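/- Let $f\ge 1$ be an odd integer, let $S\cong \operatorname{PSL}_2(3^f)$, identify $S$ with $\operatorname{Inn}(S)\le\operatorname{Aut}(S)$, and let $S<G\le \operatorname{Aut}(S)$. An element $x\in G$ is called rational in $G$ if it is conjugate in $G$ to every generator of $\langle x\rangle$; an irreducible complex character $\chi$ of $G$ is called rational if $\chi(g)\in\mathbb{Q}$ for all $g\in G$. (a) $G$ has a rational element $x\in S$ with $x\neq 1$ and $x$ of odd order if and only if $G$ has a rational irreducible character of even degree not containing $S$ in its kernel. (b) If there is a subgroup $H$ with $S<H\le G$ and $H\cong\operatorname{PGL}_2(3^f)$, then $G$ has a rational irreducible character of even degree not containing $S$ in its kernel, and $G$ has a rational element $x\in S$ with $x\neq 1$ and $x$ of odd order. -/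

import Mathlib

/-- An element `x` of a group is rational if it is conjugate to every generator of the cyclic
group `⟨x⟩`. -/
def IsRationalElement {G : Type*} [Group G] (x : G) : Prop :=
  ∀ y : G, Subgroup.zpowers y = Subgroup.zpowers x → IsConj x y

/-- `χ` is the character of an irreducible finite-dimensional complex representation of `G`. -/
def IsIrreducibleCharacter {G : Type*} [Group G] (χ : G → ℂ) : Prop :=
  ∃ (V : Type) (_ : AddCommGroup V) (_ : Module ℂ V) (_ : FiniteDimensional ℂ V)
    (ρ : Representation ℂ G V), ρ.IsIrreducible ∧ ρ.character = χ

/-- All values of `χ` are rational numbers. -/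
def IsRationalCharacter {G : Type*} (χ : G → ℂ) : Prop :=
  ∀ g : G, ∃ r : ℚ, χ g = (r : ℂ)

/-- The degree `χ(1)` is an even natural number. -/
def HasEvenDegree {G : Type*} [Group G] (χ : G → ℂ) : Prop :=
  ∃ d : ℕ, Even d ∧ χ 1 = (d : ℂ)

/-- The kernel `{g | χ(g) = χ(1)}` of a character. -/
def characterKernel {G : Type*} [Group G] (χ : G → ℂ) : Set G :=
  {g | χ g = χ 1}

/-- The group `Inn(S)` of inner automorphisms, as a subgroup of `Aut(S)`. -/
def innerAut (S : Type*) [Group S] : Subgroup (MulAut S) :=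
  (MulAut.conj : S →* MulAut S).range

/-- `G ≤ Aut(S)` has a nontrivial rational element of odd order lying in `Inn(S)`. -/
def HasRationalOddElement {S : Type*} [Group S] (G : Subgroup (MulAut S)) : Prop :=
  ∃ x : G, (x : MulAut S) ∈ innerAut S ∧ x ≠ 1 ∧ Odd (orderOf x) ∧ IsRationalElement x

/-- `G ≤ Aut(S)` has a rational irreducible character of even degree whose kernel does not
contain `Inn(S)`. -/
def HasRationalEvenCharacter {S : Type*} [Group S] (G : Subgroup (MulAut S)) : Prop :=
  ∃ χ : G → ℂ, IsIrreducibleCharacter χ ∧ IsRationalCharacter χ ∧ HasEvenDegree χ ∧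
    ¬ (((innerAut S).subgroupOf G : Set G) ⊆ characterKernel χ)

/-! Put q = 3^f. Since f is odd, q ≡ 3 mod 8 and -1 is not a square in F_q. Hence the elements of
order 3 in S form two classes, interchanged by inversion. Every other element is conjugate into one
of two cyclic tori, T₁ of order (q-1)/2 and T₂ of order (q+1)/2, and is conjugate to its inverse
(`TorusDecomposition`). Up to inner automorphisms, an automorphism of S acts on elementary matrices
by x ↦ ±ρ(x) with ρ a field automorphism. So Out(S) is abelian, and a group between Inn(S) and
Aut(S) that preserves the class of an element u of order 3 contains Inn(S) with odd index
(`IsPSL2.exists_card_eq`). Everything depends on whether G carries u into the class of u⁻¹.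

If it does, both properties hold. The element u is itself rational. For a nonreal irreducible
character ψ of S, the difference of ψ and its conjugate lives on the elements of order 3. Hence ψ is
fixed by the stabilizer K of the class of u, is sent to its conjugate by G \ K, and has no further
Galois conjugates. A distinguished irreducible character of K over ψ induces to a rational
irreducible character of G, of even degree because |G : K| = 2. A group isomorphic to PGL₂(q) has
order 2|S|, so above Inn(S) it cannot preserve the class of u; this gives (b).

If it does not, |G : S| is odd. By Clifford theory, G has a rational irreducible character of even
degree exactly when S has a real irreducible character of even degree whose Galois conjugates are
all G-conjugate. The real irreducible characters of even degree of S are attached to nonreal linear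
characters θ of the tori (`TorusDecomposition.exists_eq_torusChar`). They have degree q ± 1 and are
obtained, up to sign, by subtracting from the induced character of θ a fixed generalized character
induced from a Sylow 3-subgroup (`unipotentChar`). Galois automorphisms raise the values of θ to
powers, and the relevant automorphisms of S raise the elements of the torus to powers. So fusing the
Galois conjugates of such a character is the same problem as fusing the generators of a subgroup of
odd order of the torus (`TorusOfSign.exists_fused_powers`, `TorusOfSign.exists_fused_torusChar`).

Both cases rest on `NormalEmbedding.exists_unique_fixed`, a twisted form of the fact that over a
real irreducible character of a normal subgroup of odd index there lies exactly one real irreducible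
character, and with odd multiplicity. Existence is a parity argument, and uniqueness is a count
based on Brauer's permutation lemma. Uniqueness is what transports rationality. -/

/-! ### Characters of finite groups: Schur's lemma and completeness. -/

section CharacterTheory

variable {G : Type*} [Group G]

/-- A function on a group that is constant on conjugacy classes. -/
def IsClassFunction (f : G → ℂ) : Prop := ∀ x g, f (x * g * x⁻¹) = f g

/-- `f` is the character of a finite-dimensional complex representation. -/
def IsCharacter (f : G → ℂ) : Prop :=
  ∃ (V : Type) (_ : AddCommGroup V) (_ : Module ℂ V) (_ : FiniteDimensional ℂ V)
    (ρ : Representation ℂ G V), ρ.character = f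

/-- The bilinear form `(f, g) ↦ |G|⁻¹ ∑ f(x) g(x⁻¹)` on complex functions on a finite group. -/
noncomputable def cf [Finite G] : LinearMap.BilinForm ℂ (G → ℂ) :=
  letI := Fintype.ofFinite G
  LinearMap.mk₂ ℂ (fun f g => (Nat.card G : ℂ)⁻¹ * ∑ x, f x * g x⁻¹)
    (by intro a b c; simp only [Pi.add_apply, add_mul, Finset.sum_add_distrib, mul_add])
    (by intro a b c; simp only [Pi.smul_apply, smul_eq_mul, mul_assoc, ← Finset.mul_sum]; ring)
    (by intro a b c; simp only [Pi.add_apply, mul_add, Finset.sum_add_distrib])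
    (by
      intro a b c
      simp only [Pi.smul_apply, smul_eq_mul, mul_left_comm _ a, ← Finset.mul_sum])

theorem cf_apply [Fintype G] (f g : G → ℂ) :
    cf f g = (Nat.card G : ℂ)⁻¹ * ∑ x, f x * g x⁻¹ := by
  simp only [cf, LinearMap.mk₂_apply]
  congr! 2
  exact Finset.ext fun x => by simp

theorem card_ne_zero_complex [Finite G] : (Nat.card G : ℂ) ≠ 0 := by
  simpa using Nat.card_pos.ne'

theorem cf_comm [Finite G] (f g : G → ℂ) : cf f g = cf g f := by
  cases nonempty_fintype G
  rw [cf_apply, cf_apply]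
  congr 1
  rw [← Equiv.sum_comp (Equiv.inv G)]
  simp [mul_comm]

theorem IsIrreducibleCharacter.isCharacter {χ : G → ℂ} (h : IsIrreducibleCharacter χ) :
    IsCharacter χ := by
  obtain ⟨V, i1, i2, i3, ρ, _, h2⟩ := h
  exact ⟨V, i1, i2, i3, ρ, h2⟩

theorem IsCharacter.isClassFunction {χ : G → ℂ} (h : IsCharacter χ) : IsClassFunction χ := by
  obtain ⟨V, i1, i2, i3, ρ, rfl⟩ := h
  intro x g
  simp

theorem IsCharacter.apply_one {χ : G → ℂ} (h : IsCharacter χ) : ∃ n : ℕ, χ 1 = n := by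
  obtain ⟨V, i1, i2, i3, ρ, rfl⟩ := h
  exact ⟨_, ρ.char_one⟩

theorem IsIrreducibleCharacter.apply_one {χ : G → ℂ} (h : IsIrreducibleCharacter χ) :
    ∃ n : ℕ, 0 < n ∧ χ 1 = n := by
  obtain ⟨V, i1, i2, i3, ρ, h1, rfl⟩ := h
  refine ⟨_, ?_, ρ.char_one⟩
  rw [Module.finrank_pos_iff]
  have : Nontrivial (Subrepresentation ρ) := inferInstance
  by_contra hV
  rw [not_nontrivial_iff_subsingleton] at hV
  obtain ⟨p, q, hpq⟩ := this
  exact hpq (SetLike.ext fun x => by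
    rw [Subsingleton.elim x 0]
    exact iff_of_true p.toSubmodule.zero_mem q.toSubmodule.zero_mem)

theorem IsCharacter.comp {H : Type*} [Group H] {χ : G → ℂ} (h : IsCharacter χ) (e : H →* G) :
    IsCharacter (χ ∘ e) := by
  obtain ⟨V, i1, i2, i3, ρ, rfl⟩ := h
  exact ⟨V, i1, i2, i3, ρ.comp e, rfl⟩

theorem IsCharacter.inv {χ : G → ℂ} (h : IsCharacter χ) : IsCharacter (fun g => χ g⁻¹) := by
  obtain ⟨V, i1, i2, i3, ρ, rfl⟩ := h
  exact ⟨Module.Dual ℂ V, inferInstance, inferInstance, inferInstance, ρ.dual,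
    funext fun g => ρ.char_dual g⟩

/-- In a basis the representation consists of matrices, and σ can be applied to their entries. -/
theorem IsCharacter.ringEquiv {χ : G → ℂ} (h : IsCharacter χ) (σ : ℂ ≃+* ℂ) :
    IsCharacter (σ ∘ χ) := by
  obtain ⟨V, i1, i2, i3, ρ, rfl⟩ := h
  let b := Module.finBasis ℂ V
  let m : G →* Matrix (Fin (Module.finrank ℂ V)) (Fin (Module.finrank ℂ V)) ℂ :=
    ((σ : ℂ →+* ℂ).mapMatrix.toMonoidHom).comp
      ((LinearMap.toMatrixAlgEquiv b).toAlgHom.toRingHom.toMonoidHom.comp ρ)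
  refine ⟨Fin (Module.finrank ℂ V) → ℂ, inferInstance, inferInstance, inferInstance,
    (Matrix.toLinAlgEquiv').toAlgHom.toRingHom.toMonoidHom.comp m, ?_⟩
  funext g
  simp only [Representation.character, Function.comp_apply]
  rw [LinearMap.trace_eq_matrix_trace ℂ b (ρ g)]
  change LinearMap.trace ℂ _ (Matrix.toLin' (m g)) = _
  rw [Matrix.trace_toLin'_eq, AddMonoidHom.map_trace]
  rfl

theorem isCharacter_monoidHom (θ : G →* ℂ) : IsCharacter θ := by
  refine ⟨ℂ, inferInstance, inferInstance, inferInstance,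
    (algebraMap ℂ (Module.End ℂ ℂ) : ℂ →* _).comp θ, ?_⟩
  funext g
  simp [Representation.character, Algebra.algebraMap_eq_smul_one]

theorem IsCharacter.cf_nat [Finite G] {χ ψ : G → ℂ} (h : IsCharacter χ) (h' : IsCharacter ψ) :
    ∃ n : ℕ, cf χ ψ = n := by
  cases nonempty_fintype G
  obtain ⟨V, i1, i2, i3, ρ, rfl⟩ := h
  obtain ⟨V', j1, j2, j3, ρ', rfl⟩ := h'
  have : Invertible (Nat.card G : ℂ) := invertibleOfNonzero card_ne_zero_complex
  exact ⟨_, by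
    rw [cf_apply]
    exact Representation.card_inv_mul_sum_char_mul_char_eq_finrank ρ' ρ⟩

theorem IsIrreducibleCharacter.cf_eq [Finite G] {χ ψ : G → ℂ} (h : IsIrreducibleCharacter χ)
    (h' : IsIrreducibleCharacter ψ) [Decidable (χ = ψ)] : cf χ ψ = if χ = ψ then 1 else 0 := by
  cases nonempty_fintype G
  have : Invertible (Nat.card G : ℂ) := invertibleOfNonzero card_ne_zero_complex
  obtain ⟨V, i1, i2, i3, ρ, r1, rfl⟩ := h
  obtain ⟨V', j1, j2, j3, ρ', r2, rfl⟩ := h'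
  rw [cf_apply]
  split_ifs with hh
  · rw [← hh, Representation.char_orthonormal ρ ρ, if_pos ⟨Representation.Equiv.refl ρ⟩]
  · rw [Representation.char_orthonormal ρ ρ', if_neg]
    rintro ⟨e⟩
    exact hh (Representation.char_iso e).symm

theorem IsIrreducibleCharacter.cf_self [Finite G] {χ : G → ℂ} (h : IsIrreducibleCharacter χ) :
    cf χ χ = 1 := by
  classical rw [h.cf_eq h, if_pos rfl]

theorem IsIrreducibleCharacter.cf_ne [Finite G] {χ ψ : G → ℂ} (h : IsIrreducibleCharacter χ)
    (h' : IsIrreducibleCharacter ψ) (hne : χ ≠ ψ) : cf χ ψ = 0 := by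
  classical rw [h.cf_eq h', if_neg hne]

/-- A class function orthogonal to the character of an irreducible representation acts on it
as zero. -/
theorem sum_smul_eq_zero [Fintype G] {V : Type*} [AddCommGroup V] [Module ℂ V]
    [FiniteDimensional ℂ V] (ρ : Representation ℂ G V) [ρ.IsIrreducible] {f : G → ℂ}
    (hf : IsClassFunction f) (h : cf f ρ.character = 0) : ∑ x, f x • ρ x⁻¹ = 0 := by
  let A : Representation.IntertwiningMap ρ ρ :=
    { toLinearMap := ∑ x, f x • ρ x⁻¹
      isIntertwining' := by
        intro g
        change (∑ x, f x • ρ x⁻¹) * ρ g = ρ g * (∑ x, f x • ρ x⁻¹)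
        rw [Finset.sum_mul, Finset.mul_sum, ← Equiv.sum_comp (MulAut.conj g).toEquiv]
        refine Finset.sum_congr rfl fun x _ => ?_
        simp only [MulEquiv.toEquiv_eq_coe, EquivLike.coe_coe, MulAut.conj_apply, hf g x,
          smul_mul_assoc, mul_smul_comm, ← map_mul]
        congr 2
        group }
  -- Schur's lemma makes the operator a scalar. Its trace is a multiple of `cf f ρ.character`, hence
  -- zero.
  obtain ⟨c, hc⟩ :=
    (Representation.IsIrreducible.algebraMap_intertwiningMap_bijective_of_isAlgClosed
      (ρ := ρ)).2 A
  have hA : (∑ x, f x • ρ x⁻¹) = c • (1 : Module.End ℂ V) := by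
    change A.toLinearMap = _
    rw [← hc]
    rfl
  have ht : LinearMap.trace ℂ V (∑ x, f x • ρ x⁻¹) = 0 := by
    rw [cf_apply, mul_eq_zero, or_iff_right (inv_ne_zero card_ne_zero_complex)] at h
    simpa [map_sum, Representation.character] using h
  rw [hA] at ht ⊢
  simp only [map_smul, LinearMap.trace_one, smul_eq_mul, mul_eq_zero, Nat.cast_eq_zero] at ht
  rcases ht with rfl | ht
  · simp
  · have := Module.finrank_zero_iff.1 ht
    exact Subsingleton.elim _ _

theorem IsIrreducibleCharacter.mulEquiv {H : Type*} [Group H] {χ : G → ℂ}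
    (h : IsIrreducibleCharacter χ) (e : H ≃* G) : IsIrreducibleCharacter (χ ∘ e) := by
  obtain ⟨V, i1, i2, i3, ρ, r1, rfl⟩ := h
  refine ⟨V, i1, i2, i3, ρ.comp e.toMonoidHom, ?_, rfl⟩
  let o : Subrepresentation (ρ.comp e.toMonoidHom) ≃o Subrepresentation ρ :=
    { toFun := fun p => ⟨p.toSubmodule, fun g v hv => by
        have := p.apply_mem_toSubmodule (e.symm g) hv
        simpa using this⟩
      invFun := fun p => ⟨p.toSubmodule, fun g v hv => p.apply_mem_toSubmodule (e g) hv⟩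
      left_inv := fun p => rfl
      right_inv := fun p => rfl
      map_rel_iff' := Iff.rfl }
  exact o.isSimpleOrder_iff.2 r1

theorem IsAtom.isIrreducible_toRepresentation {V : Type*} [AddCommGroup V] [Module ℂ V]
    {ρ : Representation ℂ G V} {Q : Subrepresentation ρ} (hQ : IsAtom Q) :
    Q.toRepresentation.IsIrreducible := by
  let m : Subrepresentation Q.toRepresentation → Subrepresentation ρ := fun p =>
    ⟨p.toSubmodule.map Q.toSubmodule.subtype, by
      rintro g _ ⟨w, hw, rfl⟩
      exact ⟨_, p.apply_mem_toSubmodule g hw, rfl⟩⟩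
  have hm : ∀ p, m p ≤ Q := by
    rintro p _ ⟨w, _, rfl⟩
    exact w.2
  have hmem : ∀ p (w : Q.toSubmodule), (w : V) ∈ m p → w ∈ p := by
    rintro p w ⟨w', hw', h⟩
    rw [← Subtype.ext h]
    exact hw'
  have hmem' : ∀ p (w : Q.toSubmodule), w ∈ p → (w : V) ∈ m p := fun p w hw => ⟨w, hw, rfl⟩
  refine { exists_pair_ne := ⟨⊥, ⊤, fun h => hQ.1 ?_⟩, eq_bot_or_eq_top := fun p => ?_ }
  · rw [eq_bot_iff]
    intro v hv
    have h1 : (⟨v, hv⟩ : Q.toSubmodule) ∈ (⊤ : Subrepresentation Q.toRepresentation) :=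
      Submodule.mem_top
    rw [← h] at h1
    have h2 : (⟨v, hv⟩ : Q.toSubmodule) = 0 := (Submodule.mem_bot ℂ).1 h1
    exact (Submodule.mem_bot ℂ).2 (congrArg Subtype.val h2)
  · rcases hQ.le_iff.1 (hm p) with h | h
    · left
      rw [eq_bot_iff]
      intro w hw
      have h1 := hmem' p w hw
      rw [h] at h1
      exact (Submodule.mem_bot ℂ).2 (Subtype.ext ((Submodule.mem_bot ℂ).1 h1))
    · right
      rw [eq_top_iff]
      intro w _
      refine hmem p w ?_
      rw [h]
      exact w.2

/-- The kernel of the operator is a subrepresentation with a complement by Maschke. A nonzero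
complement would contain an irreducible representation, on which the operator vanishes. -/
theorem sum_smul_eq_zero_of_forall [Fintype G] {V : Type} [AddCommGroup V] [Module ℂ V]
    [FiniteDimensional ℂ V] (ρ : Representation ℂ G V) {f : G → ℂ} (hf : IsClassFunction f)
    (h : ∀ χ, IsIrreducibleCharacter χ → cf f χ = 0) : ∑ x, f x • ρ x⁻¹ = 0 := by
  have : NeZero (Nat.card G : ℂ) := ⟨card_ne_zero_complex⟩
  let A := ∑ x, f x • ρ x⁻¹
  have hA : ∀ g, A * ρ g = ρ g * A := by
    intro g
    simp only [A]
    rw [Finset.sum_mul, Finset.mul_sum, ← Equiv.sum_comp (MulAut.conj g).toEquiv]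
    refine Finset.sum_congr rfl fun x _ => ?_
    simp only [MulEquiv.toEquiv_eq_coe, EquivLike.coe_coe, MulAut.conj_apply, hf g x,
      smul_mul_assoc, mul_smul_comm, ← map_mul]
    congr 2
    group
  let K : Subrepresentation ρ := ⟨LinearMap.ker A, fun g v hv => by
    rw [LinearMap.mem_ker] at *
    have := LinearMap.congr_fun (hA g) v
    simp only [Module.End.mul_apply] at this
    rw [this, hv, map_zero]⟩
  have hwf : WellFoundedLT (Subrepresentation ρ) :=
    StrictMono.wellFoundedLT (f := Subrepresentation.toSubmodule)
      (Monotone.strictMono_of_injective (fun _ _ h => h) Subrepresentation.toSubmodule_injective)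
  have : IsAtomic (Subrepresentation ρ) := isAtomic_of_orderBot_wellFounded_lt hwf.wf
  have : Representation.IsSemisimpleRepresentation ρ := inferInstance
  obtain ⟨Q, hQ⟩ := exists_isCompl K
  rcases eq_bot_or_exists_atom_le Q with hb | ⟨a, ha, haQ⟩
  · have hK : K = ⊤ := by
      have := hQ.sup_eq_top
      rwa [hb, sup_bot_eq] at this
    refine LinearMap.ext fun v => ?_
    have : v ∈ K := by
      rw [hK]
      exact Submodule.mem_top
    exact LinearMap.mem_ker.1 this
  · exfalso
    refine ha.1 (le_bot_iff.1 (hQ.disjoint ?_ haQ))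
    intro v hv
    have := ha.isIrreducible_toRepresentation
    have h0 := sum_smul_eq_zero a.toRepresentation hf
      (h _ ⟨_, inferInstance, inferInstance, inferInstance, _, this, rfl⟩)
    have h1 := congrArg Subtype.val (LinearMap.congr_fun h0 ⟨v, hv⟩)
    refine LinearMap.mem_ker.2 ?_
    simp only [A]
    simpa [Subrepresentation.toRepresentation] using h1

/-- The regular representation is faithful on the group algebra. `G` is taken in `Type` because the
representation spaces of irreducible characters are; `IsClassFunction.eq_zero` removes this
restriction. -/
theorem IsClassFunction.eq_zero_aux {G : Type} [Group G] [Finite G] {f : G → ℂ}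
    (hf : IsClassFunction f) (h : ∀ χ, IsIrreducibleCharacter χ → cf f χ = 0) : f = 0 := by
  classical
  cases nonempty_fintype G
  let ρ : Representation ℂ G (G → ℂ) :=
    { toFun := fun g => LinearMap.funLeft ℂ ℂ (fun x => g⁻¹ * x)
      map_one' := by ext; simp
      map_mul' := fun a b => by
        refine LinearMap.ext fun v => funext fun x => ?_
        simp [LinearMap.funLeft_apply, mul_assoc] }
  have h0 := sum_smul_eq_zero_of_forall ρ hf h
  funext y
  -- Applied to the delta function at 1, the operator takes the value `f y` at `y⁻¹`.
  have h1 := congrFun (LinearMap.congr_fun h0 (Pi.single 1 1)) y⁻¹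
  simpa [ρ, LinearMap.funLeft_apply, Finset.sum_apply, Pi.single_apply, mul_inv_eq_one] using h1

end CharacterTheory

/-! ### Orthogonality relations and expansions in irreducible characters. -/

section CharacterTheory

variable {G : Type*} [Group G]

theorem cf_comp_mulEquiv {H : Type*} [Group H] [Finite G] [Finite H] (e : H ≃* G)
    (f g : G → ℂ) : cf (f ∘ e) (g ∘ e) = cf f g := by
  cases nonempty_fintype G
  cases nonempty_fintype H
  rw [cf_apply, cf_apply, Nat.card_congr e.toEquiv, ← Equiv.sum_comp e.toEquiv]
  simp

theorem IsClassFunction.comp {H : Type*} [Group H] {f : G → ℂ} (hf : IsClassFunction f)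
    (e : H →* G) : IsClassFunction (f ∘ e) := by
  intro x g
  simp [hf (e x) (e g)]

theorem IsClassFunction.eq_zero [Finite G] {f : G → ℂ}
    (hf : IsClassFunction f) (h : ∀ χ, IsIrreducibleCharacter χ → cf f χ = 0) : f = 0 := by
  have e : Shrink.{0} G ≃* G := Shrink.mulEquiv
  have : Finite (Shrink.{0} G) := Finite.of_equiv _ e.symm.toEquiv
  have h1 : f ∘ e = 0 := by
    refine IsClassFunction.eq_zero_aux (hf.comp e.toMonoidHom) fun χ hχ => ?_
    have := h _ (hχ.mulEquiv e.symm)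
    rw [← this, ← cf_comp_mulEquiv e]
    congr 1
    funext x
    simp
  funext x
  simpa using congrFun h1 (e.symm x)

theorem linearIndependent_isIrreducibleCharacter [Finite G] :
    LinearIndependent ℂ (fun χ : {χ : G → ℂ | IsIrreducibleCharacter χ} => (χ : G → ℂ)) := by
  rw [linearIndependent_iff']
  intro s c h i hi
  have h1 := congrArg (fun F => cf F (i : G → ℂ)) h
  simp only [map_sum, LinearMap.sum_apply, map_smul, LinearMap.smul_apply, map_zero,
    LinearMap.zero_apply, smul_eq_mul] at h1
  rw [Finset.sum_eq_single i] at h1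
  · rwa [i.2.cf_self, mul_one] at h1
  · intro j _ hj
    rw [j.2.cf_ne i.2 (fun h => hj (Subtype.ext h)), mul_zero]
  · exact fun h => absurd hi h

theorem finite_isIrreducibleCharacter [Finite G] :
    {χ : G → ℂ | IsIrreducibleCharacter χ}.Finite :=
  Set.finite_coe_iff.1 (linearIndependent_isIrreducibleCharacter (G := G)).finite

variable (G) in
/-- The finite set of irreducible characters. -/
noncomputable def irr [Finite G] : Finset (G → ℂ) :=
  (finite_isIrreducibleCharacter (G := G)).toFinset

@[simp] theorem mem_irr [Finite G] {χ : G → ℂ} : χ ∈ irr G ↔ IsIrreducibleCharacter χ := by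
  simp [irr]

theorem IsClassFunction.sub {f g : G → ℂ} (hf : IsClassFunction f) (hg : IsClassFunction g) :
    IsClassFunction (f - g) := fun x y => by simp [hf x y, hg x y]

theorem IsClassFunction.smul {f : G → ℂ} (hf : IsClassFunction f) (c : ℂ) :
    IsClassFunction (c • f) := fun x y => by simp [hf x y]

theorem IsClassFunction.sum {ι : Type*} {s : Finset ι} {f : ι → G → ℂ}
    (hf : ∀ i ∈ s, IsClassFunction (f i)) : IsClassFunction (∑ i ∈ s, f i) := fun x y => by
  simp only [Finset.sum_apply]
  exact Finset.sum_congr rfl fun i hi => hf i hi x y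

theorem IsIrreducibleCharacter.isClassFunction {χ : G → ℂ} (h : IsIrreducibleCharacter χ) :
    IsClassFunction χ := h.isCharacter.isClassFunction

theorem IsClassFunction.eq_sum_irr [Finite G] {f : G → ℂ} (hf : IsClassFunction f) :
    f = ∑ χ ∈ irr G, cf f χ • χ := by
  rw [← sub_eq_zero]
  refine IsClassFunction.eq_zero (hf.sub (IsClassFunction.sum fun χ hχ =>
    (mem_irr.1 hχ).isClassFunction.smul _)) fun ψ hψ => ?_
  simp only [map_sub, LinearMap.sub_apply, map_sum, LinearMap.sum_apply, map_smul,
    LinearMap.smul_apply, smul_eq_mul]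
  rw [Finset.sum_eq_single ψ, hψ.cf_self, mul_one, sub_self]
  · intro χ hχ hne
    rw [(mem_irr.1 hχ).cf_ne hψ hne, mul_zero]
  · exact fun h => absurd (mem_irr.2 hψ) h

theorem IsClassFunction.cf_eq_sum_irr [Finite G] {f : G → ℂ} (hf : IsClassFunction f)
    (g : G → ℂ) : cf f g = ∑ χ ∈ irr G, cf f χ * cf g χ := by
  conv_lhs => rw [hf.eq_sum_irr]
  simp only [map_sum, LinearMap.sum_apply, map_smul, LinearMap.smul_apply, smul_eq_mul]
  exact Finset.sum_congr rfl fun χ _ => by rw [cf_comm χ g]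

/-- A generalized character of norm one and positive degree is irreducible. -/
theorem IsClassFunction.isIrreducibleCharacter [Finite G] {f : G → ℂ} (hf : IsClassFunction f)
    (hint : ∀ χ, IsIrreducibleCharacter χ → ∃ n : ℤ, cf f χ = n) (hnorm : cf f f = 1)
    {r : ℕ} (hr : 0 < r) (h1 : f 1 = r) : IsIrreducibleCharacter f := by
  classical
  choose! n hn using hint
  have hsum : ∑ χ ∈ irr G, n χ ^ 2 = 1 := by
    have := hf.cf_eq_sum_irr f
    rw [hnorm] at this
    have h2 : ((∑ χ ∈ irr G, n χ ^ 2 : ℤ) : ℂ) = ((1 : ℤ) : ℂ) := by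
      push_cast
      rw [this]
      exact Finset.sum_congr rfl fun χ hχ => by rw [hn χ (mem_irr.1 hχ), sq]
    exact_mod_cast h2
  obtain ⟨χ, hχ, hχ0⟩ : ∃ χ ∈ irr G, n χ ≠ 0 := by
    by_contra! h
    rw [Finset.sum_eq_zero fun χ hχ => by rw [h χ hχ]; rfl] at hsum
    exact zero_ne_one hsum
  rw [← Finset.add_sum_erase _ _ hχ] at hsum
  have hpos : 0 < n χ ^ 2 := by positivity
  have hrest : 0 ≤ ∑ ψ ∈ (irr G).erase χ, n ψ ^ 2 := Finset.sum_nonneg fun _ _ => sq_nonneg _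
  have hzero : ∑ ψ ∈ (irr G).erase χ, n ψ ^ 2 = 0 := by omega
  have hone : n χ ^ 2 = 1 := by omega
  have hfχ : f = (n χ : ℂ) • χ := by
    conv_lhs => rw [hf.eq_sum_irr]
    rw [← Finset.add_sum_erase _ _ hχ, hn χ (mem_irr.1 hχ), Finset.sum_eq_zero, add_zero]
    intro ψ hψ
    have := (Finset.sum_eq_zero_iff_of_nonneg fun _ _ => sq_nonneg _).1 hzero ψ hψ
    rw [hn ψ (mem_irr.1 (Finset.mem_of_mem_erase hψ)), pow_eq_zero_iff two_ne_zero |>.1 this]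
    simp
  obtain ⟨d, hd, hd1⟩ := (mem_irr.1 hχ).apply_one
  rcases (show n χ = 1 ∨ n χ = -1 from by simpa using hone) with h | h
  · rw [hfχ, h]
    simpa using mem_irr.1 hχ
  · exfalso
    rw [hfχ, h] at h1
    simp only [Int.cast_neg, Int.cast_one, neg_smul, one_smul, Pi.neg_apply, hd1] at h1
    have : (-(d : ℤ)) = r := by exact_mod_cast h1
    omega

theorem IsCharacter.isIrreducibleCharacter [Finite G] {f : G → ℂ} (hf : IsCharacter f)
    (hnorm : cf f f = 1) : IsIrreducibleCharacter f := by
  obtain ⟨r, hr⟩ := hf.apply_one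
  have hint : ∀ χ : G → ℂ, IsIrreducibleCharacter χ → ∃ n : ℤ, cf f χ = n := fun χ hχ => by
    obtain ⟨n, hn⟩ := hf.cf_nat hχ.isCharacter
    exact ⟨n, by simpa using hn⟩
  obtain ⟨V, i1, i2, i3, ρ, hρ⟩ := id hf
  refine hf.isClassFunction.isIrreducibleCharacter hint hnorm (Nat.pos_of_ne_zero ?_) hr
  rintro rfl
  rw [← hρ, Representation.char_one, Nat.cast_inj] at hr
  have := Module.finrank_zero_iff.1 hr
  have h0 : f = 0 := by
    rw [← hρ]
    funext g
    simp [Representation.character, Subsingleton.elim (ρ g) 0]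
  rw [h0] at hnorm
  simp at hnorm

theorem IsIrreducibleCharacter.ringEquiv [Finite G] {χ : G → ℂ} (h : IsIrreducibleCharacter χ)
    (σ : ℂ ≃+* ℂ) : IsIrreducibleCharacter (σ ∘ χ) := by
  refine (h.isCharacter.ringEquiv σ).isIrreducibleCharacter ?_
  have h1 := congrArg σ h.cf_self
  cases nonempty_fintype G
  rw [cf_apply] at *
  simpa using h1

theorem cf_ringEquiv [Finite G] (σ : ℂ ≃+* ℂ) (f g : G → ℂ) :
    cf (σ ∘ f) (σ ∘ g) = σ (cf f g) := by
  cases nonempty_fintype G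
  simp [cf_apply]

theorem cf_inv [Finite G] (f g : G → ℂ) :
    cf (fun x => f x⁻¹) (fun x => g x⁻¹) = cf f g := by
  cases nonempty_fintype G
  rw [cf_apply, cf_apply, ← Equiv.sum_comp (Equiv.inv G)]
  simp

theorem IsIrreducibleCharacter.inv [Finite G] {χ : G → ℂ} (h : IsIrreducibleCharacter χ) :
    IsIrreducibleCharacter (fun g => χ g⁻¹) :=
  h.isCharacter.inv.isIrreducibleCharacter (by rw [cf_inv, h.cf_self])

theorem isIrreducibleCharacter_monoidHom [Finite G] (θ : G →* ℂ) : IsIrreducibleCharacter θ := by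
  refine (isCharacter_monoidHom θ).isIrreducibleCharacter ?_
  cases nonempty_fintype G
  rw [cf_apply]
  simp only [← map_mul, mul_inv_cancel, map_one, Finset.sum_const, Finset.card_univ,
    nsmul_eq_mul, mul_one, ← Nat.card_eq_fintype_card]
  exact inv_mul_cancel₀ card_ne_zero_complex

theorem isIrreducibleCharacter_one [Finite G] :
    IsIrreducibleCharacter (1 : G → ℂ) := isIrreducibleCharacter_monoidHom (1 : G →* ℂ)

theorem IsIrreducibleCharacter.exists_monoidHom [Finite G] (hG : ∀ a b : G, a * b = b * a)
    {χ : G → ℂ} (h : IsIrreducibleCharacter χ) : ∃ θ : G →* ℂ, ⇑θ = χ := by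
  obtain ⟨V, i1, i2, i3, ρ, r1, rfl⟩ := h
  have : IsMulCommutative G := ⟨⟨hG⟩⟩
  have hd : Module.finrank ℂ V = 1 :=
    Representation.IsIrreducible.finrank_eq_one_of_isMulCommutative ρ
  have hs : ∀ A : Module.End ℂ V, A = LinearMap.trace ℂ V A • 1 := by
    intro A
    obtain ⟨c, hc⟩ : ∃ c : ℂ, A = c • 1 := by
      obtain ⟨v, hv, hv'⟩ := finrank_eq_one_iff'.1 hd
      obtain ⟨c, hc⟩ := hv' (A v)
      refine ⟨c, LinearMap.ext fun w => ?_⟩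
      obtain ⟨a, rfl⟩ := hv' w
      simp [← hc, smul_comm a c]
    rw [hc]
    simp [hd]
  refine ⟨{ toFun := ρ.character, map_one' := by simp [hd], map_mul' := fun a b => ?_ }, rfl⟩
  simp only [Representation.character, map_mul]
  rw [hs (ρ a), hs (ρ b)]
  simp [hd, mul_comm]

/-- Column orthogonality: `∑ ψ(a) ψ(b⁻¹)` is the number of elements conjugating `a` to `b`. -/
theorem sum_irr_mul_inv [Finite G] (a b : G) :
    ∑ ψ ∈ irr G, ψ a * ψ b⁻¹ = (Nat.card {x : G // x * a * x⁻¹ = b} : ℂ) := by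
  classical
  cases nonempty_fintype G
  -- This is a multiple of the indicator of the class of `b`, and its coefficient at ψ is `ψ b⁻¹`.
  let f : G → ℂ := fun a => ∑ x, if x * a * x⁻¹ = b then 1 else 0
  have hf : IsClassFunction f := by
    intro y g
    simp only [f]
    rw [← Equiv.sum_comp (Equiv.mulRight y⁻¹)]
    refine Finset.sum_congr rfl fun x _ => ?_
    simp [mul_assoc]
  have hcf : ∀ ψ ∈ irr G, cf f ψ = ψ b⁻¹ := by
    intro ψ hψ
    rw [cf_apply]
    simp only [f, Finset.sum_mul]
    rw [Finset.sum_comm]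
    have : ∀ x ∈ (Finset.univ : Finset G),
        ∑ y, (if x * y * x⁻¹ = b then (1 : ℂ) else 0) * ψ y⁻¹ = ψ b⁻¹ := by
      intro x _
      rw [Finset.sum_eq_single (x⁻¹ * b * x)]
      · have := (mem_irr.1 hψ).isClassFunction x⁻¹ b⁻¹
        simpa [mul_assoc] using this
      · intro y _ hy
        rw [if_neg, zero_mul]
        rintro rfl
        exact hy (by group)
      · simp
    rw [Finset.sum_congr rfl this]
    simp only [Finset.sum_const, Finset.card_univ, nsmul_eq_mul, ← Nat.card_eq_fintype_card]
    rw [inv_mul_cancel_left₀ card_ne_zero_complex]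
  have h := congrFun hf.eq_sum_irr a
  simp only [Finset.sum_apply, Pi.smul_apply, smul_eq_mul] at h
  rw [Finset.sum_congr rfl fun ψ hψ => by rw [mul_comm, ← hcf ψ hψ], ← h]
  simp [f, Finset.sum_boole, Nat.card_eq_fintype_card, Fintype.card_subtype]

end CharacterTheory

/-! ### Automorphisms of the complex field. -/

section FieldAutomorphisms

open Cardinal in
-- Over a countable field, transcendence bases of `L` and `M` have the cardinality of the fields. A
-- bijection between them identifies the purely transcendental parts, and this extends to the
-- algebraic closures.
theorem exists_ringEquiv_commutes {K L M : Type} [Field K] [Countable K] [Field L] [Field M]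
    [Algebra K L] [Algebra K M] [IsAlgClosed L] [IsAlgClosed M] (hL : ℵ₀ < #L)
    (hLM : #L = #M) : ∃ σ : L ≃+* M, ∀ k : K, σ (algebraMap K L k) = algebraMap K M k := by
  obtain ⟨s, hs⟩ := exists_isTranscendenceBasis K L
  obtain ⟨t, ht⟩ := exists_isTranscendenceBasis K M
  have hK : #K ≤ ℵ₀ := mk_le_aleph0
  have h1 := IsAlgClosed.cardinal_eq_cardinal_transcendence_basis_of_aleph0_lt' _ hs hK hL
  have h2 := IsAlgClosed.cardinal_eq_cardinal_transcendence_basis_of_aleph0_lt' _ ht hK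
    (hLM ▸ hL)
  obtain ⟨e⟩ := Cardinal.eq.1 (h1.symm.trans (hLM.trans h2))
  have := IsAlgClosed.isAlgClosure_of_transcendence_basis _ hs
  have := IsAlgClosed.isAlgClosure_of_transcendence_basis _ ht
  let E : Algebra.adjoin K (Set.range ((↑) : s → L)) ≃ₐ[K]
      Algebra.adjoin K (Set.range ((↑) : t → M)) :=
    (hs.1.aevalEquiv.symm.trans (MvPolynomial.renameEquiv K e)).trans ht.1.aevalEquiv
  refine ⟨IsAlgClosure.equivOfEquiv L M E.toRingEquiv, fun k => ?_⟩
  rw [IsScalarTower.algebraMap_apply K (Algebra.adjoin K (Set.range ((↑) : s → L))) L,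
    IsAlgClosure.equivOfEquiv_algebraMap]
  change algebraMap _ M (E (algebraMap K _ k)) = _
  rw [AlgEquiv.commutes, ← IsScalarTower.algebraMap_apply]

theorem exists_ringEquiv_complex_commutes {K : Type} [Field K] [Countable K] (i j : K →+* ℂ) :
    ∃ σ : ℂ ≃+* ℂ, ∀ k, σ (i k) = j k :=
  @exists_ringEquiv_commutes K ℂ ℂ _ _ _ _ i.toAlgebra j.toAlgebra _ _
    (by rw [Cardinal.mk_complex]; exact Cardinal.aleph0_lt_continuum) rfl

theorem exists_ringEquiv_of_minpoly_eq {z w : ℂ} (hz : IsIntegral ℚ z)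
    (h : minpoly ℚ z = minpoly ℚ w) : ∃ σ : ℂ ≃+* ℂ, σ z = w := by
  have : FiniteDimensional ℚ (IntermediateField.adjoin ℚ {z}) :=
    IntermediateField.adjoin.finiteDimensional hz
  have : Countable (IntermediateField.adjoin ℚ {z}) :=
    (Module.finBasis ℚ (IntermediateField.adjoin ℚ {z})).equivFun.toEquiv.countable_iff.2
      inferInstance
  have hw : IsIntegral ℚ w := by
    rw [← minpoly.ne_zero_iff, ← h]
    exact minpoly.ne_zero hz
  let j := (IntermediateField.algHomAdjoinIntegralEquiv ℚ (K := ℂ) hz).symm ⟨w, by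
    rw [h, Polynomial.mem_aroots]
    exact ⟨minpoly.ne_zero hw, minpoly.aeval ℚ w⟩⟩
  obtain ⟨σ, hσ⟩ := exists_ringEquiv_complex_commutes
    (algebraMap (IntermediateField.adjoin ℚ {z}) ℂ) j.toRingHom
  refine ⟨σ, ?_⟩
  have h1 := hσ (IntermediateField.AdjoinSimple.gen ℚ z)
  rw [IntermediateField.AdjoinSimple.algebraMap_gen] at h1
  rw [h1]
  exact IntermediateField.algHomAdjoinIntegralEquiv_symm_apply_gen ℚ hz _

/-- All roots of the minimal polynomial are images of `z` under automorphisms of ℂ, so a fixed `z`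
is the only root, and by separability the degree is one. -/
theorem exists_rat_of_forall_ringEquiv {z : ℂ} (hz : IsIntegral ℚ z)
    (h : ∀ σ : ℂ ≃+* ℂ, σ z = z) : ∃ r : ℚ, z = r := by
  have hirr := minpoly.irreducible hz
  have hcard := Polynomial.card_rootSet_eq_natDegree (K := ℂ) hirr.separable
    (IsAlgClosed.splits _)
  have hsub : ∀ w ∈ (minpoly ℚ z).rootSet ℂ, w = z := by
    intro w hw
    have hw' := (Polynomial.mem_rootSet.1 hw).2
    have := minpoly.eq_of_irreducible_of_monic hirr hw' (minpoly.monic hz)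
    obtain ⟨σ, hσ⟩ := exists_ringEquiv_of_minpoly_eq hz this
    rw [← hσ, h]
  have hle : (minpoly ℚ z).natDegree ≤ 1 := by
    rw [← hcard, Fintype.card_le_one_iff]
    exact fun a b => Subtype.ext ((hsub _ a.2).trans (hsub _ b.2).symm)
  have hdeg : (minpoly ℚ z).degree = 1 := by
    have h1 := minpoly.natDegree_pos hz
    rw [Polynomial.degree_eq_natDegree (minpoly.ne_zero hz)]
    exact_mod_cast le_antisymm hle h1
  obtain ⟨r, hr⟩ := minpoly.mem_range_of_degree_eq_one ℚ z hdeg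
  exact ⟨r, by simpa using hr.symm⟩

theorem exists_ringEquiv_pow {n : ℕ} [NeZero n] {ζ : ℂ} (hζ : IsPrimitiveRoot ζ n) {k : ℕ}
    (hk : k.Coprime n) : ∃ σ : ℂ ≃+* ℂ, σ ζ = ζ ^ k := by
  have hn : 0 < n := Nat.pos_of_ne_zero (NeZero.ne n)
  refine exists_ringEquiv_of_minpoly_eq ((hζ.isIntegral hn).tower_top) ?_
  rw [← Polynomial.cyclotomic_eq_minpoly_rat hζ hn,
    ← Polynomial.cyclotomic_eq_minpoly_rat (hζ.pow_of_coprime k hk) hn]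

end FieldAutomorphisms

/-! ### Values of characters as sums of roots of unity. -/

section CharacterValues

variable {G : Type*} [Group G]

theorem exists_pow_eq_one_monoidHom [Finite G] (θ : G →* ℂ) (g : G) :
    θ g ^ Nat.card G = 1 := by
  rw [← map_pow, pow_card_eq_one', map_one]

theorem norm_monoidHom [Finite G] (θ : G →* ℂ) (g : G) : ‖θ g‖ = 1 :=
  Complex.norm_eq_one_of_pow_eq_one (exists_pow_eq_one_monoidHom θ g) Nat.card_pos.ne'

theorem monoidHom_inv [Finite G] (θ : G →* ℂ) (g : G) : θ g⁻¹ = starRingEnd ℂ (θ g) := by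
  have h : θ g⁻¹ * θ g = 1 := by rw [← map_mul, inv_mul_cancel, map_one]
  rw [eq_inv_of_mul_eq_one_left h, Complex.inv_def, Complex.normSq_eq_norm_sq,
    norm_monoidHom]
  simp

theorem IsCharacter.exists_eq_sum_monoidHom [Finite G] (hG : ∀ a b : G, a * b = b * a)
    {χ : G → ℂ} (h : IsCharacter χ) : ∃ (s : Finset (G → ℂ)) (n : (G → ℂ) → ℕ),
      (∀ ψ ∈ s, ∃ θ : G →* ℂ, ⇑θ = ψ) ∧ χ = ∑ ψ ∈ s, (n ψ : ℂ) • ψ := by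
  have hn : ∀ ψ ∈ irr G, ∃ n : ℕ, cf χ ψ = n := fun ψ hψ =>
    h.cf_nat (mem_irr.1 hψ).isCharacter
  choose! n hn using hn
  refine ⟨irr G, n, fun ψ hψ => (mem_irr.1 hψ).exists_monoidHom hG, ?_⟩
  conv_lhs => rw [h.isClassFunction.eq_sum_irr]
  exact Finset.sum_congr rfl fun ψ hψ => by rw [hn ψ hψ]

/-- Restriction to a cyclic subgroup reduces questions about a single value to linear characters,
that is, to roots of unity. -/
theorem IsCharacter.exists_eq_sum_zpowers [Finite G] {χ : G → ℂ} (h : IsCharacter χ) (g : G) :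
    ∃ (s : Finset (Subgroup.zpowers g → ℂ)) (n : (Subgroup.zpowers g → ℂ) → ℕ),
      (∀ ψ ∈ s, ∃ θ : Subgroup.zpowers g →* ℂ, ⇑θ = ψ) ∧
      ∀ x : Subgroup.zpowers g, χ x = ∑ ψ ∈ s, (n ψ : ℂ) * ψ x := by
  obtain ⟨s, n, h1, h2⟩ := (h.comp (Subgroup.zpowers g).subtype).exists_eq_sum_monoidHom
    (fun a b => mul_comm' a b)
  refine ⟨s, n, h1, fun x => ?_⟩
  have := congrFun h2 x
  simpa using this

theorem IsCharacter.apply_inv [Finite G] {χ : G → ℂ} (h : IsCharacter χ) (g : G) :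
    χ g⁻¹ = starRingEnd ℂ (χ g) := by
  obtain ⟨s, n, h1, h2⟩ := h.exists_eq_sum_zpowers g
  have h3 := h2 ⟨g, Subgroup.mem_zpowers g⟩
  have h4 := h2 (⟨g, Subgroup.mem_zpowers g⟩)⁻¹
  simp only [InvMemClass.coe_inv] at h3 h4
  rw [h3, h4, map_sum]
  refine Finset.sum_congr rfl fun ψ hψ => ?_
  obtain ⟨θ, rfl⟩ := h1 ψ hψ
  simp [monoidHom_inv]

theorem IsCharacter.isIntegral [Finite G] {χ : G → ℂ} (h : IsCharacter χ) (g : G) :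
    IsIntegral ℚ (χ g) := by
  obtain ⟨s, n, h1, h2⟩ := h.exists_eq_sum_zpowers g
  have h3 := h2 ⟨g, Subgroup.mem_zpowers g⟩
  simp only at h3
  rw [h3]
  refine IsIntegral.sum _ fun ψ hψ => ?_
  obtain ⟨θ, rfl⟩ := h1 ψ hψ
  refine IsIntegral.mul ?_ (IsIntegral.of_pow (Nat.card_pos (α := Subgroup.zpowers g)) ?_)
  · simpa using isIntegral_algebraMap (R := ℚ) (A := ℂ) (x := (n θ : ℚ))
  · rw [exists_pow_eq_one_monoidHom]
    exact isIntegral_one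

theorem IsCharacter.isRationalCharacter [Finite G] {χ : G → ℂ} (h : IsCharacter χ)
    (hσ : ∀ σ : ℂ ≃+* ℂ, σ ∘ χ = χ) : IsRationalCharacter χ := fun g =>
  exists_rat_of_forall_ringEquiv (h.isIntegral g) fun σ => congrFun (hσ σ) g

omit [Group G] in
theorem IsRationalCharacter.ringEquiv_comp {χ : G → ℂ} (h : IsRationalCharacter χ)
    (σ : ℂ ≃+* ℂ) : σ ∘ χ = χ := by
  funext g
  obtain ⟨r, hr⟩ := h g
  simp [hr]

theorem IsRationalCharacter.apply_inv [Finite G] {χ : G → ℂ} (h : IsRationalCharacter χ)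
    (h' : IsCharacter χ) (g : G) : χ g⁻¹ = χ g := by
  obtain ⟨r, hr⟩ := h g
  rw [h'.apply_inv, hr]
  simp

end CharacterValues

/-! ### Induction of class functions along a homomorphism. -/

section Induction

variable {H K : Type*} [Group H] [Group K]

/-- The class function of `K` induced from the function `ψ` on `H` along `ι : H →* K`. -/
noncomputable def indCF [Finite H] [Finite K] (ι : H →* K) (ψ : H → ℂ) : K → ℂ := fun g =>
  letI := Fintype.ofFinite H
  letI := Fintype.ofFinite K
  letI := Classical.decEq K
  (Nat.card H : ℂ)⁻¹ * ∑ x : K, ∑ h : H, if ι h = x * g * x⁻¹ then ψ h else 0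

theorem indCF_apply [Fintype H] [Fintype K] [DecidableEq K] (ι : H →* K) (ψ : H → ℂ) (g : K) :
    indCF ι ψ g =
      (Nat.card H : ℂ)⁻¹ * ∑ x : K, ∑ h : H, if ι h = x * g * x⁻¹ then ψ h else 0 := by
  simp only [indCF]
  congr 1
  refine Finset.sum_congr (Finset.ext fun x => by simp) fun x _ => ?_
  refine Finset.sum_congr (Finset.ext fun x => by simp) fun h _ => ?_
  congr

variable [Finite H] [Finite K] (ι : H →* K)

theorem isClassFunction_indCF (ψ : H → ℂ) : IsClassFunction (indCF ι ψ) := by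
  classical
  cases nonempty_fintype H
  cases nonempty_fintype K
  intro y g
  rw [indCF_apply, indCF_apply, ← Equiv.sum_comp (Equiv.mulRight y⁻¹)]
  simp [mul_assoc]

variable {ι}

/-- Frobenius reciprocity. -/
theorem cf_indCF (ψ : H → ℂ) {f : K → ℂ} (hf : IsClassFunction f) :
    cf (indCF ι ψ) f = cf ψ (f ∘ ι) := by
  classical
  cases nonempty_fintype H
  cases nonempty_fintype K
  rw [cf_apply, cf_apply]
  simp only [indCF_apply, Finset.mul_sum, Finset.sum_mul]
  rw [Finset.sum_comm]
  have : ∀ x ∈ (Finset.univ : Finset K), ∑ g : K, ∑ h : H,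
      (Nat.card K : ℂ)⁻¹ * (((Nat.card H : ℂ)⁻¹ * if ι h = x * g * x⁻¹ then ψ h else 0) * f g⁻¹)
      = (Nat.card K : ℂ)⁻¹ * ∑ h : H, (Nat.card H : ℂ)⁻¹ * (ψ h * (f ∘ ι) h⁻¹) := by
    intro x _
    rw [Finset.sum_comm, Finset.mul_sum]
    refine Finset.sum_congr rfl fun h _ => ?_
    rw [Finset.sum_eq_single (x⁻¹ * ι h * x)]
    · rw [if_pos (by group)]
      have := hf x⁻¹ (ι h)⁻¹
      simp only [inv_inv] at this
      simp only [mul_inv_rev, inv_inv, Function.comp_apply, map_inv, mul_assoc] at this ⊢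
      rw [this]
    · intro g _ hg
      rw [if_neg, mul_zero, zero_mul, mul_zero]
      intro h'
      exact hg (by rw [h']; group)
    · simp
  rw [Finset.sum_congr rfl this, Finset.sum_const, Finset.card_univ, nsmul_eq_mul,
    ← Nat.card_eq_fintype_card, mul_inv_cancel_left₀ card_ne_zero_complex]

theorem ringEquiv_comp_indCF (σ : ℂ ≃+* ℂ) (ψ : H → ℂ) :
    σ ∘ indCF ι ψ = indCF ι (σ ∘ ψ) := by
  classical
  cases nonempty_fintype H
  cases nonempty_fintype K
  funext g
  simp [indCF_apply, apply_ite σ]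

theorem indCF_inv (ψ : H → ℂ) (g : K) : indCF ι ψ g⁻¹ = indCF ι (fun h => ψ h⁻¹) g := by
  classical
  cases nonempty_fintype H
  cases nonempty_fintype K
  rw [indCF_apply, indCF_apply]
  congr 1
  refine Finset.sum_congr rfl fun x _ => ?_
  rw [← Equiv.sum_comp (Equiv.inv H)]
  refine Finset.sum_congr rfl fun h _ => ?_
  simp only [Equiv.inv_apply, map_inv]
  congr 1
  rw [inv_eq_iff_eq_inv]
  simp [mul_assoc]

/-- Used both for outer automorphisms and for conjugations, where it shows that conjugate functions
induce the same class function. -/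
theorem indCF_mulEquiv {α : MulAut K} {β : MulAut H} (h : ∀ x, ι (β x) = α (ι x))
    (ψ : H → ℂ) (g : K) : indCF ι ψ (α g) = indCF ι (ψ ∘ β) g := by
  classical
  cases nonempty_fintype H
  cases nonempty_fintype K
  rw [indCF_apply, indCF_apply]
  congr 1
  rw [← Equiv.sum_comp α.toEquiv]
  refine Finset.sum_congr rfl fun x _ => ?_
  rw [← Equiv.sum_comp β.toEquiv]
  refine Finset.sum_congr rfl fun y _ => ?_
  simp only [MulEquiv.toEquiv_eq_coe, EquivLike.coe_coe, h, Function.comp_apply, ← map_mul,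
    ← map_inv, α.injective.eq_iff]

theorem IsCharacter.cf_indCF_nat {ψ : H → ℂ} (h : IsCharacter ψ) {χ : K → ℂ}
    (hχ : IsCharacter χ) : ∃ n : ℕ, cf (indCF ι ψ) χ = n := by
  rw [cf_indCF ψ hχ.isClassFunction]
  exact h.cf_nat (hχ.comp ι)

end Induction

/-! ### Clifford theory for a normal subgroup. -/

section Clifford

variable {N K : Type*} [Group N] [Group K]

/-- `ι` embeds `N` as a normal subgroup of `K`, and `a` is the resulting conjugation action. -/
structure NormalEmbedding (ι : N →* K) (a : K →* MulAut N) : Prop where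
  injective : Function.Injective ι
  map_act : ∀ k n, ι (a k n) = k * ι n * k⁻¹

variable {ι : N →* K} {a : K →* MulAut N}

theorem NormalEmbedding.act_map (E : NormalEmbedding ι a) (m n : N) : a (ι m) n = m * n * m⁻¹ :=
  E.injective (by simp [E.map_act])

theorem NormalEmbedding.mem_range_conj (E : NormalEmbedding ι a) {x : K} (hx : x ∈ ι.range)
    (g : K) : g * x * g⁻¹ ∈ ι.range := by
  obtain ⟨n, rfl⟩ := hx
  exact ⟨a g n, E.map_act g n⟩

theorem NormalEmbedding.comp_act (E : NormalEmbedding ι a) {f : K → ℂ} (hf : IsClassFunction f)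
    (x : K) : (f ∘ ι) ∘ a x = f ∘ ι := by
  funext n
  simp [E.map_act, hf x]

variable [Finite N] [Finite K]

theorem NormalEmbedding.indCF_map (E : NormalEmbedding ι a) [Fintype K] (ψ : N → ℂ) (n : N) :
    indCF ι ψ (ι n) = (Nat.card N : ℂ)⁻¹ * ∑ x : K, ψ (a x n) := by
  classical
  cases nonempty_fintype N
  rw [indCF_apply]
  congr 1
  refine Finset.sum_congr rfl fun x _ => ?_
  simp [← E.map_act, E.injective.eq_iff]

/-- Mackey's formula: restricting an induced function back to a normal subgroup gives a sum of
conjugates. -/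
theorem NormalEmbedding.cf_indCF_indCF (E : NormalEmbedding ι a) [Fintype K] (ψ φ : N → ℂ) :
    cf (indCF ι ψ) (indCF ι φ) = (Nat.card N : ℂ)⁻¹ * ∑ x : K, cf (ψ ∘ a x) φ := by
  rw [cf_comm, cf_indCF _ (isClassFunction_indCF _ _), cf_comm]
  have : indCF ι ψ ∘ ι = (Nat.card N : ℂ)⁻¹ • ∑ x : K, ψ ∘ a x := by
    funext n
    simp [E.indCF_map]
  rw [this, map_smul, map_sum, LinearMap.smul_apply, LinearMap.sum_apply, smul_eq_mul]

omit [Finite N] [Finite K] in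
theorem IsIrreducibleCharacter.act {ψ : N → ℂ} (h : IsIrreducibleCharacter ψ) (x : K) :
    IsIrreducibleCharacter (ψ ∘ a x) := h.mulEquiv (a x)

theorem NormalEmbedding.cf_indCF_indCF_irr (E : NormalEmbedding ι a) {ψ φ : N → ℂ}
    (hψ : IsIrreducibleCharacter ψ) (hφ : IsIrreducibleCharacter φ) :
    cf (indCF ι ψ) (indCF ι φ) =
      (Nat.card N : ℂ)⁻¹ * (Nat.card {x : K // ψ ∘ a x = φ} : ℂ) := by
  classical
  cases nonempty_fintype K
  rw [E.cf_indCF_indCF]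
  congr 1
  simp only [fun x : K => (hψ.act (a := a) x).cf_eq hφ, Finset.sum_boole,
    Nat.card_eq_fintype_card, Fintype.card_subtype]

/-- Clifford's theorem: the irreducible constituents of a restriction are conjugate. -/
theorem NormalEmbedding.exists_act_eq (E : NormalEmbedding ι a) {χ : K → ℂ}
    (hχ : IsIrreducibleCharacter χ) {ψ φ : N → ℂ} (hψ : IsIrreducibleCharacter ψ)
    (hφ : IsIrreducibleCharacter φ) (h1 : cf (χ ∘ ι) ψ ≠ 0) (h2 : cf (χ ∘ ι) φ ≠ 0) :
    ∃ x, ψ ∘ a x = φ := by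
  by_contra! hne
  have h0 : cf (indCF ι ψ) (indCF ι φ) = 0 := by
    rw [E.cf_indCF_indCF_irr hψ hφ]
    have : IsEmpty {x : K // ψ ∘ a x = φ} := ⟨fun x => hne _ x.2⟩
    simp
  rw [(isClassFunction_indCF ι ψ).cf_eq_sum_irr] at h0
  have hn : ∀ η ∈ irr K, ∃ n : ℕ, cf (indCF ι ψ) η = n := fun η hη =>
    hψ.isCharacter.cf_indCF_nat (mem_irr.1 hη).isCharacter
  have hm : ∀ η ∈ irr K, ∃ n : ℕ, cf (indCF ι φ) η = n := fun η hη =>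
    hφ.isCharacter.cf_indCF_nat (mem_irr.1 hη).isCharacter
  choose! n hn using hn
  choose! m hm using hm
  rw [Finset.sum_congr rfl fun η hη => by rw [hn η hη, hm η hη]] at h0
  -- The multiplicities are natural numbers, so a vanishing product of the two induced characters
  -- rules out a common constituent.
  have h0' : ∑ η ∈ irr K, n η * m η = 0 := by exact_mod_cast h0
  have h3 := Finset.sum_eq_zero_iff.1 h0' χ (mem_irr.2 hχ)
  rw [cf_comm, ← cf_indCF _ hχ.isClassFunction, hn χ (mem_irr.2 hχ)] at h1
  rw [cf_comm, ← cf_indCF _ hχ.isClassFunction, hm χ (mem_irr.2 hχ)] at h2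
  rcases mul_eq_zero.1 h3 with h | h
  · exact h1 (by rw [h, Nat.cast_zero])
  · exact h2 (by rw [h, Nat.cast_zero])

omit [Finite K] in
theorem NormalEmbedding.cf_act (E : NormalEmbedding ι a) {f : K → ℂ} (hf : IsClassFunction f)
    (ψ : N → ℂ) (x : K) : cf (f ∘ ι) (ψ ∘ a x) = cf (f ∘ ι) ψ := by
  conv_lhs => rw [← E.comp_act hf x]
  exact cf_comp_mulEquiv (a x) _ _

omit [Finite K] in
theorem IsIrreducibleCharacter.exists_under {χ : K → ℂ} (hχ : IsIrreducibleCharacter χ)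
    (ι : N →* K) : ∃ ψ : N → ℂ, IsIrreducibleCharacter ψ ∧ cf (χ ∘ ι) ψ ≠ 0 := by
  by_contra! h
  have h1 := congrFun ((hχ.isClassFunction.comp ι).eq_zero h) 1
  obtain ⟨n, hn, h2⟩ := hχ.apply_one
  simp only [Function.comp_apply, map_one, h2, Pi.zero_apply, Nat.cast_eq_zero] at h1
  omega

omit [Finite N] [Finite K] in
theorem card_act_eq_of_act_eq {ψ φ : N → ℂ} {y : K} (h : ψ ∘ a y = φ) :
    Nat.card {x : K // ψ ∘ a x = φ} = Nat.card {x : K // ψ ∘ a x = ψ} := by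
  refine Nat.card_congr
    { toFun := fun x => ⟨x * y⁻¹, ?_⟩
      invFun := fun x => ⟨x * y, ?_⟩
      left_inv := fun x => by simp
      right_inv := fun x => by simp }
  · rw [map_mul, MulAut.coe_mul, ← Function.comp_assoc, x.2, ← h]
    funext n
    simp
  · rw [map_mul, MulAut.coe_mul, ← Function.comp_assoc, x.2, h]

open Classical in
/-- The orbit of an irreducible character under the action of `K`. -/
noncomputable def irrOrbit (a : K →* MulAut N) (ψ : N → ℂ) : Finset (N → ℂ) :=
  (irr N).filter fun φ => ∃ x, ψ ∘ a x = φ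

omit [Finite K] in
theorem mem_irrOrbit {ψ φ : N → ℂ} (hψ : IsIrreducibleCharacter ψ) :
    φ ∈ irrOrbit a ψ ↔ ∃ x, ψ ∘ a x = φ := by
  simp only [irrOrbit, Finset.mem_filter, mem_irr, and_iff_right_iff_imp]
  rintro ⟨x, rfl⟩
  exact hψ.act x

theorem card_irrOrbit_mul {ψ : N → ℂ} (hψ : IsIrreducibleCharacter ψ) :
    (irrOrbit a ψ).card * Nat.card {x : K // ψ ∘ a x = ψ} = Nat.card K := by
  classical
  cases nonempty_fintype K
  rw [Nat.card_eq_fintype_card (α := K), ← Finset.card_univ,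
    Finset.card_eq_sum_card_fiberwise (f := fun x : K => ψ ∘ a x) (t := irrOrbit a ψ)
      (fun x _ => by simpa using (mem_irrOrbit hψ).2 ⟨x, rfl⟩),
    Finset.sum_congr rfl fun φ hφ => ?_, Finset.sum_const, smul_eq_mul]
  obtain ⟨y, hy⟩ := (mem_irrOrbit hψ).1 hφ
  rw [← card_act_eq_of_act_eq hy, Nat.card_eq_fintype_card, Fintype.card_subtype]

/-- The norm of an induced character times the length of the orbit is the index. -/
theorem NormalEmbedding.exists_norm_indCF (E : NormalEmbedding ι a) {ψ : N → ℂ}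
    (hψ : IsIrreducibleCharacter ψ) {d : ℕ} (hd : Nat.card K = Nat.card N * d) :
    ∃ c : ℕ, cf (indCF ι ψ) (indCF ι ψ) = c ∧ (irrOrbit a ψ).card * c = d := by
  have hn : ∀ η ∈ irr K, ∃ n : ℕ, cf (indCF ι ψ) η = n := fun η hη =>
    hψ.isCharacter.cf_indCF_nat (mem_irr.1 hη).isCharacter
  choose! n hn using hn
  refine ⟨∑ η ∈ irr K, n η * n η, ?_, ?_⟩
  · rw [(isClassFunction_indCF ι ψ).cf_eq_sum_irr]
    push_cast
    exact Finset.sum_congr rfl fun η hη => by rw [hn η hη]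
  · have h1 : cf (indCF ι ψ) (indCF ι ψ) = ((∑ η ∈ irr K, n η * n η : ℕ) : ℂ) := by
      rw [(isClassFunction_indCF ι ψ).cf_eq_sum_irr]
      push_cast
      exact Finset.sum_congr rfl fun η hη => by rw [hn η hη]
    rw [E.cf_indCF_indCF_irr hψ hψ, inv_mul_eq_iff_eq_mul₀ card_ne_zero_complex] at h1
    have h2 : Nat.card {x : K // ψ ∘ a x = ψ} = Nat.card N * ∑ η ∈ irr K, n η * n η := by
      exact_mod_cast h1
    have h3 := card_irrOrbit_mul (a := a) hψ
    rw [h2, hd, mul_left_comm] at h3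
    exact Nat.eq_of_mul_eq_mul_left Nat.card_pos h3

theorem NormalEmbedding.apply_one_eq (E : NormalEmbedding ι a) {χ : K → ℂ}
    (hχ : IsIrreducibleCharacter χ) {ψ : N → ℂ} (hψ : IsIrreducibleCharacter ψ)
    (h : cf (χ ∘ ι) ψ ≠ 0) : χ 1 = cf (χ ∘ ι) ψ * (irrOrbit a ψ).card * ψ 1 := by
  classical
  have h1 := congrFun (hχ.isClassFunction.comp ι).eq_sum_irr 1
  simp only [Function.comp_apply, map_one, Finset.sum_apply, Pi.smul_apply, smul_eq_mul] at h1
  rw [h1, ← Finset.sum_subset (s₁ := irrOrbit a ψ) (Finset.filter_subset _ _)]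
  · rw [Finset.sum_congr rfl (g := fun _ => cf (χ ∘ ι) ψ * ψ 1), Finset.sum_const, nsmul_eq_mul]
    · ring
    · intro φ hφ
      obtain ⟨x, rfl⟩ := (mem_irrOrbit hψ).1 hφ
      simp [E.cf_act hχ.isClassFunction]
  · intro φ hφ hφ'
    by_contra h0
    exact hφ' ((mem_irrOrbit hψ).2 (E.exists_act_eq hχ hψ (mem_irr.1 hφ) h
      (left_ne_zero_of_mul h0)))

end Clifford

/-! ### Odd index: exactly one fixed character lies over a fixed orbit. -/

section Counting

/-- Brauer's permutation lemma for the anti-automorphism `g ↦ β(g)⁻¹`. -/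
theorem card_mul_card_irr_fixed {M : Type*} [Group M] [Finite M] (β : MulAut M)
    [DecidableEq (M → ℂ)] :
    Nat.card M * ((irr M).filter fun χ => (fun g => χ (β g)⁻¹) = χ).card =
      Nat.card {p : M × M // p.1 * (β p.2)⁻¹ * p.1⁻¹ = p.2} := by
  classical
  cases nonempty_fintype M
  -- Each irreducible character contributes 1 if fixed and 0 otherwise. Column orthogonality then
  -- turns the sum into a count of group elements.
  have h1 : (((irr M).filter fun χ => (fun g => χ (β g)⁻¹) = χ).card : ℂ) =
      ∑ χ ∈ irr M, cf (fun g => χ (β g)⁻¹) χ := by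
    rw [Finset.card_filter]
    push_cast
    refine Finset.sum_congr rfl fun χ hχ => ?_
    exact (((mem_irr.1 hχ).inv.mulEquiv β).cf_eq (mem_irr.1 hχ)).symm
  have h2 : Nat.card {p : M × M // p.1 * (β p.2)⁻¹ * p.1⁻¹ = p.2} =
      ∑ g : M, Nat.card {x : M // x * (β g)⁻¹ * x⁻¹ = g} := by
    rw [← Nat.card_sigma]
    exact Nat.card_congr
      { toFun := fun p => ⟨p.1.2, p.1.1, p.2⟩
        invFun := fun p => ⟨(p.2.1, p.1), p.2.2⟩
        left_inv := fun _ => rfl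
        right_inv := fun _ => rfl }
  rw [h2, ← Nat.cast_inj (R := ℂ)]
  push_cast
  rw [h1]
  simp only [cf_apply, ← sum_irr_mul_inv]
  rw [← Finset.mul_sum, mul_inv_cancel_left₀ card_ne_zero_complex, Finset.sum_comm]

/-- The square of `x` commutes with `g`. In odd order `x` is a power of its square, so `g` equals
its inverse and has order dividing both 2 and an odd number. -/
theorem eq_one_of_conj_eq_inv {Q : Type*} [Group Q] [Finite Q] (hQ : Odd (Nat.card Q)) {x g : Q}
    (h : x * g * x⁻¹ = g⁻¹) : g = 1 := by
  obtain ⟨k, hk⟩ := hQ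
  have hx : ∀ y : Q, y ^ (2 * k + 1) = 1 := fun y => by rw [← hk, pow_card_eq_one']
  have h1 : Commute (x ^ 2) g := by
    have h2 : x * (x * g * x⁻¹) * x⁻¹ = g := by
      rw [h]
      have := congrArg (·⁻¹) h
      simpa [mul_assoc] using this
    change x ^ 2 * g = g * x ^ 2
    rw [sq]
    calc x * x * g = (x * (x * g * x⁻¹) * x⁻¹) * (x * x) := by group
      _ = g * (x * x) := by rw [h2]
  have h2 : Commute x g := by
    have h3 := h1.pow_left (k + 1)
    have h4 : (x ^ 2) ^ (k + 1) = x := by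
      rw [← pow_mul, show 2 * (k + 1) = (2 * k + 1) + 1 by ring, pow_succ, hx, one_mul]
    rwa [h4] at h3
  have h3 : g = g⁻¹ := by
    rw [← h, h2.eq, mul_inv_cancel_right]
  have h4 : g ^ 2 = 1 := by
    rw [sq]
    nth_rw 2 [h3]
    exact mul_inv_cancel g
  have := hx g
  rwa [pow_succ, pow_mul, h4, one_pow, one_mul] at this

/-- Modulo 2 the terms moved by the involution cancel in pairs. -/
theorem exists_fixed_odd {α : Type*} [DecidableEq α] (s : Finset α) (T : α → α)
    (hT : ∀ x ∈ s, T x ∈ s) (hTT : ∀ x ∈ s, T (T x) = x) (n : α → ℕ) (hn : ∀ x ∈ s, n (T x) = n x)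
    (hodd : Odd (∑ x ∈ s, n x * n x)) : ∃ x ∈ s, T x = x ∧ Odd (n x) := by
  by_contra! h
  have h0 : ∑ x ∈ s, ((n x * n x : ℕ) : ZMod 2) = 0 := by
    refine Finset.sum_involution (fun x _ => T x) ?_ ?_ (fun x hx => hT x hx)
      (fun x hx => hTT x hx)
    · intro x hx
      rw [hn x hx]
      exact CharTwo.add_self_eq_zero _
    · intro x hx h1 h2
      have := h x hx h2
      rw [Nat.not_odd_iff_even] at this
      exact h1 ((ZMod.natCast_eq_zero_iff_even).2 (this.mul_right _))
  rw [← Nat.cast_sum, ZMod.natCast_eq_zero_iff_even] at h0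
  exact (Nat.not_even_iff_odd.2 hodd) h0

variable {N K : Type*} [Group N] [Group K] [Finite N] [Finite K]
  {ι : N →* K} {a : K →* MulAut N}

/-- In the quotient by the normal subgroup, of odd order `d`, the elements `t` and `g` agree and `g`
is conjugate to its inverse, so its image is trivial. -/
theorem NormalEmbedding.mem_range_of_conj (E : NormalEmbedding ι a) {d : ℕ} (hodd : Odd d)
    (hd : Nat.card K = Nat.card N * d) {x g t : K} (hg : x * t⁻¹ * x⁻¹ = g)
    (ht : t * g⁻¹ ∈ ι.range) : g ∈ ι.range := by
  have hnorm : ι.range.Normal := ⟨fun n hn g => E.mem_range_conj hn g⟩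
  have hQ : Nat.card (K ⧸ ι.range) = d := by
    have h1 := Subgroup.card_eq_card_quotient_mul_card_subgroup ι.range
    have h2 : Nat.card ι.range = Nat.card N :=
      (Nat.card_congr (MonoidHom.ofInjective E.injective).toEquiv).symm
    rw [h2, hd, mul_comm] at h1
    exact (Nat.eq_of_mul_eq_mul_right Nat.card_pos h1).symm
  have ht' : (QuotientGroup.mk t : K ⧸ ι.range) = QuotientGroup.mk g := by
    rw [← mul_inv_eq_one, ← QuotientGroup.mk_inv, ← QuotientGroup.mk_mul,
      QuotientGroup.eq_one_iff]
    exact ht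
  rw [← QuotientGroup.eq_one_iff]
  refine eq_one_of_conj_eq_inv (by rwa [hQ]) (x := QuotientGroup.mk x) ?_
  have h1 := congrArg (QuotientGroup.mk (s := ι.range)) hg
  simp only [QuotientGroup.mk_mul, QuotientGroup.mk_inv, ht'] at h1
  have h2 := congrArg (·⁻¹) h1
  simpa [mul_assoc] using h2

/-- The number of pairs `(x, ψ)` with `x ∈ K` and `ψ` an irreducible character of `N` such that
the twist of `ψ` by `x` and `τ` is `ψ`. -/
theorem NormalEmbedding.sum_card_fixed (E : NormalEmbedding ι a) [Fintype K]
    [DecidableEq (N → ℂ)] [DecidableEq (K → ℂ)] {d : ℕ}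
    (hodd : Odd d) (hd : Nat.card K = Nat.card N * d) {τ : MulAut K} {τN : MulAut N}
    (hι : ∀ n, ι (τN n) = τ (ι n)) (hτ : ∀ g, τ g * g⁻¹ ∈ ι.range) :
    ∑ x : K, ((irr N).filter fun ψ => (fun n => ψ (τN (a x n))⁻¹) = ψ).card =
      Nat.card K * ((irr K).filter fun χ => (fun g => χ (τ g)⁻¹) = χ).card := by
  cases nonempty_fintype N
  refine Nat.eq_of_mul_eq_mul_left (Nat.card_pos (α := N)) ?_
  rw [card_mul_card_irr_fixed, Finset.mul_sum]
  have h1 : ∀ x : K, Nat.card N *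
      ((irr N).filter fun ψ => (fun n => ψ (τN (a x n))⁻¹) = ψ).card =
      Nat.card {p : N × N // p.1 * (τN (a x p.2))⁻¹ * p.1⁻¹ = p.2} := fun x =>
    card_mul_card_irr_fixed (τN * a x)
  simp only [h1]
  rw [← Nat.card_sigma, ← Nat.card_prod]
  -- After multiplication by the order of `N`, both sides count solutions of one equation: the
  -- substitution z = ι(m)τ(x) matches triples (x, m, n) with triples (m, z, g). Odd index enters in
  -- showing that every such g comes from `N`.
  have key : ∀ (x : K) (m n : N), m * (τN (a x n))⁻¹ * m⁻¹ = n ↔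
      (ι m * τ x) * (τ (ι n))⁻¹ * (ι m * τ x)⁻¹ = ι n := by
    intro x m n
    rw [← E.injective.eq_iff]
    simp only [map_mul, map_inv, hι, E.map_act]
    simp only [mul_inv_rev, inv_inv, mul_assoc]
  refine Nat.card_congr (Equiv.ofBijective
    (fun p => ⟨p.2.1.1, ⟨(ι p.2.1.1 * τ p.1, ι p.2.1.2), (key _ _ _).1 p.2.2⟩⟩) ⟨?_, ?_⟩)
  · rintro ⟨x, ⟨m, n⟩, h⟩ ⟨x', ⟨m', n'⟩, h'⟩ heq
    simp only [Prod.mk.injEq, Subtype.mk.injEq] at heq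
    obtain ⟨rfl, h2, h3⟩ := heq
    obtain rfl := E.injective h3
    obtain rfl := τ.injective (mul_left_cancel h2)
    rfl
  · rintro ⟨m, ⟨z, g⟩, h⟩
    obtain ⟨n, rfl⟩ : g ∈ ι.range := E.mem_range_of_conj hodd hd h (hτ _)
    refine ⟨⟨τ.symm ((ι m)⁻¹ * z), ⟨(m, n), ?_⟩⟩, ?_⟩
    · rw [key]
      simpa using h
    · simp

omit [Finite N] in
theorem card_act_eq_le {ψ φ η : N → ℂ} {y : K} (h : ψ ∘ a y = φ) :
    Nat.card {x : K // η ∘ a x = φ} ≤ Nat.card {x : K // ψ ∘ a x = ψ} := by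
  rcases isEmpty_or_nonempty {x : K // η ∘ a x = φ} with he | ⟨⟨z, hz⟩⟩
  · simp
  · rw [card_act_eq_of_act_eq hz]
    refine Nat.card_le_card_of_injective
      (fun x => ⟨y * z⁻¹ * x * z * y⁻¹, ?_⟩) ?_
    · have hη : η = ψ ∘ a (y * z⁻¹) := by
        rw [map_mul, MulAut.coe_mul, ← Function.comp_assoc, h, ← hz]
        funext n
        simp
      have hx := x.2
      have hψ : ψ = η ∘ a (z * y⁻¹) := by
        rw [hη]
        funext n
        simp
      rw [show y * z⁻¹ * x * z * y⁻¹ = (y * z⁻¹) * (x * (z * y⁻¹)) by group, map_mul,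
        MulAut.coe_mul, ← Function.comp_assoc, ← hη, map_mul, MulAut.coe_mul,
        ← Function.comp_assoc, hx, ← hψ]
    · intro x x' hx
      exact Subtype.ext (by simpa using hx)

/-- Let `N` be normal of odd index in `K`, and let `τ` be an automorphism of `K` that is trivial
modulo `N` and whose square is inner. If `ψ` is an irreducible character of `N` whose `K`-orbit is
stable under `χ ↦ (g ↦ χ(τ(g)⁻¹))`, then there is exactly one irreducible character of `K` over
`ψ` fixed by this operation, and it lies over `ψ` with odd multiplicity. -/
theorem NormalEmbedding.exists_unique_fixed (E : NormalEmbedding ι a) {d : ℕ} (hodd : Odd d)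
    (hd : Nat.card K = Nat.card N * d) {τ : MulAut K} {τN : MulAut N}
    (hι : ∀ n, ι (τN n) = τ (ι n)) (hτ : ∀ g, τ g * g⁻¹ ∈ ι.range)
    (hττ : ∃ s, ∀ g, τ (τ g) = s * g * s⁻¹) {ψ : N → ℂ} (hψ : IsIrreducibleCharacter ψ)
    (hx : ∃ x : K, (fun n => ψ (τN (a x n))⁻¹) = ψ) :
    ∃ χ : K → ℂ, IsIrreducibleCharacter χ ∧ (fun g => χ (τ g)⁻¹) = χ ∧
      (∃ m : ℕ, Odd m ∧ cf (χ ∘ ι) ψ = m) ∧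
      ∀ χ' : K → ℂ, IsIrreducibleCharacter χ' → (fun g => χ' (τ g)⁻¹) = χ' →
        cf (χ' ∘ ι) ψ ≠ 0 → χ' = χ := by
  classical
  cases nonempty_fintype K
  have hexists : ∀ ψ : N → ℂ, IsIrreducibleCharacter ψ →
      (∃ x : K, (fun n => ψ (τN (a x n))⁻¹) = ψ) → ∃ χ : K → ℂ, IsIrreducibleCharacter χ ∧
        (fun g => χ (τ g)⁻¹) = χ ∧ ∃ m : ℕ, Odd m ∧ cf (χ ∘ ι) ψ = m := by
    rintro ψ hψ ⟨x, hx⟩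
    -- Existence by parity: the norm `c` of the induced character divides the odd number `d` and is
    -- a sum of squares of multiplicities, which the involution on `irr K` preserves.
    obtain ⟨c, hc, hcd⟩ := E.exists_norm_indCF hψ hd
    have hcodd : Odd c := Nat.Odd.of_mul_right (hcd ▸ hodd)
    have hn : ∀ η ∈ irr K, ∃ n : ℕ, cf (indCF ι ψ) η = n := fun η hη =>
      hψ.isCharacter.cf_indCF_nat (mem_irr.1 hη).isCharacter
    choose! n hn using hn
    have hsum : ∑ η ∈ irr K, n η * n η = c := by
      rw [(isClassFunction_indCF ι ψ).cf_eq_sum_irr] at hc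
      rw [← Nat.cast_inj (R := ℂ), ← hc]
      push_cast
      exact Finset.sum_congr rfl fun η hη => by rw [hn η hη]
    -- The twist of ψ by τ is conjugate to ψ under `K`, and conjugate characters induce the same
    -- character.
    have hind : (fun g => indCF ι ψ (τ g)⁻¹) = indCF ι ψ := by
      funext g
      rw [indCF_inv, indCF_mulEquiv hι]
      have h1 : indCF ι ψ (x * g * x⁻¹) = indCF ι (ψ ∘ a x) g :=
        indCF_mulEquiv (α := MulAut.conj x) (β := a x) (fun n => by simp [E.map_act]) ψ g
      have h2 : indCF ι ((fun n => ψ (τN n)⁻¹) ∘ a x) g =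
          indCF ι (fun n => ψ (τN n)⁻¹) (x * g * x⁻¹) :=
        (indCF_mulEquiv (α := MulAut.conj x) (β := a x) (fun n => by simp [E.map_act]) _ g).symm
      rw [isClassFunction_indCF] at h2
      change indCF ι (fun n => ψ (τN n)⁻¹) g = _
      rw [← h2]
      exact congrFun (congrArg _ hx) g
    have hTirr : ∀ η ∈ irr K, (fun g => η (τ g)⁻¹) ∈ irr K := fun η hη =>
      mem_irr.2 ((mem_irr.1 hη).inv.mulEquiv τ)
    obtain ⟨η, hη, hfix, hoddη⟩ := exists_fixed_odd (irr K) (fun η g => η (τ g)⁻¹) hTirr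
      (fun η hη => by
        obtain ⟨s, hs⟩ := hττ
        funext g
        simpa [hs] using (mem_irr.1 hη).isClassFunction s g) n
      (fun η hη => by
        rw [← Nat.cast_inj (R := ℂ), ← hn _ (hTirr η hη), ← hn η hη]
        conv_lhs => rw [← hind]
        exact (cf_comp_mulEquiv τ (fun g => indCF ι ψ g⁻¹) (fun g => η g⁻¹)).trans (cf_inv _ _))
      (by rwa [hsum])
    refine ⟨η, mem_irr.1 hη, hfix, n η, hoddη, ?_⟩
    rw [cf_comm, ← cf_indCF ψ (mem_irr.1 hη).isClassFunction, hn η hη]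
  obtain ⟨χ, hχ, hfix, m, hm, hcf⟩ := hexists ψ hψ hx
  refine ⟨χ, hχ, hfix, ⟨m, hm, hcf⟩, fun χ' hχ' hfix' hcf' => ?_⟩
  by_contra hne
  -- Uniqueness by double counting. `P` has `Nat.card K * F.card` elements, a character in `F` is
  -- related to at most `Nat.card K` of them, and each element of `P` is related to at least one
  -- character in `F`. Hence every element of `P` is related to exactly one, which a second
  -- character over ψ would contradict.
  let P : Finset (K × (N → ℂ)) :=
    (Finset.univ ×ˢ irr N).filter fun p => (fun n => p.2 (τN (a p.1 n))⁻¹) = p.2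
  let F : Finset (K → ℂ) := (irr K).filter fun χ => (fun g => χ (τ g)⁻¹) = χ
  let r : (K → ℂ) → K × (N → ℂ) → Prop := fun χ p => cf (χ ∘ ι) p.2 ≠ 0
  have hP : P.card = Nat.card K * F.card := by
    rw [← E.sum_card_fixed hodd hd hι hτ]
    simp only [P, Finset.card_filter, Finset.sum_product]
  -- By Clifford the second components lie in one orbit, and over each of its members the first
  -- components are empty or a coset of a stabilizer. Orbit length times stabilizer order is the
  -- order of `K`.
  have hle : ∀ η ∈ F, (P.bipartiteAbove r η).card ≤ Nat.card K := by
    intro η hη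
    have hη' := Finset.mem_filter.1 hη
    obtain ⟨ψ₀, hψ₀, h0⟩ := (mem_irr.1 hη'.1).exists_under ι
    calc (P.bipartiteAbove r η).card
        ≤ ((Finset.univ ×ˢ irrOrbit a ψ₀).filter
            fun p : K × (N → ℂ) => (fun n => p.2 (τN (a p.1 n))⁻¹) = p.2).card := by
          refine Finset.card_le_card fun p hp => ?_
          obtain ⟨hp1, hp2⟩ := Finset.mem_filter.1 hp
          obtain ⟨hp3, hp4⟩ := Finset.mem_filter.1 hp1
          refine Finset.mem_filter.2 ⟨Finset.mem_product.2 ⟨Finset.mem_univ _, ?_⟩, hp4⟩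
          exact (mem_irrOrbit hψ₀).2 (E.exists_act_eq (mem_irr.1 hη'.1) hψ₀
            (mem_irr.1 (Finset.mem_product.1 hp3).2) h0 hp2)
      _ = ∑ φ ∈ irrOrbit a ψ₀,
            Nat.card {x : K // (fun n => φ (τN n)⁻¹) ∘ a x = φ} := by
          simp only [Finset.card_filter, Finset.sum_product_right, Nat.card_eq_fintype_card,
            Fintype.card_subtype]
          rfl
      _ ≤ ∑ φ ∈ irrOrbit a ψ₀, Nat.card {x : K // ψ₀ ∘ a x = ψ₀} := by
          refine Finset.sum_le_sum fun φ hφ => ?_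
          obtain ⟨y, hy⟩ := (mem_irrOrbit hψ₀).1 hφ
          exact card_act_eq_le hy
      _ = Nat.card K := by
          rw [Finset.sum_const, smul_eq_mul, card_irrOrbit_mul hψ₀]
  have hge : ∀ p ∈ P, 1 ≤ (F.bipartiteBelow r p).card := by
    intro p hp
    obtain ⟨hp1, hp2⟩ := Finset.mem_filter.1 hp
    obtain ⟨η, h1, h2, k, hk, h3⟩ := hexists p.2 (mem_irr.1 (Finset.mem_product.1 hp1).2)
      ⟨p.1, hp2⟩
    refine Finset.card_pos.2 ⟨η, Finset.mem_filter.2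
      ⟨Finset.mem_filter.2 ⟨mem_irr.2 h1, h2⟩, ?_⟩⟩
    simp only [r, h3, ne_eq, Nat.cast_eq_zero]
    exact hk.pos.ne'
  have hlt : P.card < ∑ p ∈ P, (F.bipartiteBelow r p).card := by
    rw [Finset.card_eq_sum_ones]
    obtain ⟨x, hx⟩ := hx
    refine Finset.sum_lt_sum hge ⟨(x, ψ), Finset.mem_filter.2
      ⟨Finset.mem_product.2 ⟨Finset.mem_univ _, mem_irr.2 hψ⟩, hx⟩, ?_⟩
    refine Finset.one_lt_card.2 ⟨χ', ?_, χ, ?_, hne⟩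
    · exact Finset.mem_filter.2 ⟨Finset.mem_filter.2 ⟨mem_irr.2 hχ', hfix'⟩, hcf'⟩
    · refine Finset.mem_filter.2 ⟨Finset.mem_filter.2 ⟨mem_irr.2 hχ, hfix⟩, ?_⟩
      simp only [r, hcf, ne_eq, Nat.cast_eq_zero]
      exact hm.pos.ne'
  rw [← Finset.sum_card_bipartiteAbove_eq_sum_card_bipartiteBelow, hP] at hlt
  have h3 := Finset.sum_le_sum hle
  rw [Finset.sum_const, smul_eq_mul, mul_comm] at h3
  omega

end Counting

/-! ### Rational characters of even degree above and below a normal subgroup. -/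

section RationalCharacters

variable {N K : Type*} [Group N] [Group K] [Finite N] [Finite K]
  {ι : N →* K} {a : K →* MulAut N}

omit [Finite K] in
theorem exists_ne_apply_one {χ : K → ℂ} {ψ : N → ℂ}
    (hψ : IsIrreducibleCharacter ψ) (h1 : ψ ≠ 1) (h : cf (χ ∘ ι) ψ ≠ 0) :
    ∃ n, χ (ι n) ≠ χ 1 := by
  by_contra! hn
  have h2 : χ ∘ ι = χ 1 • (1 : N → ℂ) := by
    funext n
    simp [hn n]
  rw [h2, map_smul, LinearMap.smul_apply,
    isIrreducibleCharacter_one.cf_ne hψ (Ne.symm h1), smul_zero] at h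
  exact h rfl

/-- The unique real irreducible character over ψ is rational: each Galois conjugate is again real
and lies over a conjugate of ψ, hence over ψ. Its degree is a multiple of that of ψ. -/
theorem NormalEmbedding.exists_rational_even_of_odd (E : NormalEmbedding ι a) {d : ℕ}
    (hodd : Odd d) (hd : Nat.card K = Nat.card N * d) {ψ : N → ℂ}
    (hψ : IsIrreducibleCharacter ψ) (hreal : ∀ n, ψ n⁻¹ = ψ n) (heven : HasEvenDegree ψ)
    (hgal : ∀ σ : ℂ ≃+* ℂ, ∃ x, σ ∘ ψ = ψ ∘ a x) :
    ∃ χ : K → ℂ, IsIrreducibleCharacter χ ∧ IsRationalCharacter χ ∧ HasEvenDegree χ ∧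
      ∃ n, χ (ι n) ≠ χ 1 := by
  obtain ⟨k, hk, hk1⟩ := heven
  obtain ⟨χ, hχ, hfix, ⟨m, hm, hcf⟩, huniq⟩ := E.exists_unique_fixed hodd hd (τ := 1) (τN := 1)
    (fun _ => rfl) (fun g => ⟨1, by simp⟩) ⟨1, fun g => by simp⟩ hψ
    ⟨1, by funext n; simp [hreal]⟩
  have hm0 : cf (χ ∘ ι) ψ ≠ 0 := by
    rw [hcf, Nat.cast_ne_zero]
    exact hm.pos.ne'
  refine ⟨χ, hχ, ?_, ⟨m * (irrOrbit a ψ).card * k, hk.mul_left _, ?_⟩, ?_⟩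
  · refine hχ.isCharacter.isRationalCharacter fun σ => ?_
    refine huniq _ (hχ.ringEquiv σ) ?_ ?_
    · conv_rhs => rw [← hfix]
      rfl
    · obtain ⟨x, hx⟩ := hgal σ
      have h1 := cf_ringEquiv σ (χ ∘ ι) ψ
      rw [hx] at h1
      have h2 := E.cf_act (hχ.ringEquiv σ).isClassFunction ψ x
      rw [← h2]
      exact h1 ▸ (map_ne_zero σ).2 hm0
  · rw [E.apply_one_eq hχ hψ hm0, hcf, hk1]
    push_cast
    rfl
  · refine exists_ne_apply_one hψ ?_ hm0
    rintro rfl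
    have : k = 1 := by
      rw [Pi.one_apply] at hk1
      exact_mod_cast hk1.symm
    subst this
    exact absurd hk (by decide)

omit [Finite K] in
theorem NormalEmbedding.pow_mem_range (E : NormalEmbedding ι a) {d : ℕ}
    (hd : Nat.card K = Nat.card N * d) (y : K) : y ^ d ∈ ι.range := by
  have hnorm : ι.range.Normal := ⟨fun n hn g => E.mem_range_conj hn g⟩
  have hQ : Nat.card (K ⧸ ι.range) = d := by
    have h1 := Subgroup.card_eq_card_quotient_mul_card_subgroup ι.range
    have h2 : Nat.card ι.range = Nat.card N :=
      (Nat.card_congr (MonoidHom.ofInjective E.injective).toEquiv).symm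
    rw [h2, hd, mul_comm] at h1
    exact (Nat.eq_of_mul_eq_mul_right Nat.card_pos h1).symm
  rw [← QuotientGroup.eq_one_iff, QuotientGroup.mk_pow, ← hQ, pow_card_eq_one']

/-- Converse of `NormalEmbedding.exists_rational_even_of_odd`. Multiplicity and orbit length are
odd, so the even degree must come from ψ. -/
theorem NormalEmbedding.exists_under_rational_even (E : NormalEmbedding ι a) {d : ℕ}
    (hodd : Odd d) (hd : Nat.card K = Nat.card N * d) {χ : K → ℂ}
    (hχ : IsIrreducibleCharacter χ) (hrat : IsRationalCharacter χ) (heven : HasEvenDegree χ) :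
    ∃ ψ : N → ℂ, IsIrreducibleCharacter ψ ∧ cf (χ ∘ ι) ψ ≠ 0 ∧ (∀ n, ψ n⁻¹ = ψ n) ∧
      HasEvenDegree ψ ∧ ∀ σ : ℂ ≃+* ℂ, ∃ x, σ ∘ ψ = ψ ∘ a x := by
  obtain ⟨ψ, hψ, h0⟩ := hχ.exists_under ι
  have hreal : ∀ n, ψ n⁻¹ = ψ n := by
    have hinv : (fun n => (χ ∘ ι) n⁻¹) = χ ∘ ι := by
      funext n
      simp [hrat.apply_inv hχ.isCharacter]
    -- As χ is real, the conjugate of ψ is ψ twisted by some `y`. Then y² fixes ψ, and so does the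
    -- odd power y^d, which is inner on `N`; hence `y` fixes ψ and ψ is real.
    obtain ⟨y, hy⟩ := E.exists_act_eq hχ hψ hψ.inv h0 (by rw [← hinv, cf_inv]; exact h0)
    have hy' : ∀ n, ψ (a y n) = ψ n⁻¹ := congrFun hy
    have hy2 : ∀ n, ψ (a (y ^ 2) n) = ψ n := by
      intro n
      rw [sq, map_mul, MulAut.mul_apply, hy', ← map_inv, hy', inv_inv]
    have hy2k : ∀ k n, ψ (a ((y ^ 2) ^ k) n) = ψ n := by
      intro k
      induction k with
      | zero => simp
      | succ k ih =>
        intro n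
        rw [pow_succ, map_mul, MulAut.mul_apply, ih, hy2]
    obtain ⟨k, hk⟩ := hodd
    obtain ⟨m, hm⟩ := E.pow_mem_range hd y
    intro n
    rw [← hy', ← hy2k k, ← MulAut.mul_apply, ← map_mul, ← pow_mul, ← pow_succ, ← hk, ← hm,
      E.act_map, hψ.isClassFunction]
  refine ⟨ψ, hψ, h0, hreal, ?_, fun σ => ?_⟩
  · obtain ⟨χ', hχ', hfix, ⟨m, hm, hcf⟩, huniq⟩ := E.exists_unique_fixed hodd hd (τ := 1)
      (τN := 1) (fun _ => rfl) (fun g => ⟨1, by simp⟩) ⟨1, fun g => by simp⟩ hψ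
      ⟨1, by funext n; simp [hreal]⟩
    obtain rfl := huniq χ hχ (by funext g; simp [hrat.apply_inv hχ.isCharacter]) h0
    obtain ⟨k, -, hk⟩ := hψ.apply_one
    obtain ⟨e, he, he'⟩ := heven
    obtain ⟨c, -, hc⟩ := E.exists_norm_indCF hψ hd
    have h1 := E.apply_one_eq hχ hψ h0
    rw [hcf, hk, he'] at h1
    have h2 : e = m * (irrOrbit a ψ).card * k := by exact_mod_cast h1
    refine ⟨k, ?_, hk⟩
    rw [h2, Nat.even_mul] at he
    refine he.resolve_left ?_
    rw [Nat.not_even_iff_odd]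
    exact hm.mul (Nat.Odd.of_mul_left (hc ▸ hodd))
  · obtain ⟨x, hx⟩ := E.exists_act_eq hχ hψ (hψ.ringEquiv σ) h0 (by
      have h1 := cf_ringEquiv σ (χ ∘ ι) ψ
      rw [← Function.comp_assoc, hrat.ringEquiv_comp σ] at h1
      rw [h1]
      exact (map_ne_zero σ).2 h0)
    exact ⟨x, hx.symm⟩

theorem normalEmbedding_subtype {G : Type*} [Group G] (K : Subgroup G) [K.Normal] :
    NormalEmbedding K.subtype (MulAut.conjNormal : G →* MulAut K) :=
  ⟨K.subtype_injective, fun k n => by simp [MulAut.conjNormal_apply]⟩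

theorem indCF_subtype_one {G : Type*} [Group G] [Finite G] (K : Subgroup G) [K.Normal]
    (ψ : K → ℂ) : indCF K.subtype ψ 1 = K.index * ψ 1 := by
  cases nonempty_fintype G
  have h := (normalEmbedding_subtype K).indCF_map ψ 1
  rw [map_one] at h
  rw [h]
  simp only [map_one, Finset.sum_const, Finset.card_univ, nsmul_eq_mul,
    ← Nat.card_eq_fintype_card]
  rw [← K.card_mul_index]
  push_cast
  field_simp [card_ne_zero_complex (G := K)]

/-- If a nonreal character `ψ` of `N` is conjugate in `G` to its complex conjugate and has no
further Galois conjugates, then `G` has a rational character of even degree over it. -/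
theorem NormalEmbedding.exists_rational_even_of_index_two {G : Type*} [Group G] [Finite G]
    {ι : N →* G} {a : G →* MulAut N} (E : NormalEmbedding ι a) (K : Subgroup G)
    (hK : K.index = 2) (hιK : ι.range ≤ K) {d : ℕ} (hodd : Odd d)
    (hd : Nat.card K = Nat.card N * d) {t : G} (ht : t ∉ K)
    (hcomm : ∀ k ∈ K, t * k * t⁻¹ * k⁻¹ ∈ ι.range) {ψ : N → ℂ}
    (hψ : IsIrreducibleCharacter ψ) (hψK : ∀ k ∈ K, ψ ∘ a k = ψ)
    (hψt : ψ ∘ a t = fun n => ψ n⁻¹) (hne : (fun n => ψ n⁻¹) ≠ ψ)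
    (hgal : ∀ σ : ℂ ≃+* ℂ, σ ∘ ψ = ψ ∨ σ ∘ ψ = fun n => ψ n⁻¹) :
    ∃ χ : G → ℂ, IsIrreducibleCharacter χ ∧ IsRationalCharacter χ ∧ HasEvenDegree χ ∧
      ∃ n, χ (ι n) ≠ χ 1 := by
  have hKn : K.Normal := Subgroup.normal_of_index_eq_two hK
  have EK : NormalEmbedding (ι.codRestrict K fun n => hιK ⟨n, rfl⟩) (a.comp K.subtype) :=
    ⟨fun x y h => E.injective (congrArg Subtype.val h), fun k n => Subtype.ext (E.map_act k n)⟩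
  set j := ι.codRestrict K fun n => hιK ⟨n, rfl⟩ with hj
  -- Twisting by `t` replaces the missing reality of ψ: conjugation by `t` followed by inversion of
  -- the argument fixes ψ, so there is a unique χ over ψ with the same symmetry.
  let τ : MulAut K := MulAut.conjNormal t
  have hτ : ∀ g : K, ((τ g : K) : G) = t * g * t⁻¹ := fun g => MulAut.conjNormal_apply t g
  have hjτ : ∀ n, j (a t n) = τ (j n) := fun n => Subtype.ext (by
    rw [hτ]
    exact E.map_act t n)
  have hψt' : ∀ n, ψ (a t n) = ψ n⁻¹ := congrFun hψt
  obtain ⟨χ, hχ, hfix, ⟨m, hm, hcf⟩, huniq⟩ := EK.exists_unique_fixed hodd hd (τ := τ)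
    (τN := a t) hjτ
    (fun g => by
      obtain ⟨n, hn⟩ := hcomm g g.2
      exact ⟨n, Subtype.ext (by simpa [hj, hτ] using hn)⟩)
    ⟨⟨t * t, Subgroup.mul_self_mem_of_index_two hK t⟩, fun g => Subtype.ext (by
      simp [hτ, mul_assoc])⟩ hψ
    ⟨1, by funext n; simp [← map_inv, hψt']⟩
  have hm0 : cf (χ ∘ j) ψ ≠ 0 := by
    rw [hcf, Nat.cast_ne_zero]
    exact hm.pos.ne'
  have hcft : ∀ f : K → ℂ, ∀ φ : N → ℂ, cf ((f ∘ τ) ∘ j) (φ ∘ a t) = cf (f ∘ j) φ := by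
    intro f φ
    have : (f ∘ τ) ∘ j = (f ∘ j) ∘ a t := by
      funext n
      simp [hjτ]
    rw [this, cf_comp_mulEquiv]
  have ES := normalEmbedding_subtype K
  -- ψ is invariant in `K`, so no other irreducible character lies under χ, while an element outside
  -- `K` sends ψ to its conjugate. Hence χ has stabilizer `K` and induces irreducibly.
  have hstab : ∀ x : G, χ ∘ (MulAut.conjNormal x : MulAut K) = χ ↔ x ∈ K := by
    intro x
    refine ⟨fun h => ?_, fun h => ?_⟩
    · by_contra hx
      have hk : x * t⁻¹ ∈ K := by
        rw [Subgroup.mul_mem_iff_of_index_two hK, inv_mem_iff]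
        simp [hx, ht]
      have hax : ψ ∘ a x = fun n => ψ n⁻¹ := by
        rw [← hψt]
        conv_lhs => rw [show x = (x * t⁻¹) * t by group, map_mul, MulAut.coe_mul,
          ← Function.comp_assoc, hψK _ hk]
      have h1 : cf (χ ∘ j) (fun n => ψ n⁻¹) ≠ 0 := by
        rw [← hax, ← h]
        have : (χ ∘ (MulAut.conjNormal x : MulAut K)) ∘ j = (χ ∘ j) ∘ a x := by
          funext n
          simp only [Function.comp_apply]
          congr 1
          exact Subtype.ext (by
            rw [MulAut.conjNormal_apply]
            exact (E.map_act x n).symm)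
        rw [this, cf_comp_mulEquiv]
        exact hm0
      obtain ⟨k, hk⟩ := EK.exists_act_eq hχ hψ hψ.inv hm0 h1
      exact hne (hk.symm.trans (hψK k k.2))
    · funext g
      have : (MulAut.conjNormal x : MulAut K) g = ⟨x, h⟩ * g * ⟨x, h⟩⁻¹ :=
        Subtype.ext (by simp [MulAut.conjNormal_apply])
      simp only [Function.comp_apply, this]
      exact hχ.isClassFunction _ _
  have hirr : IsIrreducibleCharacter (indCF K.subtype χ) := by
    obtain ⟨r, hr, hr1⟩ := hχ.apply_one
    refine (isClassFunction_indCF _ _).isIrreducibleCharacter (fun η hη => ?_) ?_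
      (r := 2 * r) (by omega) ?_
    · obtain ⟨n, hn⟩ := hχ.isCharacter.cf_indCF_nat (ι := K.subtype) hη.isCharacter
      exact ⟨n, by simpa using hn⟩
    · rw [ES.cf_indCF_indCF_irr hχ hχ]
      simp only [hstab]
      exact inv_mul_cancel₀ card_ne_zero_complex
    · rw [indCF_subtype_one, hK, hr1]
      push_cast
      rfl
  refine ⟨indCF K.subtype χ, hirr, ?_, ?_, ?_⟩
  · refine hirr.isCharacter.isRationalCharacter fun σ => ?_
    rw [ringEquiv_comp_indCF]
    have hfix' : ∀ g, χ (τ g)⁻¹ = χ g := congrFun hfix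
    have hσ0 : cf ((σ ∘ χ) ∘ j) (σ ∘ ψ) ≠ 0 := by
      rw [Function.comp_assoc, cf_ringEquiv]
      exact (map_ne_zero σ).2 hm0
    -- If σ fixes ψ, uniqueness gives σχ = χ. Otherwise σχ ∘ τ lies over ψ and equals χ. In both
    -- cases σχ and χ are conjugate in `G` and induce the same character.
    rcases hgal σ with h | h
    · rw [huniq _ (hχ.ringEquiv σ) (by funext g; simp [hfix']) (by rwa [h] at hσ0)]
    · have h1 : (σ ∘ χ) ∘ τ = χ := by
        refine huniq _ ((hχ.ringEquiv σ).mulEquiv τ) ?_ ?_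
        · funext g
          simp [hfix']
        · rw [h] at hσ0
          rw [← hcft] at hσ0
          have : (fun n => ψ n⁻¹) ∘ a t = ψ := by
            funext n
            simp [← map_inv, hψt']
          rwa [this] at hσ0
      funext g
      have h2 : indCF K.subtype (σ ∘ χ) (MulAut.conj t g) = indCF K.subtype ((σ ∘ χ) ∘ τ) g :=
        indCF_mulEquiv (fun x => by simp [hτ]) _ g
      rw [h1, MulAut.conj_apply, isClassFunction_indCF] at h2
      exact h2
  · obtain ⟨r, hr, hr1⟩ := hχ.apply_one
    exact ⟨2 * r, even_two_mul r, by rw [indCF_subtype_one, hK, hr1]; push_cast; rfl⟩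
  · refine exists_ne_apply_one hψ ?_ (ψ := ψ) ?_
    · rintro rfl
      exact hne rfl
    · cases nonempty_fintype G
      have h1 : indCF K.subtype χ ∘ ι = (Nat.card K : ℂ)⁻¹ •
          ∑ x : G, (χ ∘ (MulAut.conjNormal x : MulAut K)) ∘ j := by
        funext n
        simpa using (show indCF K.subtype χ (ι n) = _ from ES.indCF_map χ (j n))
      have h2 : ∀ x : G, ∃ k : ℕ, cf ((χ ∘ (MulAut.conjNormal x : MulAut K)) ∘ j) ψ = k :=
        fun x => ((hχ.mulEquiv (MulAut.conjNormal x)).isCharacter.comp j).cf_nat hψ.isCharacter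
      choose k hk using h2
      have hk1 : k 1 = m := by
        have := hk 1
        rw [map_one, MulAut.coe_one, Function.comp_id, hcf] at this
        exact_mod_cast this.symm
      rw [h1, map_smul, map_sum, LinearMap.smul_apply, LinearMap.sum_apply]
      simp only [hk, smul_eq_mul]
      refine mul_ne_zero (inv_ne_zero card_ne_zero_complex) ?_
      rw [← Nat.cast_sum, Nat.cast_ne_zero]
      intro h0
      have := Finset.sum_eq_zero_iff.1 h0 1 (Finset.mem_univ _)
      exact hm.pos.ne' (hk1 ▸ this)

end RationalCharacters

/-! ### Matrix computations in SL₂. -/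

section SL2

/-- The group `SL₂(F)`. -/
abbrev SL2 (F : Type*) [Field F] := Matrix.SpecialLinearGroup (Fin 2) F

namespace SL2

variable {F : Type*} [Field F]

/-- The matrix with the given entries. -/
def of (a b c d : F) (h : a * d - b * c = 1) : SL2 F :=
  ⟨!![a, b; c, d], by rw [Matrix.det_fin_two_of, h]⟩

section
variable (a b c d : F) (h : a * d - b * c = 1)
@[simp] theorem of_00 : of a b c d h 0 0 = a := rfl
@[simp] theorem of_01 : of a b c d h 0 1 = b := rfl
@[simp] theorem of_10 : of a b c d h 1 0 = c := rfl
@[simp] theorem of_11 : of a b c d h 1 1 = d := rfl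
end

theorem eq_iff {A B : SL2 F} :
    A = B ↔ A 0 0 = B 0 0 ∧ A 0 1 = B 0 1 ∧ A 1 0 = B 1 0 ∧ A 1 1 = B 1 1 := by
  rw [Matrix.SpecialLinearGroup.ext_iff]
  simp [Fin.forall_fin_two, and_assoc]

theorem det_eq (A : SL2 F) : A 0 0 * A 1 1 - A 0 1 * A 1 0 = 1 := by
  rw [← Matrix.det_fin_two]
  exact A.2

theorem mul_apply' (A B : SL2 F) (i j : Fin 2) :
    (A * B) i j = A i 0 * B 0 j + A i 1 * B 1 j := by
  simp [Matrix.mul_apply, Fin.sum_univ_two]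

theorem neg_apply' (A : SL2 F) (i j : Fin 2) : (-A) i j = -(A i j) := by simp

@[simp] theorem one_00 : (1 : SL2 F) 0 0 = 1 := rfl
@[simp] theorem one_01 : (1 : SL2 F) 0 1 = 0 := rfl
@[simp] theorem one_10 : (1 : SL2 F) 1 0 = 0 := rfl
@[simp] theorem one_11 : (1 : SL2 F) 1 1 = 1 := rfl

theorem inv_eq_of (A : SL2 F) :
    A⁻¹ = of (A 1 1) (-A 0 1) (-A 1 0) (A 0 0) (by linear_combination det_eq A) := by
  rw [Matrix.SpecialLinearGroup.SL2_inv_expl]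
  rfl

/-- Upper unitriangular matrices. -/
def upper (x : F) : SL2 F := of 1 x 0 1 (by ring)

/-- Lower unitriangular matrices. -/
def lower (x : F) : SL2 F := of 1 0 x 1 (by ring)

theorem upper_add (x y : F) : upper (x + y) = upper x * upper y := by
  simp [eq_iff, mul_apply', upper, add_comm]

theorem lower_add (x y : F) : lower (x + y) = lower x * lower y := by
  simp [eq_iff, mul_apply', lower]

theorem upper_zero : upper (0 : F) = 1 := by simp [eq_iff, upper]

/-- The diagonal subgroup. -/
def diagonal (F : Type*) [Field F] : Subgroup (SL2 F) where
  carrier := {A | A 0 1 = 0 ∧ A 1 0 = 0}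
  mul_mem' := by
    rintro A B ⟨h1, h2⟩ ⟨h3, h4⟩
    simp only [Set.mem_ofPred_eq, mul_apply', h1, h2, h3, h4]
    simp
  one_mem' := by simp
  inv_mem' := by
    rintro A ⟨h1, h2⟩
    simp [inv_eq_of, h1, h2]

/-- The subgroup of rotations. -/
def rotation (F : Type*) [Field F] : Subgroup (SL2 F) where
  carrier := {A | A 1 1 = A 0 0 ∧ A 0 1 = -A 1 0}
  mul_mem' := by
    rintro A B ⟨h1, h2⟩ ⟨h3, h4⟩
    simp only [Set.mem_ofPred_eq, mul_apply', h1, h2, h3, h4]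
    constructor <;> ring
  one_mem' := by simp
  inv_mem' := by
    rintro A ⟨h1, h2⟩
    simp [inv_eq_of, h1, h2]

/-- The group of upper unitriangular matrices. -/
def unipotent (F : Type*) [Field F] : Subgroup (SL2 F) where
  carrier := Set.range upper
  mul_mem' := by
    rintro _ _ ⟨x, rfl⟩ ⟨y, rfl⟩
    exact ⟨x + y, upper_add x y⟩
  one_mem' := ⟨0, upper_zero⟩
  inv_mem' := by
    rintro _ ⟨x, rfl⟩
    exact ⟨-x, by simp [inv_eq_of, upper]⟩

theorem mem_diagonal {A : SL2 F} : A ∈ diagonal F ↔ A 0 1 = 0 ∧ A 1 0 = 0 := Iff.rfl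

theorem mem_rotation {A : SL2 F} : A ∈ rotation F ↔ A 1 1 = A 0 0 ∧ A 0 1 = -A 1 0 := Iff.rfl

theorem neg_mem_diagonal {A : SL2 F} : -A ∈ diagonal F ↔ A ∈ diagonal F := by
  simp [mem_diagonal]

theorem neg_mem_rotation {A : SL2 F} : -A ∈ rotation F ↔ A ∈ rotation F := by
  simp [mem_rotation, neg_eq_iff_eq_neg]

/-- The trace. -/
def tr (A : SL2 F) : F := A 0 0 + A 1 1

theorem tr_eq_of_mul_eq {g X Y : SL2 F} (h : g * X = Y * g) : tr X = tr Y := by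
  have h1 : Y = g * X * g⁻¹ := by rw [h, mul_inv_cancel_right]
  rw [h1, inv_eq_of]
  simp only [tr, mul_apply', of_00, of_01, of_10, of_11]
  linear_combination (-(X 0 0) - X 1 1) * det_eq g

theorem tr_neg (A : SL2 F) : tr (-A) = -tr A := by
  simp [tr]
  ring

/-- The standard Weyl element. -/
def weyl (F : Type*) [Field F] : SL2 F := of 0 1 (-1) 0 (by ring)

/-- A diagonal matrix other than ±1 has two distinct eigenlines, the coordinate axes, and `g` must
preserve or exchange them. -/
theorem diagonal_conj {g X Y : SL2 F} (hX : X ∈ diagonal F) (hY : Y ∈ diagonal F)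
    (hX1 : X ≠ 1) (hX2 : X ≠ -1) (h : g * X = Y * g) :
    g ∈ diagonal F ∨ g * (weyl F)⁻¹ ∈ diagonal F := by
  obtain ⟨x1, x2⟩ := mem_diagonal.1 hX
  obtain ⟨y1, y2⟩ := mem_diagonal.1 hY
  have hne : X 0 0 ≠ X 1 1 := by
    intro he
    have hd := det_eq X
    rw [← he, x1, zero_mul, sub_zero, mul_self_eq_one_iff] at hd
    rcases hd with hd | hd
    · exact hX1 (by simp [eq_iff, x1, x2, ← he, hd])
    · exact hX2 (by simp [eq_iff, x1, x2, ← he, hd])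
  obtain ⟨e1, e2, e3, e4⟩ := eq_iff.1 h
  simp only [mul_apply', x1, x2, y1, y2, mul_zero, zero_mul, add_zero, zero_add] at e1 e2 e3 e4
  have hd := det_eq g
  have k1 : g 0 0 * g 0 1 = 0 := by
    have : (X 0 0 - X 1 1) * (g 0 0 * g 0 1) = 0 := by
      linear_combination g 0 1 * e1 - g 0 0 * e2
    exact (mul_eq_zero.1 this).resolve_left (sub_ne_zero.2 hne)
  have k2 : g 1 0 * g 1 1 = 0 := by
    have : (X 0 0 - X 1 1) * (g 1 0 * g 1 1) = 0 := by
      linear_combination g 1 1 * e3 - g 1 0 * e4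
    exact (mul_eq_zero.1 this).resolve_left (sub_ne_zero.2 hne)
  rcases mul_eq_zero.1 k1 with h0 | h0
  · right
    have : g 1 1 = 0 := by
      refine (mul_eq_zero.1 k2).resolve_left fun h1 => ?_
      rw [h0, h1] at hd
      simp at hd
    simp [mem_diagonal, mul_apply', inv_eq_of, weyl, h0, this]
  · left
    refine mem_diagonal.2 ⟨h0, (mul_eq_zero.1 k2).resolve_right fun h1 => ?_⟩
    rw [h0, h1] at hd
    simp at hd

theorem weyl_mul_diagonal {X : SL2 F} (hX : X ∈ diagonal F) : weyl F * X = X⁻¹ * weyl F := by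
  obtain ⟨x1, x2⟩ := mem_diagonal.1 hX
  simp [eq_iff, mul_apply', inv_eq_of, weyl, x1, x2]

theorem weyl_notMem_diagonal : weyl F ∉ diagonal F := by
  simp [mem_diagonal, weyl]

/-- Equality of traces leaves only Y = X or Y = X⁻¹. The first makes `g` a rotation. In the second,
`g` differs by a rotation from the given matrix, which inverts all rotations. -/
theorem rotation_conj (h2 : (2 : F) ≠ 0) {r s : F} (hrs : r * -r - s * s = 1) {g X Y : SL2 F}
    (hX : X ∈ rotation F)
    (hY : Y ∈ rotation F) (hX1 : X ≠ 1) (hX2 : X ≠ -1) (h : g * X = Y * g) :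
    g ∈ rotation F ∨ g * (of r s s (-r) hrs)⁻¹ ∈ rotation F := by
  have ht := tr_eq_of_mul_eq h
  obtain ⟨x1, x2⟩ := mem_rotation.1 hX
  obtain ⟨y1, y2⟩ := mem_rotation.1 hY
  have dX := det_eq X
  have dY := det_eq Y
  simp only [tr, x1, y1] at ht
  have hxy : X 0 0 = Y 0 0 := mul_left_cancel₀ h2 (by linear_combination ht)
  rw [x1, x2] at dX
  rw [y1, y2, ← hxy] at dY
  have hne : X 1 0 ≠ 0 := by
    intro h0
    rw [h0, mul_zero, sub_zero, mul_self_eq_one_iff] at dX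
    rcases dX with hd | hd
    · exact hX1 (by simp [eq_iff, x1, x2, h0, hd])
    · exact hX2 (by simp [eq_iff, x1, x2, h0, hd])
  obtain ⟨e1, e2, e3, e4⟩ := eq_iff.1 h
  simp only [mul_apply', x1, x2, y1, y2, ← hxy] at e1 e2 e3 e4
  have hsq : (X 1 0 - Y 1 0) * (X 1 0 + Y 1 0) = 0 := by linear_combination dX - dY
  rcases mul_eq_zero.1 hsq with h0 | h0
  · left
    have h0' : Y 1 0 = X 1 0 := (sub_eq_zero.1 h0).symm
    rw [h0'] at e1 e2 e3 e4
    refine mem_rotation.2 ⟨mul_left_cancel₀ hne ?_, mul_left_cancel₀ hne ?_⟩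
    · linear_combination e2
    · linear_combination e1
  · right
    have h0' : Y 1 0 = -X 1 0 := (neg_eq_of_add_eq_zero_right h0).symm
    rw [h0'] at e1 e2 e3 e4
    have k1 : g 1 1 = -g 0 0 := mul_left_cancel₀ hne (by linear_combination -e2)
    have k2 : g 0 1 = g 1 0 := mul_left_cancel₀ hne (by linear_combination e1)
    simp only [mem_rotation, mul_apply', inv_eq_of, of_00, of_01, of_10, of_11, k1, k2]
    constructor <;> ring

theorem mul_rotation {r s : F} (hrs : r * -r - s * s = 1) {X : SL2 F} (hX : X ∈ rotation F) :
    of r s s (-r) hrs * X = X⁻¹ * of r s s (-r) hrs := by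
  obtain ⟨x1, x2⟩ := mem_rotation.1 hX
  simp only [eq_iff, mul_apply', inv_eq_of, of_00, of_01, of_10, of_11, x1, x2]
  refine ⟨?_, ?_, ?_, ?_⟩ <;> ring

theorem notMem_rotation (h2 : (2 : F) ≠ 0) {r s : F} (hrs : r * -r - s * s = 1) :
    of r s s (-r) hrs ∉ rotation F := by
  simp only [mem_rotation, of_00, of_01, of_10, of_11]
  rintro ⟨h3, h4⟩
  have hr : r = 0 := by
    have : 2 * r = 0 := by linear_combination -h3
    exact (mul_eq_zero.1 this).resolve_left h2
  have hs : s = 0 := by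
    have : 2 * s = 0 := by linear_combination h4
    exact (mul_eq_zero.1 this).resolve_left h2
  rw [hr, hs] at hrs
  simp at hrs

theorem mul_upper {g : SL2 F} {x y : F} (hx : x ≠ 0) (h : g * upper x = upper y * g) :
    g 1 0 = 0 ∧ y = g 0 0 ^ 2 * x := by
  have hd := det_eq g
  obtain ⟨e1, e2, e3, e4⟩ := eq_iff.1 h
  simp only [mul_apply', upper, of_00, of_01, of_10, of_11] at e1 e2 e3 e4
  have hc : g 1 0 = 0 := by
    have : g 1 0 * x = 0 := by linear_combination e4
    exact (mul_eq_zero.1 this).resolve_right hx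
  refine ⟨hc, ?_⟩
  rw [hc] at hd
  linear_combination -g 0 0 * e2 - y * hd

theorem mul_upper_eq {g : SL2 F} (x : F) (h : g 1 0 = 0) :
    g * upper x = upper (g 0 0 ^ 2 * x) * g := by
  have hd := det_eq g
  rw [h] at hd
  simp only [eq_iff, mul_apply', upper, of_00, of_01, of_10, of_11, h]
  refine ⟨by ring, ?_, by ring, by ring⟩
  linear_combination -(g 0 0) * x * hd

/-- The traces would be 2 and -2. This is why conjugacy of unipotent elements is not affected by
passing to the quotient by ±1. -/
theorem mul_upper_ne_neg (h2 : (2 : F) ≠ 0) {g : SL2 F} {x y : F} :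
    g * upper x ≠ -(upper y * g) := by
  intro h
  rw [← neg_mul] at h
  have := tr_eq_of_mul_eq h
  rw [tr_neg] at this
  simp only [tr, upper, of_00, of_11] at this
  have h4 : (2 : F) * 2 = 0 := by linear_combination this
  exact h2 (mul_self_eq_zero.1 h4)

/-- According to whether tr² - 4 is zero, a nonzero square or minus a nonzero square, the
eigenvalues are a repeated ±1, distinct in `F`, or of the form x ± iy with i² = -1. The nonzero
entry allows explicit conjugating matrices. -/
theorem trichotomy_aux (h2 : (2 : F) ≠ 0) (hsq : ∀ z : F, IsSquare z ∨ IsSquare (-z))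
    (hsum : ∀ z : F, ∃ r s : F, r ^ 2 + s ^ 2 = z) (A : SL2 F) (hb : A 0 1 ≠ 0) :
    ∃ P B : SL2 F, (B ∈ diagonal F ∨ B ∈ rotation F ∨ B ∈ unipotent F ∨ -B ∈ unipotent F) ∧
      A * P = P * B := by
  have hd := det_eq A
  set a := A 0 0 with ha
  set b := A 0 1 with hb'
  set c := A 1 0 with hc
  set d := A 1 1 with hd'
  have h4 : (4 : F) ≠ 0 := by
    rw [show (4 : F) = 2 * 2 by norm_num]
    exact mul_ne_zero h2 h2
  by_cases h0 : (a + d - 2) * (a + d + 2) = 0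
  · rcases mul_eq_zero.1 h0 with ht | ht
    · refine ⟨of b 0 (1 - a) b⁻¹ (by field_simp; ring), upper b⁻¹,
        Or.inr (Or.inr (Or.inl ⟨_, rfl⟩)), ?_⟩
      simp only [eq_iff, mul_apply', of_00, of_01, of_10, of_11, upper, ← ha, ← hb', ← hc, ← hd']
      refine ⟨by ring, by ring, ?_, ?_⟩
      · linear_combination ht - hd
      · linear_combination b⁻¹ * ht
    · refine ⟨of b 0 (-1 - a) b⁻¹ (by field_simp; ring), -upper (-b⁻¹),
        Or.inr (Or.inr (Or.inr (by rw [neg_neg]; exact ⟨_, rfl⟩))), ?_⟩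
      simp only [eq_iff, mul_apply', of_00, of_01, of_10, of_11, upper, ← ha, ← hb', ← hc, ← hd',
        neg_apply']
      refine ⟨by ring, by ring, ?_, ?_⟩
      · linear_combination -ht - hd
      · linear_combination b⁻¹ * ht
  rcases hsq ((a + d) ^ 2 - 4) with ⟨s, hs⟩ | ⟨s, hs⟩
  · have hs0 : s ≠ 0 := by
      rintro rfl
      exact h0 (by linear_combination hs)
    obtain ⟨l, hl⟩ : ∃ l, 2 * l = a + d + s := ⟨(a + d + s) / 2, by field_simp⟩
    obtain ⟨m, hm⟩ : ∃ m, 2 * m = a + d - s := ⟨(a + d - s) / 2, by field_simp⟩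
    have hlm : l + m = a + d := mul_left_cancel₀ h2 (by linear_combination hl + hm)
    have hlm' : l * m = 1 := mul_left_cancel₀ h4 (by
      linear_combination 2 * m * hl + (a + d + s) * hm + hs)
    obtain ⟨k, hk⟩ : ∃ k, b * k * (m - l) = 1 := by
      have : m - l ≠ 0 := by
        intro h
        exact hs0 (mul_left_cancel₀ h2 (by linear_combination hm - hl - 2 * h) |>.trans rfl)
      exact ⟨(b * (m - l))⁻¹, by field_simp⟩
    -- The columns are eigenvectors for `l` and `m`, the second scaled by `k` to make the
    -- determinant one.
    refine ⟨of b (b * k) (l - a) (k * (m - a)) (by linear_combination hk),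
      of l 0 0 m (by linear_combination hlm'), Or.inl ⟨rfl, rfl⟩, ?_⟩
    simp only [eq_iff, mul_apply', of_00, of_01, of_10, of_11, ← ha, ← hb', ← hc, ← hd']
    refine ⟨by ring, by ring, ?_, ?_⟩
    · linear_combination -hd + hlm' - l * hlm
    · linear_combination k * (-hd + hlm' - m * hlm)
  · have hs0 : s ≠ 0 := by
      rintro rfl
      exact h0 (by linear_combination -hs)
    obtain ⟨x, hx⟩ : ∃ x, 2 * x = a + d := ⟨(a + d) / 2, by field_simp⟩
    obtain ⟨y, hy⟩ : ∃ y, 2 * y = s := ⟨s / 2, by field_simp⟩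
    have hy0 : y ≠ 0 := by
      rintro rfl
      exact hs0 (by rw [← hy, mul_zero])
    have hxy : x ^ 2 + y ^ 2 = 1 := mul_left_cancel₀ h4 (by
      linear_combination (2 * x + a + d) * hx + (2 * y + s) * hy - hs)
    -- The conjugating matrix has columns v = (p, r) and (A - x)v / y. Its determinant is Q(v)/y for
    -- Q(v) = cp² + (d-a)pr - br², so Q must represent y. Completing the square gives Q = -b(R² +
    -- S²) with R = r - ep and S = py/b, which reduces this to a sum of two squares.
    obtain ⟨R, S, hRS⟩ := hsum (-y * b⁻¹)
    obtain ⟨e, he⟩ : ∃ e, 2 * b * e = d - a := ⟨(d - a) / (2 * b), by field_simp⟩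
    obtain ⟨p, hp⟩ : ∃ p, p * y = S * b := ⟨S * b / y, by field_simp⟩
    have hRS' : b * (R ^ 2 + S ^ 2) = -y := by rw [hRS]; field_simp
    have hbe : b * (c + b * e ^ 2) = -y ^ 2 := mul_left_cancel₀ h4 (by
      linear_combination (2 * b * e + d - a) * he - 4 * hd - (2 * x + a + d) * hx + 4 * hxy)
    have hQ : c * p ^ 2 + (d - a) * p * (R + e * p) - b * (R + e * p) ^ 2 = y :=
      mul_left_cancel₀ hb (by
        linear_combination -b * p * (R + e * p) * he + p ^ 2 * hbe - (p * y + S * b) * hp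
          - b * hRS')
    obtain ⟨i, hi⟩ : ∃ i, y * i = 1 := ⟨y⁻¹, mul_inv_cancel₀ hy0⟩
    set r := R + e * p with hr
    refine ⟨of p ((a * p + b * r - x * p) * i) r ((c * p + d * r - x * r) * i)
      (by linear_combination i * hQ + hi), of x (-y) y x (by linear_combination hxy),
      Or.inr (Or.inl ⟨rfl, rfl⟩), ?_⟩
    simp only [eq_iff, mul_apply', of_00, of_01, of_10, of_11, ← ha, ← hb', ← hc, ← hd']
    refine ⟨?_, ?_, ?_, ?_⟩
    · linear_combination -(a * p + b * r - x * p) * hi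
    · linear_combination i * p * (hxy - a * hx - hd) - i * b * r * hx - p * y * hi
    · linear_combination -(c * p + d * r - x * r) * hi
    · linear_combination i * r * (hxy - d * hx - hd) - i * c * p * hx - r * y * hi

/-- Every matrix in `SL₂(F)` is up to sign conjugate to a diagonal matrix, a unipotent matrix or a
rotation. -/
theorem trichotomy (h2 : (2 : F) ≠ 0) (hsq : ∀ z : F, IsSquare z ∨ IsSquare (-z))
    (hsum : ∀ z : F, ∃ r s : F, r ^ 2 + s ^ 2 = z) (A : SL2 F) :
    ∃ P B : SL2 F, (B ∈ diagonal F ∨ B ∈ rotation F ∨ B ∈ unipotent F ∨ -B ∈ unipotent F) ∧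
      A * P = P * B := by
  by_cases hb : A 0 1 = 0
  · by_cases hc : A 1 0 = 0
    · exact ⟨1, A, Or.inl ⟨hb, hc⟩, by simp⟩
    · obtain ⟨P, B, hB, h⟩ := trichotomy_aux h2 hsq hsum ((weyl F)⁻¹ * A * weyl F) (by
        simp [mul_apply', inv_eq_of, weyl, hc])
      refine ⟨weyl F * P, B, hB, ?_⟩
      rw [mul_assoc, mul_assoc, inv_mul_eq_iff_eq_mul] at h
      rw [← mul_assoc, mul_assoc, h, mul_assoc]
  · exact trichotomy_aux h2 hsq hsum A hb

end SL2

end SL2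

/-! ### The split and the nonsplit torus of SL₂ and their orders. -/

section Tori

/-- A cyclic subgroup `T` which is a trivial intersection set, with an element outside `T`
inverting `T`, and such that these elements control fusion in `T`. -/
structure IsTorus {S : Type*} [Group S] (T : Subgroup S) : Prop where
  isCyclic : IsCyclic T
  exists_inv : ∃ w ∉ T, (∀ t ∈ T, w * t * w⁻¹ = t⁻¹) ∧
    ∀ t ∈ T, t ≠ 1 → ∀ g, g * t * g⁻¹ ∈ T → g ∈ T ∨ g * w⁻¹ ∈ T

/-- A surjective homomorphism `SL₂(F) → S` with kernel `{1, -1}`. -/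
structure IsPSL2 {F S : Type*} [Field F] [Group S] (π : SL2 F →* S) : Prop where
  surjective : Function.Surjective π
  eq_iff : ∀ A B, π A = π B ↔ A = B ∨ A = -B

namespace SL2

variable {F : Type*} [Field F]

theorem two_ne_zero_of_not_isSquare (h : ¬IsSquare (-1 : F)) : (2 : F) ≠ 0 := by
  intro h2
  exact h ⟨1, by linear_combination -h2⟩

theorem add_sq_ne_zero (h : ¬IsSquare (-1 : F)) (t : F) : 1 + t ^ 2 ≠ 0 := by
  intro h0
  exact h ⟨t, by linear_combination -h0⟩

theorem neg_ne_self (h2 : (2 : F) ≠ 0) (A : SL2 F) : -A ≠ A := by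
  intro h
  have h0 : ∀ x : F, -x = x → x = 0 := fun x hx =>
    (mul_eq_zero.1 (show 2 * x = 0 by linear_combination -hx)).resolve_left h2
  obtain ⟨e1, e2, e3, e4⟩ := eq_iff.1 h
  simp only [neg_apply'] at e1 e2 e3 e4
  have hd := det_eq A
  rw [h0 _ e1, h0 _ e2] at hd
  simp at hd

theorem card_diagonal [Finite F] : Nat.card (diagonal F) = Nat.card F - 1 := by
  rw [← Nat.card_units]
  refine Nat.card_congr (Equiv.ofBijective (fun u : Fˣ =>
    (⟨of u 0 0 ↑u⁻¹ (by simp), rfl, rfl⟩ : diagonal F)) ⟨fun u v h => ?_, fun ⟨A, hA⟩ => ?_⟩).symm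
  · have := (eq_iff.1 (Subtype.ext_iff.1 h)).1
    exact Units.ext this
  · obtain ⟨h1, h2⟩ := mem_diagonal.1 hA
    have hd := det_eq A
    rw [h1, zero_mul, sub_zero] at hd
    refine ⟨⟨A 0 0, A 1 1, hd, by rw [mul_comm, hd]⟩, Subtype.ext ?_⟩
    simp [eq_iff, h1, h2]

/-- Stereographic projection of the circle from the rotation -1, to which `none` is assigned. The
denominators 1 + t² do not vanish because -1 is not a square. -/
theorem card_rotation [Finite F] (hs : ¬IsSquare (-1 : F)) :
    Nat.card (rotation F) = Nat.card F + 1 := by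
  have h2 := two_ne_zero_of_not_isSquare hs
  have hne := add_sq_ne_zero hs
  let e : Option F → rotation F := fun o => match o with
    | none => ⟨-1, by simp [mem_rotation]⟩
    | some t => ⟨of ((1 - t ^ 2) / (1 + t ^ 2)) (-(2 * t / (1 + t ^ 2))) (2 * t / (1 + t ^ 2))
        ((1 - t ^ 2) / (1 + t ^ 2)) (by have := hne t; field_simp; ring), rfl, rfl⟩
  have he : Function.Bijective e := by
    constructor
    · have key : ∀ t : F, e (some t) ≠ e none := by
        intro t h
        have := (eq_iff.1 (Subtype.ext_iff.1 h)).1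
        simp only [e, of_00, neg_apply', one_00] at this
        have h0 := hne t
        field_simp at this
        exact h2 (by linear_combination this)
      rintro (_ | s) (_ | t) h
      · rfl
      · exact absurd h.symm (key t)
      · exact absurd h (key s)
      · obtain ⟨e1, -, e3, -⟩ := eq_iff.1 (Subtype.ext_iff.1 h)
        simp only [e, of_00, of_10] at e1 e3
        have hs := hne s
        have ht := hne t
        have h5 : 2 / (1 + s ^ 2) = 2 / (1 + t ^ 2) := by
          have a1 : (1 - s ^ 2) / (1 + s ^ 2) = 2 / (1 + s ^ 2) - 1 := by field_simp; ring
          have a2 : (1 - t ^ 2) / (1 + t ^ 2) = 2 / (1 + t ^ 2) - 1 := by field_simp; ring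
          linear_combination e1 - a1 + a2
        have h6 : 2 / (1 + s ^ 2) * (s - t) = 0 := by
          linear_combination e3 - t * h5
        have h7 := (mul_eq_zero.1 h6).resolve_left (div_ne_zero h2 hs)
        rw [sub_eq_zero.1 h7]
    · rintro ⟨A, hA⟩
      obtain ⟨h3, h4⟩ := mem_rotation.1 hA
      have hd := det_eq A
      rw [h3, h4] at hd
      by_cases h : 1 + A 0 0 = 0
      · refine ⟨none, Subtype.ext ?_⟩
        have ha : A 0 0 = -1 := by linear_combination h
        have hc : A 1 0 = 0 := by
          rw [ha] at hd
          exact mul_self_eq_zero.1 (by linear_combination hd)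
        simp [e, eq_iff, h3, h4, ha, hc]
      · refine ⟨some (A 1 0 / (1 + A 0 0)), Subtype.ext ?_⟩
        have h8 : (1 + A 0 0) * (1 + (A 1 0 / (1 + A 0 0)) ^ 2) = 2 := by
          field_simp
          linear_combination hd
        have h9 := hne (A 1 0 / (1 + A 0 0))
        have h10 : (1 - (A 1 0 / (1 + A 0 0)) ^ 2) / (1 + (A 1 0 / (1 + A 0 0)) ^ 2) = A 0 0 := by
          rw [div_eq_iff h9]
          linear_combination -h8
        have h11 : 2 * (A 1 0 / (1 + A 0 0)) / (1 + (A 1 0 / (1 + A 0 0)) ^ 2) = A 1 0 := by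
          rw [div_eq_iff h9, ← h8]
          field_simp
        simp only [e, eq_iff, of_00, of_01, of_10, of_11]
        exact ⟨h10, by rw [h11, h4], h11, by rw [h10, h3]⟩
  have := Nat.card_congr (Equiv.ofBijective e he)
  rw [← this, Finite.card_option]

theorem card_mul_card_units [Finite F] :
    Nat.card (SL2 F) * (Nat.card F - 1) = Nat.card (Matrix.GeneralLinearGroup (Fin 2) F) := by
  have h1 := (Matrix.GeneralLinearGroup.det (n := Fin 2) (R := F)).ker.card_mul_index
  rw [Subgroup.index_ker, MonoidHom.range_eq_top.2 Matrix.GeneralLinearGroup.det_surjective,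
    Subgroup.card_top, Nat.card_units] at h1
  rw [← h1]
  congr 1
  refine Nat.card_congr (Equiv.ofBijective (fun A : SL2 F =>
    (⟨Matrix.SpecialLinearGroup.toGL A, ?_⟩ :
      (Matrix.GeneralLinearGroup.det (n := Fin 2) (R := F)).ker)) ⟨fun A B h => ?_, fun A => ?_⟩)
  · have : Matrix.SpecialLinearGroup.toGL A ∈
      Set.range (Matrix.SpecialLinearGroup.toGL : SL2 F → _) := ⟨A, rfl⟩
    rwa [Matrix.SpecialLinearGroup.range_toGL] at this
  · exact Matrix.SpecialLinearGroup.toGL_injective (Subtype.ext_iff.1 h)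
  · have : A.1 ∈ Set.range (Matrix.SpecialLinearGroup.toGL : SL2 F → _) := by
      rw [Matrix.SpecialLinearGroup.range_toGL]
      exact A.2
    obtain ⟨B, hB⟩ := this
    exact ⟨B, Subtype.ext hB⟩

theorem card_eq [Finite F] : Nat.card (SL2 F) + Nat.card F = Nat.card F ^ 3 := by
  have h1 := card_mul_card_units (F := F)
  have := Fintype.ofFinite F
  rw [Matrix.card_GL_field, ← Nat.card_eq_fintype_card] at h1
  simp only [Fin.prod_univ_two, Fin.val_zero, Fin.val_one, pow_zero, pow_one] at h1
  have hq : 1 < Nat.card F := Finite.one_lt_card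
  obtain ⟨k, hk⟩ := Nat.exists_eq_add_of_lt hq
  rw [hk] at h1 ⊢
  have e1 : (1 + k + 1) - 1 = k + 1 := by omega
  have e2 : (1 + k + 1) ^ 2 - 1 = (k + 1) * (k + 3) := by
    rw [Nat.sub_eq_iff_eq_add (Nat.one_le_pow _ _ (by omega))]
    ring
  have e3 : (1 + k + 1) ^ 2 - (1 + k + 1) = (k + 2) * (k + 1) := by
    rw [Nat.sub_eq_iff_eq_add (by nlinarith)]
    ring
  rw [e1, e2, e3] at h1
  have h3 : Nat.card (SL2 F) = (k + 1) * (k + 3) * (k + 2) :=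
    Nat.eq_of_mul_eq_mul_right (show 0 < k + 1 by omega) (by rw [h1]; ring)
  rw [h3]
  ring

theorem card_projGenLinGroup [Finite F] :
    Nat.card (Matrix.ProjGenLinGroup (Fin 2) F) = Nat.card (SL2 F) := by
  have h1 := card_mul_card_units (F := F)
  have h2 := (Subgroup.center (Matrix.GeneralLinearGroup (Fin 2) F)).card_mul_index
  have h3 : Nat.card (Subgroup.center (Matrix.GeneralLinearGroup (Fin 2) F)) = Nat.card F - 1 := by
    rw [Matrix.GeneralLinearGroup.center_eq_range_scalar, ← Nat.card_units]
    refine Nat.card_congr (MonoidHom.ofInjective (f := Matrix.GeneralLinearGroup.scalar (Fin 2))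
      fun u v h => ?_).toEquiv.symm
    have := congrArg (fun M : Matrix.GeneralLinearGroup (Fin 2) F => M.1 0 0) h
    simpa [Units.ext_iff] using this
  have hq : 1 < Nat.card F := Finite.one_lt_card
  have h4 : Nat.card (Matrix.ProjGenLinGroup (Fin 2) F) =
    (Subgroup.center (Matrix.GeneralLinearGroup (Fin 2) F)).index := rfl
  rw [h4]
  rw [h3, ← h1, mul_comm] at h2
  exact Nat.eq_of_mul_eq_mul_right (by omega) h2

theorem isCyclic_diagonal [Finite F] : IsCyclic (diagonal F) := by
  refine isCyclic_of_injective_ringHom (R := F)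
    { toFun := fun A => A.1 0 0, map_one' := rfl, map_mul' := ?_ } ?_
  · rintro ⟨A, hA⟩ ⟨B, hB⟩
    simp [Matrix.mul_apply, (mem_diagonal.1 hA).1]
  · rintro ⟨A, hA⟩ ⟨B, hB⟩ h
    have h' : A 0 0 = B 0 0 := h
    obtain ⟨h1, h2⟩ := mem_diagonal.1 hA
    obtain ⟨h3, h4⟩ := mem_diagonal.1 hB
    have d1 := det_eq A
    have d2 := det_eq B
    rw [h1, zero_mul, sub_zero] at d1
    rw [h3, zero_mul, sub_zero, ← h'] at d2
    have h0 : A 0 0 ≠ 0 := by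
      intro h0
      simp [h0] at d1
    exact Subtype.ext (eq_iff.2 ⟨h', by rw [h1, h3], by rw [h2, h4],
      mul_left_cancel₀ h0 (by rw [d1, d2])⟩)

/-- With i² = -1, the map to a + ic embeds rotations in the multiplicative group of an algebraic
closure. It is injective because i does not lie in `F`. -/
theorem isCyclic_rotation [Finite F] (hs : ¬IsSquare (-1 : F)) : IsCyclic (rotation F) := by
  have h2 := two_ne_zero_of_not_isSquare hs
  obtain ⟨i, hi⟩ := IsAlgClosed.exists_pow_nat_eq (-1 : AlgebraicClosure F) (n := 2) (by norm_num)
  refine isCyclic_of_injective_ringHom (R := AlgebraicClosure F)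
    { toFun := fun A => algebraMap F _ (A.1 0 0) + i * algebraMap F _ (A.1 1 0),
      map_one' := by simp, map_mul' := ?_ } ?_
  · rintro ⟨A, hA⟩ ⟨B, hB⟩
    obtain ⟨h1, h2⟩ := mem_rotation.1 hA
    simp only [mul_apply', MulMemClass.mk_mul_mk, h1, h2, map_add, map_mul,
      map_neg]
    linear_combination -(algebraMap F (AlgebraicClosure F) (A 1 0)
      * algebraMap F (AlgebraicClosure F) (B 1 0)) * hi
  · rintro ⟨A, hA⟩ ⟨B, hB⟩ h
    have h' : algebraMap F (AlgebraicClosure F) (A 0 0) + i * algebraMap F _ (A 1 0)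
      = algebraMap F _ (B 0 0) + i * algebraMap F _ (B 1 0) := h
    obtain ⟨h1, h2⟩ := mem_rotation.1 hA
    obtain ⟨h3, h4⟩ := mem_rotation.1 hB
    have hinj := (algebraMap F (AlgebraicClosure F)).injective
    have hc : A 1 0 = B 1 0 := by
      by_contra hne
      have hne' : A 1 0 - B 1 0 ≠ 0 := sub_ne_zero.2 hne
      refine hs ⟨(B 0 0 - A 0 0) / (A 1 0 - B 1 0), ?_⟩
      have : -(A 1 0 - B 1 0) ^ 2 = (B 0 0 - A 0 0) ^ 2 := by
        apply hinj
        simp only [map_neg, map_pow, map_sub]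
        rw [← neg_one_mul, ← hi, ← mul_pow]
        congr 1
        linear_combination h'
      field_simp
      linear_combination this
    have ha : A 0 0 = B 0 0 := by
      apply hinj
      rw [hc] at h'
      exact add_right_cancel h'
    exact Subtype.ext (eq_iff.2 ⟨ha, by rw [h2, h4, hc], hc, by rw [h1, h3, ha]⟩)

end SL2

end Tori

/-! ### Tori and unipotent elements of PSL₂. -/

section PSL2

namespace IsPSL2

open SL2

variable {F S : Type*} [Field F] [Group S] {π : SL2 F →* S}

theorem map_neg (H : IsPSL2 π) (A : SL2 F) : π (-A) = π A :=
  (H.eq_iff _ _).2 (Or.inr rfl)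

theorem map_eq_one_iff (H : IsPSL2 π) {A : SL2 F} : π A = 1 ↔ A = 1 ∨ A = -1 := by
  rw [← map_one π, H.eq_iff]

theorem conj_eq_iff (H : IsPSL2 π) {g X Y : SL2 F} :
    π g * π X * (π g)⁻¹ = π Y ↔ g * X = Y * g ∨ g * X = -(Y * g) := by
  rw [mul_inv_eq_iff_eq_mul, ← map_mul, ← map_mul, H.eq_iff]

theorem isPSL2_mk' : IsPSL2 (QuotientGroup.mk' (Subgroup.center (SL2 F))) where
  surjective := QuotientGroup.mk'_surjective _
  eq_iff A B := by
    have hc : ∀ Z : SL2 F, Z ∈ Subgroup.center (SL2 F) ↔ Z = 1 ∨ Z = -1 := by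
      intro Z
      constructor
      · intro hZ
        obtain ⟨r, hr, hrZ⟩ := Matrix.SpecialLinearGroup.mem_center_iff.1 hZ
        rw [Fintype.card_fin, sq_eq_one_iff] at hr
        refine hr.imp ?_ ?_ <;> rintro rfl <;> refine Subtype.ext ?_ <;> rw [← hrZ] <;> ext i j <;>
          fin_cases i <;> fin_cases j <;> simp
      · rintro (rfl | rfl)
        · exact one_mem _
        · exact Subgroup.mem_center_iff.2 fun g => by simp
    rw [QuotientGroup.mk'_apply, QuotientGroup.mk'_apply, QuotientGroup.eq, hc,
      inv_mul_eq_iff_eq_mul, inv_mul_eq_iff_eq_mul]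
    constructor
    · rintro (h | h)
      · exact Or.inl (by rw [h, mul_one])
      · exact Or.inr (by rw [h]; simp)
    · rintro (h | h)
      · exact Or.inl (by rw [h, mul_one])
      · exact Or.inr (by rw [h]; simp)

theorem comp_mulEquiv (H : IsPSL2 π) {S' : Type*} [Group S'] (e : S ≃* S') :
    IsPSL2 (e.toMonoidHom.comp π) where
  surjective := e.surjective.comp H.surjective
  eq_iff A B := by simp [H.eq_iff]

theorem mem_map_iff (H : IsPSL2 π) {D : Subgroup (SL2 F)} (hneg : ∀ A, -A ∈ D ↔ A ∈ D) {A : SL2 F} :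
    π A ∈ D.map π ↔ A ∈ D := by
  refine ⟨?_, fun h => ⟨A, h, rfl⟩⟩
  rintro ⟨B, hB, hAB⟩
  rcases (H.eq_iff _ _).1 hAB with rfl | rfl
  · exact hB
  · exact (hneg A).1 hB

theorem isTorus (H : IsPSL2 π) {D : Subgroup (SL2 F)} (hneg : ∀ A, -A ∈ D ↔ A ∈ D)
    (hcyc : IsCyclic D) {w : SL2 F} (hw : w ∉ D) (hinv : ∀ X ∈ D, w * X = X⁻¹ * w)
    (hconj : ∀ g X Y, X ∈ D → Y ∈ D → X ≠ 1 → X ≠ -1 → g * X = Y * g → g ∈ D ∨ g * w⁻¹ ∈ D) :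
    IsTorus (D.map π) where
  isCyclic := isCyclic_of_surjective (π.subgroupMap D) (π.subgroupMap_surjective D)
  exists_inv := by
    refine ⟨π w, fun h => hw ((H.mem_map_iff hneg).1 h), ?_, ?_⟩
    · rintro _ ⟨X, hX, rfl⟩
      rw [← map_inv π X, H.conj_eq_iff]
      exact Or.inl (hinv X hX)
    · rintro _ ⟨X, hX, rfl⟩ h1 g hg
      obtain ⟨g, rfl⟩ := H.surjective g
      obtain ⟨Y, hY, hY'⟩ := hg
      have hX1 : X ≠ 1 := fun h => h1 (by rw [h, map_one])
      have hX2 : X ≠ -1 := fun h => h1 (H.map_eq_one_iff.2 (Or.inr h))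
      rw [← map_inv, ← map_mul, H.mem_map_iff hneg, H.mem_map_iff hneg]
      rcases H.conj_eq_iff.1 hY'.symm with h | h
      · exact hconj g X Y hX hY hX1 hX2 h
      · exact hconj g X (-Y) hX ((hneg Y).2 hY) hX1 hX2 (by rw [h, neg_mul])

theorem two_mul_card_map [Finite F] (H : IsPSL2 π) (h2 : (2 : F) ≠ 0) {D : Subgroup (SL2 F)}
    (hneg : ∀ A, -A ∈ D ↔ A ∈ D) : 2 * Nat.card (D.map π) = Nat.card D := by
  have h := (π.subgroupMap D).ker.card_mul_index
  rw [Subgroup.index_ker, MonoidHom.range_eq_top.2 (π.subgroupMap_surjective D),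
    Subgroup.card_top] at h
  rw [← h]
  congr 1
  have hm : (-1 : SL2 F) ∈ D := (hneg 1).2 (one_mem _)
  have : ((π.subgroupMap D).ker : Set D) = {1, ⟨-1, hm⟩} := by
    ext ⟨A, hA⟩
    simp [MonoidHom.mem_ker, Subtype.ext_iff, H.map_eq_one_iff]
  rw [← SetLike.coe_sort_coe, this, Nat.card_coe_set_eq, Set.ncard_pair]
  intro h
  exact neg_ne_self h2 1 (Subtype.ext_iff.1 h).symm

theorem two_mul_card [Finite F] (H : IsPSL2 π) (h2 : (2 : F) ≠ 0) :
    2 * Nat.card S = Nat.card (SL2 F) := by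
  have := H.two_mul_card_map h2 (D := ⊤) (by simp)
  rwa [← MonoidHom.range_eq_map, MonoidHom.range_eq_top.2 H.surjective, Subgroup.card_top,
    Subgroup.card_top] at this

theorem map_upper_conj_iff (H : IsPSL2 π) (h2 : (2 : F) ≠ 0) {g : SL2 F} {x y : F} (hx : x ≠ 0) :
    π g * π (upper x) * (π g)⁻¹ = π (upper y) ↔ g 1 0 = 0 ∧ y = g 0 0 ^ 2 * x := by
  rw [H.conj_eq_iff]
  constructor
  · rintro (h | h)
    · exact mul_upper hx h
    · exact absurd h (mul_upper_ne_neg h2)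
  · rintro ⟨h, rfl⟩
    exact Or.inl (mul_upper_eq x h)

theorem map_upper_injective (H : IsPSL2 π) (h2 : (2 : F) ≠ 0) :
    Function.Injective fun x => π (upper x) := by
  intro x y h
  rcases (H.eq_iff _ _).1 h with h | h
  · exact (SL2.eq_iff.1 h).2.1
  · have := (SL2.eq_iff.1 h).1
    simp only [upper, of_00, neg_apply'] at this
    exact absurd (by linear_combination this) h2

/-- Centralizers of unipotent elements are unipotent. -/
theorem commute_upper (H : IsPSL2 π) (h2 : (2 : F) ≠ 0) {s : S} {x : F} (hx : x ≠ 0)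
    (h : s * π (upper x) * s⁻¹ = π (upper x)) : ∃ y, s = π (upper y) := by
  obtain ⟨g, rfl⟩ := H.surjective s
  obtain ⟨h10, hxx⟩ := (H.map_upper_conj_iff h2 hx).1 h
  have h00 : g 0 0 ^ 2 = 1 := mul_right_cancel₀ hx (by rw [← hxx, one_mul])
  have hd := det_eq g
  rw [h10, mul_zero, sub_zero] at hd
  rcases sq_eq_one_iff.1 h00 with h | h
  · refine ⟨g 0 1, congrArg π (SL2.eq_iff.2 ?_)⟩
    rw [h, one_mul] at hd
    simp [upper, h, h10, hd]
  · refine ⟨-g 0 1, (H.eq_iff _ _).2 (Or.inr (SL2.eq_iff.2 ?_))⟩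
    have hd' : g 1 1 = -1 := by
      rw [h] at hd
      linear_combination -hd
    simp [upper, h, h10, hd']

/-- A matrix conjugating a nontrivial unipotent upper matrix to another is upper triangular and
scales the parameter by a square. Classes of such elements thus correspond to square classes. -/
theorem isConj_map_upper_iff (H : IsPSL2 π) (h2 : (2 : F) ≠ 0) {x y : F} (hx : x ≠ 0) :
    IsConj (π (upper x)) (π (upper y)) ↔ ∃ z, z ≠ 0 ∧ y = z ^ 2 * x := by
  rw [isConj_iff]
  constructor
  · rintro ⟨s, hs⟩
    obtain ⟨g, rfl⟩ := H.surjective s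
    obtain ⟨h10, hxx⟩ := (H.map_upper_conj_iff h2 hx).1 hs
    refine ⟨g 0 0, fun h => ?_, hxx⟩
    have hd := det_eq g
    simp [h, h10] at hd
  · rintro ⟨z, hz, rfl⟩
    exact ⟨π (of z 0 0 z⁻¹ (by simp [hz])), (H.map_upper_conj_iff h2 hx).2 ⟨rfl, rfl⟩⟩

theorem isTorus_diagonal [Finite F] (H : IsPSL2 π) : IsTorus ((diagonal F).map π) :=
  H.isTorus (fun _ => neg_mem_diagonal) isCyclic_diagonal weyl_notMem_diagonal
    (fun _ => weyl_mul_diagonal) fun _ _ _ => diagonal_conj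

theorem isTorus_rotation [Finite F] (H : IsPSL2 π) (hs : ¬IsSquare (-1 : F)) {r s : F}
    (hrs : r * -r - s * s = 1) : IsTorus ((rotation F).map π) :=
  H.isTorus (fun _ => neg_mem_rotation) (isCyclic_rotation hs)
    (notMem_rotation (two_ne_zero_of_not_isSquare hs) hrs)
    (fun _ => mul_rotation hrs)
    fun _ _ _ => rotation_conj (two_ne_zero_of_not_isSquare hs) hrs

end IsPSL2

end PSL2

/-! ### The generalized character supported on elements of order dividing 3. -/

section TorusDecomposition

variable {S : Type*} [Group S]

open Classical in
/-- The class function with value `q² - 1` at `1`, value `-1` at the other elements of order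
dividing `3`, and `0` elsewhere. -/
noncomputable def unipotentChar (S : Type*) [Group S] (q : ℕ) : S → ℂ := fun g =>
  if g = 1 then (q : ℂ) ^ 2 - 1 else if g ^ 3 = 1 then -1 else 0

theorem unipotentChar_one (q : ℕ) : unipotentChar S q 1 = (q : ℂ) ^ 2 - 1 := if_pos rfl

theorem unipotentChar_of_pow_eq {q : ℕ} {g : S} (h1 : g ≠ 1) (h3 : g ^ 3 = 1) :
    unipotentChar S q g = -1 := by
  rw [unipotentChar, if_neg h1, if_pos h3]

theorem unipotentChar_of_pow_ne {q : ℕ} {g : S} (h3 : g ^ 3 ≠ 1) :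
    unipotentChar S q g = 0 := by
  rw [unipotentChar, if_neg (fun h => h3 (by rw [h, one_pow])), if_neg h3]

theorem unipotentChar_mulEquiv (q : ℕ) (φ : MulAut S) (g : S) :
    unipotentChar S q (φ g) = unipotentChar S q g := by
  have h1 : φ g = 1 ↔ g = 1 := map_eq_one_iff φ φ.injective
  have h3 : φ g ^ 3 = 1 ↔ g ^ 3 = 1 := by rw [← map_pow, map_eq_one_iff φ φ.injective]
  unfold unipotentChar
  congr 1
  · rw [h1]
  · congr 1
    rw [h3]

theorem isClassFunction_unipotentChar (q : ℕ) : IsClassFunction (unipotentChar S q) := fun x g =>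
  unipotentChar_mulEquiv q (MulAut.conj x) g

theorem unipotentChar_inv (q : ℕ) (g : S) : unipotentChar S q g⁻¹ = unipotentChar S q g := by
  have h3 : g⁻¹ ^ 3 = 1 ↔ g ^ 3 = 1 := by rw [inv_pow, inv_eq_one]
  unfold unipotentChar
  congr 1
  · rw [inv_eq_one]
  · congr 1
    rw [h3]

/-- A group decomposed, like `PSL₂(q)`, as the union of the conjugates of two tori of orders
`(q - 1) / 2` and `(q + 1) / 2` and of a set of elements of order three. -/
structure TorusDecomposition [Finite S] (q : ℕ) (T₁ T₂ : Subgroup S) : Prop where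
  three_dvd : 3 ∣ q
  mod_eight : q % 8 = 3
  torus₁ : IsTorus T₁
  torus₂ : IsTorus T₂
  card₁ : 2 * Nat.card T₁ + 1 = q
  card₂ : 2 * Nat.card T₂ = q + 1
  card : 2 * Nat.card S + q = q ^ 3
  cover : ∀ g : S, g ^ 3 = 1 ∨ (∃ x, x * g * x⁻¹ ∈ T₁) ∨ ∃ x, x * g * x⁻¹ ∈ T₂
  exists_unipotent : ∃ g : S, g ^ 3 = 1 ∧ g ≠ 1
  isConj_or : ∀ g h : S, g ^ 3 = 1 → g ≠ 1 → h ^ 3 = 1 → h ≠ 1 → IsConj g h ∨ IsConj g h⁻¹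
  not_isConj_inv : ∀ g : S, g ^ 3 = 1 → g ≠ 1 → ¬IsConj g g⁻¹
  cf_unipotentChar_int : ∀ χ, IsIrreducibleCharacter χ → ∃ n : ℤ, cf (unipotentChar S q) χ = n
  cf_unipotentChar_self : cf (unipotentChar S q) (unipotentChar S q) = 2 * q

theorem card_conj_eq {a b : S} (h : IsConj a b) :
    Nat.card {x // x * a * x⁻¹ = b} = Nat.card {x // x * a * x⁻¹ = a} := by
  obtain ⟨c, rfl⟩ := isConj_iff.1 h
  refine Nat.card_congr ((Equiv.mulLeft c).subtypeEquiv fun x => ?_).symm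
  simp only [Equiv.coe_mulLeft]
  rw [mul_inv_rev, show c * x * a * (x⁻¹ * c⁻¹) = c * (x * a * x⁻¹) * c⁻¹ by group,
    mul_left_inj, mul_right_inj]

section Induced

variable {N : Type*} [CommGroup N] {ν : N →* S} {q : ℕ} {θ : N →* ℂ}

theorem sum_add_inv_eq_zero [Fintype N] (hθ : θ ≠ 1) : ∑ n, (θ n + θ n⁻¹) = 0 := by
  have h : ∑ n, θ n⁻¹ = ∑ n, θ n := Equiv.sum_comp (Equiv.inv N) fun n => θ n
  rw [Finset.sum_add_distrib, h, sum_hom_units_eq_zero θ hθ, add_zero]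

/-- The induced character of a sum of two nontrivial linear characters of a Sylow subgroup. -/
theorem indCF_eq_unipotentChar [Finite N] [Finite S] (hν : Function.Injective ν) (hq : Nat.card N = q)
    (hS : 2 * Nat.card S + q = q ^ 3) (hcube : ∀ n, ν n ^ 3 = 1)
    (hcov : ∀ g : S, g ^ 3 = 1 → ∃ x n, x * g * x⁻¹ = ν n)
    (hcent : ∀ n, n ≠ 1 → ∀ s, s * ν n * s⁻¹ = ν n → ∃ m, s = ν m)
    (hfus : ∀ m n, m ≠ 1 → n ≠ 1 → IsConj (ν m) (ν n) ∨ IsConj (ν m) (ν n⁻¹))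
    (hinv : ∀ m, m ≠ 1 → ¬IsConj (ν m) (ν m⁻¹)) (hθ : θ ≠ 1) :
    indCF ν (fun n => θ n + θ n⁻¹) = unipotentChar S q := by
  classical
  have := Fintype.ofFinite N
  have := Fintype.ofFinite S
  have hqpos : 0 < q := hq ▸ Nat.card_pos
  have hq0 : (q : ℂ) ≠ 0 := by exact_mod_cast hqpos.ne'
  have hSC : 2 * (Nat.card S : ℂ) + q = q ^ 3 := by exact_mod_cast hS
  have hsum : ∑ n, (θ n + θ n⁻¹) = 0 := sum_add_inv_eq_zero hθ
  funext g
  rw [indCF_apply, hq]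
  by_cases hg1 : g = 1
  · subst hg1
    rw [unipotentChar_one]
    have : ∀ x : S, ∑ n, (if ν n = x * 1 * x⁻¹ then θ n + θ n⁻¹ else 0) = 2 := by
      intro x
      rw [Finset.sum_eq_single 1]
      · simp
        norm_num
      · intro n _ hn
        rw [mul_one, mul_inv_cancel, if_neg]
        exact fun h => hn (hν (by rw [h, map_one]))
      · simp
    rw [Finset.sum_congr rfl fun x _ => this x, Finset.sum_const, Finset.card_univ,
      ← Nat.card_eq_fintype_card, nsmul_eq_mul]
    field_simp
    linear_combination hSC
  by_cases hg3 : g ^ 3 = 1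
  · rw [unipotentChar_of_pow_eq hg1 hg3]
    obtain ⟨x, y, hxy⟩ := hcov g hg3
    have hy : y ≠ 1 := by
      rintro rfl
      rw [map_one, mul_inv_eq_one, mul_eq_left] at hxy
      exact hg1 hxy
    have hcl := isClassFunction_indCF (ι := ν) (fun n => θ n + θ n⁻¹) x g
    rw [indCF_apply, indCF_apply, hq, hxy] at hcl
    rw [← hcl]
    -- `N' n` counts the elements conjugating `ν y` to `ν n`. It is `q` or 0, and for `n ≠ 1`
    -- exactly one of `n`, `n⁻¹` gives `q`. Since θ + θ⁻¹ is symmetric, `N'` may be replaced by its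
    -- average q/2 off the identity.
    set N' : N → ℂ := fun n => (Nat.card {x // x * ν y * x⁻¹ = ν n} : ℂ) with hN'
    have h1 : ∑ x : S, ∑ n, (if ν n = x * ν y * x⁻¹ then θ n + θ n⁻¹ else 0) =
        ∑ n, (θ n + θ n⁻¹) * N' n := by
      rw [Finset.sum_comm]
      refine Finset.sum_congr rfl fun n _ => ?_
      rw [← Finset.sum_filter, Finset.sum_const, nsmul_eq_mul, mul_comm, hN']
      simp only [Nat.card_eq_fintype_card, Fintype.card_subtype, eq_comm]
    have hcard : Nat.card {x // x * ν y * x⁻¹ = ν y} = q := by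
      rw [← hq]
      refine Nat.card_congr (Equiv.ofBijective (fun n : N =>
        (⟨ν n, by rw [← map_mul, ← map_inv, ← map_mul, mul_comm n, mul_inv_cancel_right]⟩ :
          {x // x * ν y * x⁻¹ = ν y})) ⟨fun m n h => hν (Subtype.ext_iff.1 h), fun s => ?_⟩).symm
      obtain ⟨m, hm⟩ := hcent y hy s.1 s.2
      exact ⟨m, Subtype.ext hm.symm⟩
    have hzero : ∀ n, ¬IsConj (ν y) (ν n) → N' n = 0 := by
      intro n hn
      simp only [hN', Nat.cast_eq_zero]
      have : IsEmpty {x // x * ν y * x⁻¹ = ν n} := ⟨fun x => hn (isConj_iff.2 ⟨x.1, x.2⟩)⟩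
      exact Nat.card_of_isEmpty
    have hq' : ∀ n, IsConj (ν y) (ν n) → N' n = q := by
      intro n hn
      simp only [hN', card_conj_eq hn, hcard]
    have hN1 : N' 1 = 0 := by
      refine hzero 1 fun h => hy (hν ?_)
      rw [map_one] at h
      rw [map_one, isConj_one_left.1 h]
    have hNN : ∀ n, n ≠ 1 → N' n + N' n⁻¹ = q := by
      intro n hn
      have hmain : ∀ n, n ≠ 1 → IsConj (ν y) (ν n) → N' n + N' n⁻¹ = q := by
        intro n hn h
        rw [hq' n h, hzero n⁻¹ fun h' => hinv n hn (h.symm.trans h'), add_zero]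
      rcases hfus y n hy hn with h | h
      · exact hmain n hn h
      · have := hmain n⁻¹ (inv_ne_one.2 hn) h
        rwa [inv_inv, add_comm] at this
    have h2 : ∑ n, (θ n + θ n⁻¹) * N' n = ∑ n, (θ n + θ n⁻¹) * N' n⁻¹ := by
      rw [← Equiv.sum_comp (Equiv.inv N)]
      refine Finset.sum_congr rfl fun n _ => ?_
      simp only [Equiv.inv_apply, inv_inv]
      ring
    have h3 : ∑ n, (θ n + θ n⁻¹) * N' n + ∑ n, (θ n + θ n⁻¹) * N' n⁻¹ = -2 * q := by
      rw [← Finset.sum_add_distrib, ← Finset.add_sum_erase _ _ (Finset.mem_univ 1)]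
      have : ∀ n ∈ Finset.univ.erase (1 : N), (θ n + θ n⁻¹) * N' n + (θ n + θ n⁻¹) * N' n⁻¹
          = (θ n + θ n⁻¹) * q := by
        intro n hn
        rw [← mul_add, hNN n (Finset.ne_of_mem_erase hn)]
      rw [Finset.sum_congr rfl this, ← Finset.sum_mul,
        Finset.sum_erase_eq_sub (Finset.mem_univ _), hsum, inv_one, hN1]
      simp
      ring
    rw [h1]
    have h4 : ∑ n, (θ n + θ n⁻¹) * N' n = -q := by
      rw [← h2] at h3
      linear_combination h3 / 2
    rw [h4]
    field_simp
  · rw [unipotentChar_of_pow_ne hg3]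
    simp only [mul_eq_zero, inv_eq_zero]
    right
    refine Finset.sum_eq_zero fun x _ => Finset.sum_eq_zero fun n _ => if_neg fun h => hg3 ?_
    have h3 : (x * g * x⁻¹) ^ 3 = 1 := by rw [← h, hcube]
    rwa [conj_pow, mul_inv_eq_one, mul_eq_left] at h3

/-- Frobenius reciprocity moves both products to `N`, where integrality is clear and the induced
function is -1 off the identity. -/
theorem cf_unipotentChar [Finite N] [Finite S] (hν : Function.Injective ν) (hq : Nat.card N = q)
    (hcube : ∀ n, ν n ^ 3 = 1) (hθ : θ ≠ 1)
    (h : indCF ν (fun n => θ n + θ n⁻¹) = unipotentChar S q) :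
    (∀ χ, IsIrreducibleCharacter χ → ∃ n : ℤ, cf (unipotentChar S q) χ = n) ∧
      cf (unipotentChar S q) (unipotentChar S q) = 2 * q := by
  classical
  have := Fintype.ofFinite N
  have := Fintype.ofFinite S
  have hqpos : 0 < q := hq ▸ Nat.card_pos
  have hq0 : (q : ℂ) ≠ 0 := by exact_mod_cast hqpos.ne'
  constructor
  · intro χ hχ
    obtain ⟨a, ha⟩ := (isCharacter_monoidHom θ).cf_nat (hχ.isCharacter.comp ν)
    obtain ⟨b, hb⟩ := (isCharacter_monoidHom θ).inv.cf_nat (hχ.isCharacter.comp ν)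
    refine ⟨a + b, ?_⟩
    rw [← h, cf_indCF _ hχ.isClassFunction,
      show (fun n => θ n + θ n⁻¹) = θ + fun n => θ n⁻¹ from rfl, map_add, LinearMap.add_apply,
      ha, hb]
    push_cast
    rfl
  · have hsum : ∑ n, (θ n + θ n⁻¹) = 0 := sum_add_inv_eq_zero hθ
    conv_lhs => rw [← h]
    rw [cf_indCF _ (h ▸ isClassFunction_unipotentChar q), h, cf_apply, hq,
      ← Finset.add_sum_erase _ _ (Finset.mem_univ 1)]
    have : ∀ n ∈ Finset.univ.erase (1 : N), (θ n + θ n⁻¹) * (unipotentChar S q ∘ ν) n⁻¹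
        = (θ n + θ n⁻¹) * -1 := by
      intro n hn
      rw [Function.comp_apply, unipotentChar_of_pow_eq _ (hcube _)]
      rw [Ne, map_eq_one_iff ν hν, inv_eq_one]
      exact Finset.ne_of_mem_erase hn
    rw [Finset.sum_congr rfl this, ← Finset.sum_mul,
        Finset.sum_erase_eq_sub (Finset.mem_univ _), hsum]
    simp only [inv_one, map_one, Function.comp_apply, unipotentChar_one]
    field_simp
    ring

end Induced

end TorusDecomposition

/-! ### Characters of degree q + ε attached to a torus. -/

section TorusCharacters

variable {S : Type*} [Group S] {T : Subgroup S}

theorem IsTorus.mul_comm (h : IsTorus T) (a b : T) : a * b = b * a := by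
  have := h.isCyclic
  exact IsMulCommutative.is_comm.comm a b

theorem IsTorus.indCF_one [Finite S] (f : T → ℂ) :
    indCF T.subtype f 1 = Nat.card S / Nat.card T * f 1 := by
  classical
  have := Fintype.ofFinite S
  have := Fintype.ofFinite T
  rw [indCF_apply]
  have : ∀ x : S, ∑ t : T, (if T.subtype t = x * 1 * x⁻¹ then f t else 0) = f 1 := by
    intro x
    rw [Finset.sum_eq_single 1]
    · simp
    · intro n _ hn
      rw [mul_one, mul_inv_cancel, if_neg]
      exact fun h => hn (Subtype.ext h)
    · simp
  rw [Finset.sum_congr rfl fun x _ => this x, Finset.sum_const, Finset.card_univ,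
    ← Nat.card_eq_fintype_card, nsmul_eq_mul]
  ring

theorem IsTorus.indCF_of_forall_notMem [Finite S] (f : T → ℂ) {g : S} (hg : ∀ x, x * g * x⁻¹ ∉ T) :
    indCF T.subtype f g = 0 := by
  classical
  have := Fintype.ofFinite S
  have := Fintype.ofFinite T
  rw [indCF_apply]
  simp only [mul_eq_zero, inv_eq_zero]
  right
  exact Finset.sum_eq_zero fun x _ => Finset.sum_eq_zero fun t _ => if_neg fun h =>
    hg x (by rw [← h]; exact t.2)

/-- The elements conjugating `t` into `T` are those of `T` and of `T w`. The former fix `t` and the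
latter invert it. -/
theorem IsTorus.indCF_of_mem [Finite S] (hT : IsTorus T) (f : T → ℂ) {t : T} (ht : t ≠ 1) :
    indCF T.subtype f t = f t + f t⁻¹ := by
  classical
  have := Fintype.ofFinite S
  have := Fintype.ofFinite T
  obtain ⟨w, hw, hinv, hfus⟩ := hT.exists_inv
  have ht' : (t : S) ≠ 1 := fun h => ht (Subtype.ext h)
  rw [indCF_apply]
  have h1 : ∀ x : S, ∑ s : T, (if T.subtype s = x * t * x⁻¹ then f s else 0) =
      (if x ∈ T then f t else 0) + (if x * w⁻¹ ∈ T then f t⁻¹ else 0) := by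
    have hsum : ∀ (x : S) (r : T), x * t * x⁻¹ = r →
        ∑ s : T, (if T.subtype s = x * t * x⁻¹ then f s else 0) = f r := by
      intro x r hr
      rw [Finset.sum_eq_single r]
      · rw [if_pos (show T.subtype r = _ from hr.symm)]
      · intro s _ hs
        rw [if_neg]
        exact fun h => hs (Subtype.ext (h.trans hr))
      · simp
    intro x
    by_cases hx : x ∈ T
    · have hxw : x * w⁻¹ ∉ T := fun h => hw (by
        have := T.mul_mem (T.inv_mem h) hx
        simpa using this)
      rw [if_pos hx, if_neg hxw, add_zero, hsum x t]
      have := congrArg (fun z : T => (z : S)) (hT.mul_comm ⟨x, hx⟩ t)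
      simp only [Subgroup.coe_mul] at this
      rw [this, mul_inv_cancel_right]
    · by_cases hxw : x * w⁻¹ ∈ T
      · rw [if_neg hx, if_pos hxw, zero_add, hsum x t⁻¹]
        have := congrArg (fun z : T => (z : S)) (hT.mul_comm ⟨x * w⁻¹, hxw⟩ t⁻¹)
        simp only [Subgroup.coe_mul, Subgroup.coe_inv] at this
        have h2 := hinv t t.2
        rw [mul_inv_eq_iff_eq_mul] at h2
        rw [mul_inv_eq_iff_eq_mul, Subgroup.coe_inv]
        calc x * t = x * w⁻¹ * (w * t) := by group
          _ = x * w⁻¹ * (t : S)⁻¹ * w := by rw [h2]; group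
          _ = (t : S)⁻¹ * x := by rw [this]; group
      · rw [if_neg hx, if_neg hxw, add_zero]
        refine Finset.sum_eq_zero fun s _ => if_neg fun h => ?_
        rcases hfus t t.2 ht' x (by rw [← h]; exact s.2) with h | h
        · exact hx h
        · exact hxw h
  have h2 : ∀ c : ℂ, ∑ x : S, (if x ∈ T then c else 0) = Nat.card T * c := by
    intro c
    rw [← Finset.sum_filter, Finset.sum_const, nsmul_eq_mul, Nat.card_eq_fintype_card,
      Fintype.card_subtype]
  have h3 : ∀ c : ℂ, ∑ x : S, (if x * w⁻¹ ∈ T then c else 0) = Nat.card T * c := by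
    intro c
    rw [← h2]
    exact Equiv.sum_comp (Equiv.mulRight w⁻¹) fun x => if x ∈ T then c else 0
  rw [Finset.sum_congr rfl fun x _ => h1 x, Finset.sum_add_distrib, h2, h3]
  have : (Nat.card T : ℂ) ≠ 0 := card_ne_zero_complex
  field_simp

/-- The torus is inverted in `S`, so induction sees only the part of a function that is symmetric
under inversion. -/
theorem IsTorus.indCF_congr [Finite S] (hT : IsTorus T) {f f' : T → ℂ}
    (h : ∀ t, f t + f t⁻¹ = f' t + f' t⁻¹) : indCF T.subtype f = indCF T.subtype f' := by
  funext g
  have h1 : f 1 = f' 1 := by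
    have := h 1
    rw [inv_one] at this
    linear_combination this / 2
  by_cases hg : ∃ x, x * g * x⁻¹ ∈ T
  · obtain ⟨x, hx⟩ := hg
    rw [← isClassFunction_indCF T.subtype f x g, ← isClassFunction_indCF T.subtype f' x g]
    by_cases hx1 : x * g * x⁻¹ = 1
    · rw [hx1, IsTorus.indCF_one, IsTorus.indCF_one, h1]
    · have hne : (⟨x * g * x⁻¹, hx⟩ : T) ≠ 1 := fun h => hx1 (Subtype.ext_iff.1 h)
      have e1 := hT.indCF_of_mem f hne
      have e2 := hT.indCF_of_mem f' hne
      rw [h] at e1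
      exact e1.trans e2.symm
  · push Not at hg
    rw [IsTorus.indCF_of_forall_notMem f hg, IsTorus.indCF_of_forall_notMem f' hg]

/-- A torus of `PSL₂(q)` of order `(q - ε) / 2`. -/
structure TorusOfSign [Finite S] (q : ℕ) (ε : ℤ) (T : Subgroup S) : Prop where
  torus : IsTorus T
  sign : ε = 1 ∨ ε = -1
  three_dvd : 3 ∣ q
  mod_eight : q % 8 = 3
  card : (2 * Nat.card T : ℤ) = q - ε
  card_group : 2 * Nat.card S + q = q ^ 3
  cf_unipotentChar_int : ∀ χ, IsIrreducibleCharacter χ → ∃ n : ℤ, cf (unipotentChar S q) χ = n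
  cf_unipotentChar_self : cf (unipotentChar S q) (unipotentChar S q) = 2 * q

theorem TorusDecomposition.torusOfSign₁ [Finite S] {q : ℕ} {T₁ T₂ : Subgroup S}
    (D : TorusDecomposition q T₁ T₂) : TorusOfSign q 1 T₁ :=
  ⟨D.torus₁, Or.inl rfl, D.three_dvd, D.mod_eight, by have := D.card₁; omega, D.card,
    D.cf_unipotentChar_int, D.cf_unipotentChar_self⟩

theorem TorusDecomposition.torusOfSign₂ [Finite S] {q : ℕ} {T₁ T₂ : Subgroup S}
    (D : TorusDecomposition q T₁ T₂) : TorusOfSign q (-1) T₂ :=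
  ⟨D.torus₂, Or.inr rfl, D.three_dvd, D.mod_eight, by have := D.card₂; omega, D.card,
    D.cf_unipotentChar_int, D.cf_unipotentChar_self⟩

/-- The generalized character attached to a character of a torus. -/
noncomputable def torusChar [Finite S] (q : ℕ) (ε : ℤ) {T : Subgroup S} (f : T → ℂ) : S → ℂ :=
  (ε : ℂ) • (indCF T.subtype f - unipotentChar S q)

namespace TorusOfSign

variable [Finite S] {q : ℕ} {ε : ℤ}

theorem isClassFunction (q : ℕ) (ε : ℤ) (f : T → ℂ) : IsClassFunction (torusChar q ε f) :=
  ((isClassFunction_indCF T.subtype f).sub (isClassFunction_unipotentChar q)).smul _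

theorem sign_sq (P : TorusOfSign q ε T) : (ε : ℂ) * ε = 1 := by
  rcases P.sign with rfl | rfl <;> norm_num

theorem card_complex (P : TorusOfSign q ε T) : (2 * Nat.card T : ℂ) = q - ε := by
  exact_mod_cast congrArg (fun z : ℤ => (z : ℂ)) P.card

theorem card_group_complex (P : TorusOfSign q ε T) : (2 * Nat.card S : ℂ) + q = q ^ 3 := by
  exact_mod_cast P.card_group

theorem three_lt (P : TorusOfSign q ε T) : 3 ≤ q := by
  have := P.mod_eight
  omega

theorem card_div (P : TorusOfSign q ε T) :
    (Nat.card S / Nat.card T : ℂ) = q * (q + ε) := by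
  have h1 := P.card_complex
  have h2 := P.card_group_complex
  have h3 := P.sign_sq
  rw [div_eq_iff card_ne_zero_complex]
  have : (2 : ℂ) ≠ 0 := two_ne_zero
  apply mul_left_cancel₀ this
  linear_combination h2 - q * (q + ε) * h1 + q * h3

theorem eq_one_of_pow_three (P : TorusOfSign q ε T) {t : S} (ht : t ∈ T) (h : t ^ 3 = 1) :
    t = 1 := by
  have h1 : orderOf t ∣ 3 := orderOf_dvd_of_pow_eq_one h
  have h2 : orderOf t ∣ Nat.card T := Subgroup.orderOf_dvd_natCard T ht
  rcases (Nat.dvd_prime Nat.prime_three).1 h1 with h3 | h3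
  · exact orderOf_eq_one_iff.1 h3
  · rw [h3] at h2
    have := P.card
    have := P.three_dvd
    rcases P.sign with rfl | rfl <;> omega

theorem unipotentChar_eq_zero (P : TorusOfSign q ε T) {t : S} (ht : t ∈ T) (h1 : t ≠ 1) :
    unipotentChar S q t = 0 :=
  unipotentChar_of_pow_ne fun h => h1 (P.eq_one_of_pow_three ht h)

theorem torusChar_one (P : TorusOfSign q ε T) {f : T → ℂ} (hf : f 1 = 1) :
    torusChar q ε f 1 = q + ε := by
  rw [torusChar, Pi.smul_apply, Pi.sub_apply, IsTorus.indCF_one, hf, P.card_div,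
    unipotentChar_one, smul_eq_mul]
  linear_combination (q : ℂ) * P.sign_sq

theorem cf_eq_apply_one {H : Type*} [Group H] [Finite H] {f g : H → ℂ}
    (h : ∀ x, x ≠ 1 → f x * g x⁻¹ = 0) : cf f g = f 1 * g 1 / Nat.card H := by
  have := Fintype.ofFinite H
  rw [cf_apply, Finset.sum_eq_single 1 (fun x _ hx => h x hx) (by simp), inv_one]
  ring

/-- On the torus the unipotent function is supported at 1, since the order of `T` is prime to 3. The
product is therefore (q² - 1)/|T|. -/
theorem cf_indCF_unipotentChar (P : TorusOfSign q ε T) {f : T → ℂ} (hf : f 1 = 1) :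
    cf (indCF T.subtype f) (unipotentChar S q) = 2 * (q + ε) := by
  rw [cf_indCF _ (isClassFunction_unipotentChar q), cf_eq_apply_one]
  · rw [hf, Function.comp_apply, map_one, unipotentChar_one, one_mul,
      div_eq_iff card_ne_zero_complex]
    linear_combination -(q + ε) * P.card_complex + P.sign_sq
  · intro x hx
    rw [Function.comp_apply, Subgroup.subtype_apply, P.unipotentChar_eq_zero (x⁻¹).2, mul_zero]
    simpa using hx

/-- The excess at the identity in the product of the two induced characters is 2(q + 2ε). It is
cancelled by the cross terms -4(q + ε) and by the norm 2q of the unipotent function. -/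
theorem cf_torusChar_eq (P : TorusOfSign q ε T) (θ θ' : T →* ℂ) :
    cf (torusChar q ε θ) (torusChar q ε θ') = cf θ θ' + cf θ fun t => θ' t⁻¹ := by
  classical
  have hres : (indCF T.subtype θ' ∘ T.subtype : T → ℂ) = (θ' : T → ℂ) + (fun t => θ' t⁻¹) +
      ((q * (q + ε) - 2 : ℂ) • fun t => if t = 1 then 1 else 0) := by
    funext t
    by_cases ht : t = 1
    · subst ht
      simp only [Function.comp_apply, map_one, IsTorus.indCF_one, P.card_div, Pi.add_apply,
        Pi.smul_apply, inv_one, if_true, smul_eq_mul]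
      ring
    · simp only [Function.comp_apply, Subgroup.subtype_apply, P.torus.indCF_of_mem _ ht,
        Pi.add_apply, Pi.smul_apply, if_neg ht, smul_zero, add_zero]
  have hone : cf (θ : T → ℂ) (fun t => if t = 1 then 1 else 0) = 1 / Nat.card T := by
    rw [cf_eq_apply_one]
    · simp
    · intro x hx
      simp [hx]
  have h1 : cf (indCF T.subtype θ) (indCF T.subtype θ') =
      cf θ θ' + cf θ (fun t => θ' t⁻¹) + (q * (q + ε) - 2) / Nat.card T := by
    rw [cf_indCF _ (isClassFunction_indCF _ _), hres, map_add, map_add, map_smul, hone, smul_eq_mul]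
    ring
  have h2 := P.cf_indCF_unipotentChar (f := θ) (map_one θ)
  have h3 := P.cf_indCF_unipotentChar (f := θ') (map_one θ')
  rw [torusChar, torusChar, map_smul, map_smul, LinearMap.smul_apply, map_sub, map_sub,
    LinearMap.sub_apply, LinearMap.sub_apply, h1, h2, cf_comm _ (indCF T.subtype θ'), h3,
    P.cf_unipotentChar_self, smul_eq_mul, smul_eq_mul]
  have h4 : ((q * (q + ε) - 2) / Nat.card T : ℂ) = 2 * (q + 2 * ε) := by
    rw [div_eq_iff card_ne_zero_complex]
    linear_combination -(q + 2 * ε) * P.card_complex + 2 * P.sign_sq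
  rw [h4]
  linear_combination (cf θ θ' + cf θ (fun t => θ' t⁻¹)) * P.sign_sq

theorem cf_torusChar_int (P : TorusOfSign q ε T) (θ : T →* ℂ) {χ : S → ℂ}
    (hχ : IsIrreducibleCharacter χ) : ∃ n : ℤ, cf (torusChar q ε θ) χ = n := by
  obtain ⟨a, ha⟩ := (isCharacter_monoidHom θ).cf_indCF_nat (ι := T.subtype) hχ.isCharacter
  obtain ⟨b, hb⟩ := P.cf_unipotentChar_int χ hχ
  refine ⟨ε * (a - b), ?_⟩
  rw [torusChar, map_smul, LinearMap.smul_apply, map_sub, LinearMap.sub_apply, ha, hb]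
  push_cast
  rfl

theorem cf_monoidHom {H : Type*} [Group H] [Finite H] (θ θ' : H →* ℂ) (h : θ ≠ θ') :
    cf θ θ' = 0 :=
  (isIrreducibleCharacter_monoidHom θ).cf_ne (isIrreducibleCharacter_monoidHom θ')
    fun h' => h (DFunLike.coe_injective h')

theorem cf_monoidHom_inv {H : Type*} [Group H] [Finite H] (θ θ' : H →* ℂ)
    (h : (fun t => θ' t⁻¹) ≠ θ) : cf θ (fun t => θ' t⁻¹) = 0 :=
  (isIrreducibleCharacter_monoidHom θ).cf_ne (isIrreducibleCharacter_monoidHom θ').inv h.symm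

theorem cf_torusChar_self (P : TorusOfSign q ε T) {θ : T →* ℂ} (hθ : (fun t => θ t⁻¹) ≠ θ) :
    cf (torusChar q ε θ) (torusChar q ε θ) = 1 := by
  rw [P.cf_torusChar_eq, cf_monoidHom_inv θ θ hθ,
    (isIrreducibleCharacter_monoidHom θ).cf_self, add_zero]

theorem isIrreducibleCharacter (P : TorusOfSign q ε T) {θ : T →* ℂ} (hθ : (fun t => θ t⁻¹) ≠ θ) :
    IsIrreducibleCharacter (torusChar q ε θ) := by
  have h3 := P.three_lt
  refine (isClassFunction q ε θ).isIrreducibleCharacter (r := ((q : ℤ) + ε).toNat)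
    (fun χ hχ => P.cf_torusChar_int θ hχ) (P.cf_torusChar_self hθ) ?_ ?_
  · rcases P.sign with rfl | rfl <;> omega
  · rw [P.torusChar_one (map_one θ)]
    have : ((((q : ℤ) + ε).toNat : ℤ) : ℂ) = (((q : ℤ) + ε : ℤ) : ℂ) := by
      congr 1
      rcases P.sign with rfl | rfl <;> omega
    push_cast at this
    exact_mod_cast this.symm

theorem hasEvenDegree (P : TorusOfSign q ε T) (θ : T →* ℂ) :
    HasEvenDegree (torusChar q ε θ) := by
  have h3 := P.mod_eight
  refine ⟨((q : ℤ) + ε).toNat, ?_, ?_⟩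
  · rw [Nat.even_iff]
    rcases P.sign with rfl | rfl <;> omega
  · rw [P.torusChar_one (map_one θ)]
    have : ((((q : ℤ) + ε).toNat : ℤ) : ℂ) = (((q : ℤ) + ε : ℤ) : ℂ) := by
      congr 1
      rcases P.sign with rfl | rfl <;> omega
    push_cast at this
    exact_mod_cast this.symm

theorem torusChar_inv (P : TorusOfSign q ε T) (f : T → ℂ) (g : S) :
    torusChar q ε f g⁻¹ = torusChar q ε f g := by
  rw [torusChar, Pi.smul_apply, Pi.sub_apply, Pi.smul_apply, Pi.sub_apply, indCF_inv,
    unipotentChar_inv, P.torus.indCF_congr (f' := f)]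
  intro t
  rw [inv_inv, add_comm]

theorem ringEquiv_torusChar (q : ℕ) (ε : ℤ) (σ : ℂ ≃+* ℂ) (f : T → ℂ) :
    ⇑σ ∘ torusChar q ε f = torusChar q ε (σ ∘ f) := by
  funext g
  have h := congrFun (ringEquiv_comp_indCF (ι := T.subtype) σ f) g
  simp only [Function.comp_apply] at h
  simp only [torusChar, Function.comp_apply, Pi.smul_apply, Pi.sub_apply, smul_eq_mul, map_mul,
    map_sub, map_intCast, h]
  congr 2
  unfold unipotentChar
  split_ifs <;> simp

theorem torusChar_eq_torusChar (P : TorusOfSign q ε T) {θ θ' : T →* ℂ}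
    (hθ : (fun t => θ t⁻¹) ≠ θ) (h : torusChar q ε θ = torusChar q ε θ') :
    θ = θ' ∨ (fun t => θ' t⁻¹) = θ := by
  by_contra! hne
  have h1 := P.cf_torusChar_self hθ
  nth_rewrite 2 [h] at h1
  rw [P.cf_torusChar_eq, cf_monoidHom_inv θ θ' hne.2, cf_monoidHom θ θ' hne.1, add_zero] at h1
  exact zero_ne_one h1

/-- The action of an automorphism that maps the torus to a conjugate. -/
theorem torusChar_mulEquiv (q : ℕ) (ε : ℤ) (f : T → ℂ) {φ : MulAut S} {β : MulAut T} {c : S}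
    (h : ∀ t : T, c * φ t * c⁻¹ = β t) : torusChar q ε f ∘ φ = torusChar q ε (f ∘ β) := by
  funext g
  have h1 := isClassFunction q ε f c (φ g)
  rw [Function.comp_apply, ← h1]
  have h2 := indCF_mulEquiv (ι := T.subtype) (α := MulAut.conj c * φ) (β := β)
    (fun t => (h t).symm) f g
  have h3 := unipotentChar_mulEquiv q (MulAut.conj c * φ) g
  simp only [MulAut.mul_apply, MulAut.conj_apply] at h2 h3
  simp only [torusChar, Pi.smul_apply, Pi.sub_apply, h2, h3]

end TorusOfSign

end TorusCharacters

/-! ### Real irreducible characters of even degree. -/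

section RealCharacters

variable {S : Type*} [Group S] [Finite S]

namespace TorusOfSign

variable {q : ℕ} {ε : ℤ} {T : Subgroup S}

theorem torusChar_of_mem (P : TorusOfSign q ε T) (f : T → ℂ) {t : T} (ht : t ≠ 1) :
    torusChar q ε f t = ε * (f t + f t⁻¹) := by
  rw [torusChar, Pi.smul_apply, Pi.sub_apply, P.torus.indCF_of_mem f ht,
    P.unipotentChar_eq_zero t.2 (fun h => ht (Subtype.ext h)), sub_zero, smul_eq_mul]

theorem torusChar_of_forall_notMem (f : T → ℂ) {g : S} (hg : ∀ x, x * g * x⁻¹ ∉ T) :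
    torusChar q ε f g = -ε * unipotentChar S q g := by
  rw [torusChar, Pi.smul_apply, Pi.sub_apply, IsTorus.indCF_of_forall_notMem f hg, smul_eq_mul]
  ring

/-- A class function orthogonal to the characters attached to a torus restricts to a multiple of
the regular character. -/
theorem apply_eq_of_cf_eq_zero (P : TorusOfSign q ε T) {f : S → ℂ} (hf : IsClassFunction f)
    (h : ∀ θ : T →* ℂ, cf (torusChar q ε θ) f = 0) :
    (∀ t ∈ T, t ≠ 1 → f t = 0) ∧ f 1 = cf (unipotentChar S q) f * Nat.card T := by
  classical
  set c := cf (unipotentChar S q) f with hc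
  have hε : (ε : ℂ) ≠ 0 := by
    intro h0
    have := P.sign_sq
    simp [h0] at this
  set r : T → ℂ := fun t => if t = 1 then c * Nat.card T else 0 with hr
  -- By Frobenius reciprocity every linear character of `T` has the same product `c` with the
  -- restriction of `f`, as it has with `c` times the regular character.
  have key : f ∘ T.subtype - r = 0 := by
    refine IsClassFunction.eq_zero (fun x g => ?_) fun χ hχ => ?_
    · rw [P.torus.mul_comm x, mul_inv_cancel_right]
    · obtain ⟨θ, rfl⟩ := hχ.exists_monoidHom P.torus.mul_comm
      have h1 := h θ
      rw [torusChar, map_smul, LinearMap.smul_apply, map_sub, LinearMap.sub_apply,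
        cf_indCF _ hf, smul_eq_mul] at h1
      have h2 := (mul_eq_zero.1 h1).resolve_left hε
      have h3 : cf (θ : T → ℂ) r = c := by
        rw [cf_eq_apply_one]
        · simp only [hr, if_true, map_one, one_mul]
          rw [mul_div_cancel_right₀ _ card_ne_zero_complex]
        · intro x hx
          simp [hr, hx]
      rw [cf_comm, map_sub, h3, sub_eq_zero.1 h2, sub_self]
  refine ⟨fun t ht h1 => ?_, ?_⟩
  · have := congrFun key ⟨t, ht⟩
    have hne : (⟨t, ht⟩ : T) ≠ 1 := fun h => h1 (Subtype.ext_iff.1 h)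
    simpa [hr, hne] using this
  · have := congrFun key 1
    simpa [hr, sub_eq_zero] using this

end TorusOfSign

namespace TorusDecomposition

variable {q : ℕ} {T₁ T₂ : Subgroup S}

/-- The orders of the tori are consecutive integers, hence coprime. -/
theorem eq_one_of_conj (D : TorusDecomposition q T₁ T₂) {t x : S} (ht : t ∈ T₁)
    (hx : x * t * x⁻¹ ∈ T₂) : t = 1 := by
  rw [← orderOf_eq_one_iff]
  have h1 : orderOf t ∣ Nat.card T₁ := Subgroup.orderOf_dvd_natCard T₁ ht
  have h2 : orderOf t ∣ Nat.card T₂ := by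
    have := Subgroup.orderOf_dvd_natCard T₂ hx
    rwa [show x * t * x⁻¹ = MulAut.conj x t from rfl, MulEquiv.orderOf_eq] at this
  have h3 : Nat.card T₂ = Nat.card T₁ + 1 := by
    have := D.card₁
    have := D.card₂
    omega
  rw [h3] at h2
  exact Nat.dvd_one.1 ((Nat.dvd_add_right h1).1 h2)

/-- For trivial θ the two attached functions are St + 1 and St - 1, where St is the Steinberg
character. The values are compared on each type of element. -/
theorem torusChar_trivial (D : TorusDecomposition q T₁ T₂) :
    torusChar q 1 ((1 : T₁ →* ℂ) : T₁ → ℂ) = torusChar q (-1) ((1 : T₂ →* ℂ) : T₂ → ℂ) + 2 := by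
  have P := D.torusOfSign₁
  have P' := D.torusOfSign₂
  funext g
  simp only [Pi.add_apply, Pi.ofNat_apply]
  by_cases h1 : g = 1
  · subst h1
    rw [P.torusChar_one (map_one _), P'.torusChar_one (map_one _)]
    push_cast
    ring
  by_cases h3 : g ^ 3 = 1
  · have hn : ∀ {ε : ℤ} {T : Subgroup S}, TorusOfSign q ε T → ∀ x, x * g * x⁻¹ ∉ T := by
      intro ε T P x hx
      have := P.eq_one_of_pow_three hx (by rw [conj_pow, h3]; simp)
      rw [mul_inv_eq_one, mul_eq_left] at this
      exact h1 this
    rw [TorusOfSign.torusChar_of_forall_notMem _ (hn P),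
      TorusOfSign.torusChar_of_forall_notMem _ (hn P'), unipotentChar_of_pow_eq h1 h3]
    push_cast
    ring
  have hc : ∀ x, x * g * x⁻¹ ≠ 1 := fun x h => h1 (by rwa [mul_inv_eq_one, mul_eq_left] at h)
  rcases D.cover g with h | ⟨x, hx⟩ | ⟨x, hx⟩
  · exact absurd h h3
  · rw [← TorusOfSign.isClassFunction q 1 _ x g,
      P.torusChar_of_mem _ (t := ⟨_, hx⟩) fun h => hc x (Subtype.ext_iff.1 h),
      TorusOfSign.torusChar_of_forall_notMem, unipotentChar_of_pow_ne h3]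
    · simp
      norm_num
    · intro y hy
      refine hc x (D.eq_one_of_conj hx (x := y * x⁻¹) ?_)
      convert hy using 1
      group
  · rw [← TorusOfSign.isClassFunction q (-1) _ x g,
      P'.torusChar_of_mem _ (t := ⟨_, hx⟩) fun h => hc x (Subtype.ext_iff.1 h),
      TorusOfSign.torusChar_of_forall_notMem, unipotentChar_of_pow_ne h3]
    · simp
      norm_num
    · intro y hy
      refine h1 ?_
      have := D.eq_one_of_conj hy (x := x * y⁻¹) (by convert hx using 1; group)
      rwa [mul_inv_eq_one, mul_eq_left] at this

/-- Conjugates of the two tori meet trivially, so the product of the induced characters comes from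
the identity alone and is 2q. It cancels against -2(q+1) - 2(q-1) + 2q. -/
theorem cf_torusChar_torusChar (D : TorusDecomposition q T₁ T₂) (θ : T₁ →* ℂ) (θ' : T₂ →* ℂ) :
    cf (torusChar q 1 θ) (torusChar q (-1) θ') = 0 := by
  have P := D.torusOfSign₁
  have P' := D.torusOfSign₂
  have h1 : cf (indCF T₁.subtype θ) (indCF T₂.subtype θ') = 2 * q := by
    rw [cf_indCF _ (isClassFunction_indCF _ _), TorusOfSign.cf_eq_apply_one]
    · rw [Function.comp_apply, map_one, map_one, IsTorus.indCF_one, P'.card_div, map_one,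
        div_eq_iff card_ne_zero_complex]
      have := P.card_complex
      push_cast at this ⊢
      linear_combination -q * this
    · intro t ht
      rw [Function.comp_apply, IsTorus.indCF_of_forall_notMem, mul_zero]
      intro y hy
      exact inv_ne_one.2 ht (Subtype.ext (D.eq_one_of_conj (t⁻¹).2 hy))
  have h2 := P.cf_indCF_unipotentChar (f := θ) (map_one θ)
  have h3 := P'.cf_indCF_unipotentChar (f := θ') (map_one θ')
  rw [torusChar, torusChar, map_smul, map_smul, LinearMap.smul_apply, map_sub, map_sub,
    LinearMap.sub_apply, LinearMap.sub_apply, h1, h2, cf_comm _ (indCF T₂.subtype θ'), h3,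
    D.cf_unipotentChar_self, smul_eq_mul, smul_eq_mul]
  push_cast
  ring

theorem cf_one_torusChar₁ (D : TorusDecomposition q T₁ T₂) (θ : T₁ →* ℂ) :
    2 * cf (torusChar q 1 θ) 1 = cf (torusChar q 1 θ) (torusChar q 1 (1 : T₁ →* ℂ)) := by
  rw [D.torusChar_trivial, map_add, D.cf_torusChar_torusChar, zero_add,
    show (2 : S → ℂ) = (2 : ℂ) • (1 : S → ℂ) by ext; simp, map_smul, smul_eq_mul]

theorem cf_one_torusChar₂ (D : TorusDecomposition q T₁ T₂) (θ : T₂ →* ℂ) :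
    2 * cf (torusChar q (-1) θ) 1 = -cf (torusChar q (-1) θ) (torusChar q (-1) (1 : T₂ →* ℂ)) := by
  have h : torusChar q (-1) ((1 : T₂ →* ℂ) : T₂ → ℂ) =
      torusChar q 1 ((1 : T₁ →* ℂ) : T₁ → ℂ) - (2 : ℂ) • (1 : S → ℂ) := by
    rw [D.torusChar_trivial]
    ext
    simp
  rw [h, map_sub, cf_comm _ (torusChar q 1 _), D.cf_torusChar_torusChar, zero_sub, neg_neg,
    map_smul, smul_eq_mul]

/-- The Steinberg character. -/
theorem isIrreducibleCharacter_steinberg (D : TorusDecomposition q T₁ T₂) :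
    IsIrreducibleCharacter (torusChar q 1 (1 : T₁ →* ℂ) - 1) ∧
      (torusChar q 1 (1 : T₁ →* ℂ) - 1 : S → ℂ) 1 = q := by
  have P := D.torusOfSign₁
  have hq : (torusChar q 1 (1 : T₁ →* ℂ) - 1 : S → ℂ) 1 = q := by
    rw [Pi.sub_apply, P.torusChar_one (map_one _)]
    simp
  have hone : IsIrreducibleCharacter (1 : S → ℂ) := isIrreducibleCharacter_one
  have h2 : cf (torusChar q 1 (1 : T₁ →* ℂ)) (torusChar q 1 (1 : T₁ →* ℂ)) = 2 := by
    rw [P.cf_torusChar_eq]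
    have h1 := (isIrreducibleCharacter_monoidHom (1 : T₁ →* ℂ)).cf_self
    have h : (fun t : T₁ => (1 : T₁ →* ℂ) t⁻¹) = (1 : T₁ →* ℂ) := by
      ext
      simp
    rw [h, h1]
    norm_num
  have h1 : cf (torusChar q 1 (1 : T₁ →* ℂ)) (1 : S → ℂ) = 1 := by
    have := D.cf_one_torusChar₁ 1
    rw [h2] at this
    linear_combination this / 2
  refine ⟨((TorusOfSign.isClassFunction q 1 _).sub hone.isClassFunction).isIrreducibleCharacter
    (r := q) (fun χ hχ => ?_) ?_ ?_ hq, hq⟩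
  · obtain ⟨n, hn⟩ := P.cf_torusChar_int 1 hχ
    obtain ⟨m, hm⟩ := hone.isCharacter.cf_nat hχ.isCharacter
    refine ⟨n - m, ?_⟩
    rw [map_sub, LinearMap.sub_apply, hn, hm]
    push_cast
    rfl
  · rw [map_sub, map_sub, LinearMap.sub_apply, LinearMap.sub_apply, h2, h1,
      cf_comm _ (torusChar q 1 _), h1, hone.cf_self]
    norm_num
  · have := P.three_lt
    omega

/-- The trivial character and the characters attached to tori separate real class functions. -/
theorem eq_zero_of_cf_eq_zero (D : TorusDecomposition q T₁ T₂) {f : S → ℂ}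
    (hf : IsClassFunction f) (hreal : ∀ g, f g⁻¹ = f g) (h1 : cf f 1 = 0)
    (hf₁ : ∀ θ : T₁ →* ℂ, cf (torusChar q 1 θ) f = 0)
    (hf₂ : ∀ θ : T₂ →* ℂ, cf (torusChar q (-1) θ) f = 0) : f = 0 := by
  classical
  have := Fintype.ofFinite S
  obtain ⟨a1, b1⟩ := D.torusOfSign₁.apply_eq_of_cf_eq_zero hf hf₁
  obtain ⟨a2, b2⟩ := D.torusOfSign₂.apply_eq_of_cf_eq_zero hf hf₂
  -- The value `f 1` is the same constant times the order of either torus, and these orders differ.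
  have hf1 : f 1 = 0 := by
    have c1 := D.torusOfSign₁.card_complex
    have c2 := D.torusOfSign₂.card_complex
    push_cast at c1 c2
    have : cf (unipotentChar S q) f = 0 := by
      linear_combination b1 - b2 + cf (unipotentChar S q) f * (c1 - c2) / 2
    rw [b1, this, zero_mul]
  have hss : ∀ g : S, g ^ 3 ≠ 1 → f g = 0 := by
    intro g hg
    have hg1 : ∀ x, x * g * x⁻¹ ≠ 1 := by
      intro x h
      rw [mul_inv_eq_one, mul_eq_left] at h
      exact hg (by rw [h, one_pow])
    rcases D.cover g with h | ⟨x, hx⟩ | ⟨x, hx⟩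
    · exact absurd h hg
    · rw [← hf x g, a1 _ hx (hg1 x)]
    · rw [← hf x g, a2 _ hx (hg1 x)]
  obtain ⟨u, hu, hu1⟩ := D.exists_unipotent
  -- Reality identifies the values on the two classes of order 3. Orthogonality to the trivial
  -- character then forces the common value to be zero.
  have huni : ∀ g : S, g ^ 3 = 1 → g ≠ 1 → f g = f u := by
    intro g hg hg1
    rcases D.isConj_or g u hg hg1 hu hu1 with h | h
    · obtain ⟨x, hx⟩ := isConj_iff.1 h
      rw [← hx, hf]
    · obtain ⟨x, hx⟩ := isConj_iff.1 h
      rw [← hreal u, ← hx, hf]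
  have hfu : f u = 0 := by
    rw [cf_apply, mul_eq_zero] at h1
    have h2 := h1.resolve_left (inv_ne_zero card_ne_zero_complex)
    have h3 : ∀ g : S, f g * (1 : S → ℂ) g⁻¹ = if g ^ 3 = 1 ∧ g ≠ 1 then f u else 0 := by
      intro g
      rw [Pi.one_apply, mul_one]
      split_ifs with h
      · exact huni g h.1 h.2
      · by_cases hg : g ^ 3 = 1
        · have hg1 : g = 1 := by
            by_contra hg1
            exact h ⟨hg, hg1⟩
          rw [hg1, hf1]
        · exact hss g hg
    rw [Finset.sum_congr rfl fun g _ => h3 g, ← Finset.sum_filter, Finset.sum_const,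
      nsmul_eq_mul, mul_eq_zero] at h2
    refine h2.resolve_left ?_
    rw [Nat.cast_eq_zero]
    exact Finset.card_ne_zero_of_mem (Finset.mem_filter.2 ⟨Finset.mem_univ u, hu, hu1⟩)
  funext g
  by_cases hg : g ^ 3 = 1
  · by_cases hg1 : g = 1
    · rw [hg1, hf1, Pi.zero_apply]
    · rw [huni g hg hg1, hfu, Pi.zero_apply]
  · exact hss g hg

/-- A nontrivial real linear character of a cyclic group takes the value -1 at a generator. -/
theorem eq_of_quadratic {T : Subgroup S} (hT : IsTorus T) {θ θ' : T →* ℂ} (h : θ ≠ 1) (h' : θ' ≠ 1)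
    (hi : (fun t => θ t⁻¹) = θ) (hi' : (fun t => θ' t⁻¹) = θ') : θ = θ' := by
  obtain ⟨t, ht⟩ := hT.isCyclic.exists_generator
  have hext : ∀ {α β : T →* ℂ}, α t = β t → α = β := by
    intro α β hab
    ext s
    obtain ⟨n, rfl⟩ := (mem_powers_iff_mem_zpowers (x := t)).2 (ht s)
    simp [hab]
  have hneg : ∀ {α : T →* ℂ}, α ≠ 1 → ((fun t => α t⁻¹) = α) → α t = -1 := by
    intro α h hi
    have h1 : α t * α t = 1 := by
      nth_rewrite 1 [← congrFun hi t]
      rw [← map_mul, inv_mul_cancel, map_one]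
    exact (mul_self_eq_one_iff.1 h1).resolve_left fun h1 => h (hext (by rw [h1, MonoidHom.one_apply]))
  exact hext (by rw [hneg h hi, hneg h' hi'])

theorem eq_one_of_inv_eq (D : TorusDecomposition q T₁ T₂) {θ : T₁ →* ℂ}
    (hi : (fun t => θ t⁻¹) = θ) : θ = 1 := by
  ext t
  have h1 : θ t ^ 2 = 1 := by
    rw [sq]
    nth_rewrite 1 [← congrFun hi t]
    rw [← map_mul, inv_mul_cancel, map_one]
  have h2 : θ t ^ Nat.card T₁ = 1 := by rw [← map_pow, pow_card_eq_one', map_one]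
  have h3 : Odd (Nat.card T₁) := by
    rw [Nat.odd_iff]
    have := D.card₁
    have := D.mod_eight
    omega
  obtain ⟨k, hk⟩ := h3
  rw [hk, pow_succ, pow_mul, h1, one_pow, one_mul] at h2
  rw [h2, MonoidHom.one_apply]

/-- Real irreducible characters of even degree are attached to a torus. -/
theorem exists_eq_torusChar (D : TorusDecomposition q T₁ T₂) {χ : S → ℂ}
    (hχ : IsIrreducibleCharacter χ) (hreal : ∀ g, χ g⁻¹ = χ g) (heven : HasEvenDegree χ) :
    (∃ θ : T₁ →* ℂ, (fun t => θ t⁻¹) ≠ θ ∧ χ = torusChar q 1 θ) ∨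
      ∃ θ : T₂ →* ℂ, (fun t => θ t⁻¹) ≠ θ ∧ χ = torusChar q (-1) θ := by
  by_contra! hcon
  obtain ⟨hn1, hn2⟩ := hcon
  have P := D.torusOfSign₁
  have P' := D.torusOfSign₂
  have hone : IsIrreducibleCharacter (1 : S → ℂ) := isIrreducibleCharacter_one
  obtain ⟨hSt, hSt1⟩ := D.isIrreducibleCharacter_steinberg
  obtain ⟨d, hd, hd1⟩ := heven
  -- The trivial and the Steinberg character have the odd degrees 1 and q, so χ is orthogonal to
  -- both.
  have hc1 : cf χ 1 = 0 := hχ.cf_ne hone (by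
    rintro rfl
    rw [Pi.one_apply] at hd1
    have : 1 = d := by exact_mod_cast hd1
    rw [← this] at hd
    exact absurd hd (by decide))
  have hcSt : cf χ (torusChar q 1 (1 : T₁ →* ℂ)) = 0 := by
    have : cf χ (torusChar q 1 (1 : T₁ →* ℂ) - 1) = 0 := hχ.cf_ne hSt (by
      rintro rfl
      rw [hSt1] at hd1
      have : q = d := by exact_mod_cast hd1
      rw [← this, Nat.even_iff] at hd
      have := D.mod_eight
      omega)
    rw [map_sub, hc1, sub_zero] at this
    exact this
  have hf₁ : ∀ θ : T₁ →* ℂ, cf (torusChar q 1 θ) χ = 0 := by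
    intro θ
    by_cases hθ : (fun t => θ t⁻¹) = θ
    · rw [D.eq_one_of_inv_eq hθ, cf_comm, hcSt]
    · exact (P.isIrreducibleCharacter hθ).cf_ne hχ (hn1 θ hθ).symm
  have hf₂ : cf (torusChar q (-1) (1 : T₂ →* ℂ)) χ = 0 := by
    have := hf₁ 1
    rwa [D.torusChar_trivial, map_add, LinearMap.add_apply,
      show (2 : S → ℂ) = (2 : ℂ) • (1 : S → ℂ) by ext; simp, map_smul, LinearMap.smul_apply,
      cf_comm 1, hc1, smul_zero, add_zero] at this
  -- The quadratic character of T₂ is the one remaining case. Its attached character X has norm 2,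
  -- and χ - (n/2)X is orthogonal to all test characters, hence zero. Comparing norms gives the
  -- impossible n² = 2.
  by_cases hsgn : ∃ θ : T₂ →* ℂ, θ ≠ 1 ∧ (fun t => θ t⁻¹) = θ
  · obtain ⟨θ₀, h0, h0i⟩ := hsgn
    obtain ⟨n, hn⟩ := P'.cf_torusChar_int θ₀ hχ
    have hself : cf (torusChar q (-1) θ₀) (torusChar q (-1) θ₀) = 2 := by
      rw [P'.cf_torusChar_eq, h0i, (isIrreducibleCharacter_monoidHom θ₀).cf_self]
      norm_num
    have hother : ∀ θ : T₂ →* ℂ, θ ≠ θ₀ → cf (torusChar q (-1) θ) (torusChar q (-1) θ₀) = 0 := by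
      intro θ hθ
      rw [P'.cf_torusChar_eq, h0i, TorusOfSign.cf_monoidHom θ θ₀ hθ, add_zero]
    have hX1 : cf (torusChar q (-1) θ₀) 1 = 0 := by
      have h2 := D.cf_one_torusChar₂ θ₀
      rw [cf_comm _ (torusChar q (-1) (1 : T₂ →* ℂ)), hother 1 h0.symm] at h2
      linear_combination h2 / 2
    have hzero := D.eq_zero_of_cf_eq_zero (f := χ - (n / 2 : ℂ) • torusChar q (-1) θ₀)
      (hχ.isClassFunction.sub ((TorusOfSign.isClassFunction _ _ _).smul _))
      (fun g => by
        simp only [Pi.sub_apply, Pi.smul_apply, hreal, P'.torusChar_inv])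
      (by rw [map_sub, map_smul, LinearMap.sub_apply, LinearMap.smul_apply, hX1, hc1]; simp)
      (fun θ => by rw [map_sub, map_smul, hf₁, D.cf_torusChar_torusChar]; simp)
      (fun θ => by
        rw [map_sub, map_smul]
        by_cases h : θ = θ₀
        · rw [h, hn, hself, smul_eq_mul]
          ring
        · rw [hother θ h, smul_zero, sub_zero]
          by_cases hθ : (fun t => θ t⁻¹) = θ
          · by_cases h1 : θ = 1
            · rw [h1, hf₂]
            · exact absurd (eq_of_quadratic D.torus₂ h1 h0 hθ h0i) h
          · exact (P'.isIrreducibleCharacter hθ).cf_ne hχ (hn2 θ hθ).symm)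
    rw [sub_eq_zero] at hzero
    have hnorm := hχ.cf_self
    rw [hzero, map_smul, map_smul, LinearMap.smul_apply, hself, smul_eq_mul, smul_eq_mul] at hnorm
    have h2 : ((n ^ 2 : ℤ) : ℂ) = (2 : ℤ) := by
      push_cast
      linear_combination 2 * hnorm
    have h3 : n ^ 2 = 2 := by exact_mod_cast h2
    have h4 : n < 2 := by nlinarith
    have h5 : -2 < n := by nlinarith
    interval_cases n <;> omega
  · push Not at hsgn
    have hzero := D.eq_zero_of_cf_eq_zero hχ.isClassFunction hreal hc1 hf₁ fun θ => by
      by_cases hθ : (fun t => θ t⁻¹) = θ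
      · by_cases h1 : θ = 1
        · rw [h1, hf₂]
        · exact absurd hθ (hsgn θ h1)
      · exact (P'.isIrreducibleCharacter hθ).cf_ne hχ (hn2 θ hθ).symm
    have := hχ.cf_self
    rw [hzero, map_zero] at this
    exact zero_ne_one this

end TorusDecomposition

end RealCharacters

/-! ### Galois action on torus characters against fusion of torus elements. -/

section TorusGalois

variable {S : Type*} [Group S]

theorem exists_coprime_modEq {m n : ℕ} (hn : n ≠ 0) (h : m ∣ n) {k : ℕ} (hk : k.Coprime m) :
    ∃ l : ℕ, l.Coprime n ∧ l ≡ k [MOD m] := by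
  have : NeZero n := ⟨hn⟩
  obtain ⟨u, hu⟩ := ZMod.unitsMap_surjective h (ZMod.unitOfCoprime k hk)
  refine ⟨(u : ZMod n).val, ZMod.val_coe_unit_coprime u, ?_⟩
  have h1 := congrArg (fun v : (ZMod m)ˣ => (v : ZMod m)) hu
  simp only [ZMod.unitsMap_val, ZMod.coe_unitOfCoprime] at h1
  rw [← ZMod.natCast_eq_natCast_iff, ← h1, ZMod.natCast_val]

/-- An element centralizing `t` lies in `T` or in `T w`. In the latter case it would also invert
`t`. -/
theorem IsTorus.mem_of_commute {T : Subgroup S} (hT : IsTorus T) {t g : S} (ht : t ∈ T)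
    (h2 : t * t ≠ 1) (h : g * t = t * g) : g ∈ T := by
  obtain ⟨w, -, hinv, hfus⟩ := hT.exists_inv
  have hg : g * t * g⁻¹ = t := by rw [h, mul_inv_cancel_right]
  have h1 : t ≠ 1 := by
    rintro rfl
    exact h2 (one_mul 1)
  refine (hfus t ht h1 g (by rwa [hg])).resolve_right fun hw => h2 ?_
  have e1 := hinv t ht
  have e2 := congrArg (fun z : T => (z : S)) (hT.mul_comm ⟨g * w⁻¹, hw⟩ ⟨t, ht⟩⁻¹)
  simp only [Subgroup.coe_mul, Subgroup.coe_inv] at e2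
  have e3 : g * t * g⁻¹ = t⁻¹ := by
    calc g * t * g⁻¹ = g * w⁻¹ * (w * t * w⁻¹) * (g * w⁻¹)⁻¹ := by group
      _ = t⁻¹ := by rw [e1, e2, mul_inv_cancel_right]
  rw [hg] at e3
  nth_rewrite 1 [e3]
  rw [inv_mul_cancel]

theorem exists_mulAut_of_conj_mem [Finite S] {T : Subgroup S} {φ : MulAut S} {c : S}
    (h : ∀ t ∈ T, c * φ t * c⁻¹ ∈ T) : ∃ β : MulAut T, ∀ t : T, c * φ t * c⁻¹ = β t := by
  let b : T →* T := ((MulAut.conj c * φ).toMonoidHom.comp T.subtype).codRestrict T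
    fun t => h t t.2
  have hb : Function.Injective b := by
    intro s t hst
    exact Subtype.ext ((MulAut.conj c * φ).injective (Subtype.ext_iff.1 hst))
  exact ⟨MulEquiv.ofBijective b (Finite.injective_iff_bijective.1 hb), fun t => rfl⟩

/-- The image of `t` is conjugate into `T` or `T'`, and centralizers follow it. The second case
would make the two tori isomorphic, against their orders. -/
theorem exists_conj_mem_of_cover [Finite S] {T T' : Subgroup S} {q : ℕ} {ε ε' : ℤ}
    (P : TorusOfSign q ε T)
    (P' : TorusOfSign q ε' T') (hne : ε ≠ ε')
    (hcov : ∀ g : S, g ^ 3 = 1 ∨ (∃ x, x * g * x⁻¹ ∈ T) ∨ ∃ x, x * g * x⁻¹ ∈ T')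
    {t : S} (ht : t ∈ T) (h2 : t * t ≠ 1) (φ : MulAut S) : ∃ c, ∀ s ∈ T, c * φ s * c⁻¹ ∈ T := by
  have key : ∀ {T'' : Subgroup S} (_ : IsTorus T'') (c : S), c * φ t * c⁻¹ ∈ T'' →
      ∀ s ∈ T, c * φ s * c⁻¹ ∈ T'' := by
    intro T'' hT'' c hc s hs
    refine hT''.mem_of_commute hc ?_ ?_
    · intro h
      have : MulAut.conj c (φ (t * t)) = 1 := by
        rw [← h]
        simp
      rw [map_eq_one_iff _ (MulAut.conj c).injective, map_eq_one_iff _ φ.injective] at this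
      exact h2 this
    · have := congrArg (fun z : T => MulAut.conj c (φ z)) (P.torus.mul_comm ⟨s, hs⟩ ⟨t, ht⟩)
      simpa using this
  rcases hcov (φ t) with h | ⟨c, hc⟩ | ⟨c, hc⟩
  · rw [← map_pow, map_eq_one_iff _ φ.injective] at h
    refine absurd (P.eq_one_of_pow_three ht h) fun h1 => h2 ?_
    rw [h1, one_mul]
  · exact ⟨c, key P.torus c hc⟩
  · exfalso
    have h1 := key P'.torus c hc
    have heq : T.map (MulAut.conj c * φ).toMonoidHom = T' := by
      apply le_antisymm
      · rintro _ ⟨s, hs, rfl⟩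
        exact h1 s hs
      · intro s hs
        refine ⟨(MulAut.conj c * φ)⁻¹ s, ?_, MulAut.apply_inv_self S (MulAut.conj c * φ) s⟩
        refine P.torus.mem_of_commute ht h2 ((MulAut.conj c * φ).injective ?_)
        have := congrArg (fun z : T' => (z : S)) (P'.torus.mul_comm ⟨s, hs⟩ ⟨_, h1 t ht⟩)
        rw [map_mul, map_mul, MulAut.apply_inv_self]
        exact this
    have h3 : Nat.card T = Nat.card T' := by
      rw [← heq]
      exact (Subgroup.card_map_of_injective (MulAut.conj c * φ).injective).symm
    have h4 := P.card
    have h5 := P'.card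
    rw [h3] at h4
    exact hne (by linarith)

namespace TorusOfSign

variable [Finite S] {q : ℕ} {ε : ℤ} {T : Subgroup S}

/-- A character attached to a torus that is Galois conjugate only to its conjugates under a group
of automorphisms yields an element of odd prime order all of whose generators are fused. -/
theorem exists_fused_powers (P : TorusOfSign q ε T) {G : Subgroup (MulAut S)} (hG : innerAut S ≤ G)
    {θ : T →* ℂ} (hθ : (fun t => θ t⁻¹) ≠ θ)
    (hT : ∀ t ∈ T, t * t ≠ 1 → ∀ φ : MulAut S, ∃ c, ∀ s ∈ T, c * φ s * c⁻¹ ∈ T)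
    (hgal : ∀ σ : ℂ ≃+* ℂ, ∃ φ ∈ G, σ ∘ torusChar q ε θ = torusChar q ε θ ∘ φ) :
    ∃ x : S, x ≠ 1 ∧ Odd (orderOf x) ∧
      ∀ k : ℕ, k.Coprime (orderOf x) → ∃ φ ∈ G, φ x = x ^ k := by
  obtain ⟨t, ht⟩ := P.torus.isCyclic.exists_generator
  have htp : ∀ s : T, ∃ i : ℕ, t ^ i = s := fun s => (mem_powers_iff_mem_zpowers (x := t)).2 (ht s)
  have hord : orderOf t = Nat.card T := orderOf_eq_card_of_forall_mem_zpowers ht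
  set ζ := θ t with hζ
  set n := orderOf ζ with hn
  have hζN : ζ ^ Nat.card T = 1 := by rw [hζ, ← map_pow, pow_card_eq_one', map_one]
  have hnN : n ∣ Nat.card T := orderOf_dvd_of_pow_eq_one hζN
  have hn0 : n ≠ 0 := fun h => Nat.card_pos.ne' (Nat.eq_zero_of_zero_dvd (h ▸ hnN))
  have hprim : IsPrimitiveRoot ζ n := IsPrimitiveRoot.orderOf ζ
  have hn2 : ¬n ∣ 2 := by
    intro h
    apply hθ
    funext s
    obtain ⟨i, rfl⟩ := htp s
    have h1 : ζ * ζ = 1 := by rw [← sq]; exact orderOf_dvd_iff_pow_eq_one.1 h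
    have h2 : θ t⁻¹ = θ t := by
      calc θ t⁻¹ = θ t⁻¹ * (θ t * θ t) := by rw [← hζ, h1, mul_one]
        _ = θ t := by rw [← mul_assoc, ← map_mul, inv_mul_cancel, map_one, one_mul]
    rw [← inv_pow, map_pow, map_pow, h2]
  -- The order of `T` is odd for ε = 1 and 2 mod 4 for ε = -1. Since `n` does not divide 2, it has
  -- an odd prime factor.
  have hn4 : ¬4 ∣ n := by
    intro h
    have h1 := h.trans hnN
    have h2 := P.card
    have h3 := P.mod_eight
    rcases P.sign with rfl | rfl <;> omega
  obtain ⟨p, hp, hpn, hpodd⟩ : ∃ p, p.Prime ∧ p ∣ n ∧ Odd p := by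
    rcases Nat.eq_two_pow_or_exists_odd_prime_and_dvd n with ⟨k, hk⟩ | h
    · exfalso
      rcases lt_or_ge k 2 with h | h
      · apply hn2
        rw [hk]
        exact pow_dvd_pow 2 (Nat.lt_succ_iff.1 h)
      · apply hn4
        rw [hk]
        exact pow_dvd_pow 2 h
    · exact h
  have hpN := hpn.trans hnN
  have hxord : orderOf (t ^ (Nat.card T / p)) = p := by
    rw [← hord] at hpN ⊢
    exact orderOf_pow_orderOf_div (orderOf_pos t).ne' hpN
  set x := t ^ (Nat.card T / p) with hx
  have hxord' : orderOf (x : S) = p := by rw [← hxord, Subgroup.orderOf_coe]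
  refine ⟨x, ?_, by rwa [hxord'], fun k hk => ?_⟩
  · intro h
    rw [h, orderOf_one] at hxord'
    exact hp.one_lt.ne hxord'
  rw [hxord'] at hk
  -- The exponent is lifted from `p` to `n` so that raising ζ to this power extends to a field
  -- automorphism.
  obtain ⟨l, hl, hlk⟩ := exists_coprime_modEq hn0 hpn hk
  have : NeZero n := ⟨hn0⟩
  obtain ⟨σ, hσ⟩ := exists_ringEquiv_pow hprim hl
  obtain ⟨φ, hφ, hφX⟩ := hgal σ
  have htt : (t : S) * t ≠ 1 := by
    intro h
    apply hn2
    have h1 : t * t = 1 := Subtype.ext h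
    rw [hn, orderOf_dvd_iff_pow_eq_one, hζ, ← map_pow, sq, h1, map_one]
  have hmain : ∃ (c : S) (b : T →* T), (∀ s : T, c * φ s * c⁻¹ = b s) ∧
      ∀ s, σ (θ s) = θ (b s) := by
    obtain ⟨c, hc⟩ := hT t t.2 htt φ
    obtain ⟨β, hβ⟩ := exists_mulAut_of_conj_mem hc
    have h1 := torusChar_mulEquiv q ε θ hβ
    rw [← hφX, ringEquiv_torusChar] at h1
    have h2 : (fun s => (σ.toRingHom.toMonoidHom.comp θ) s⁻¹) ≠
        (σ.toRingHom.toMonoidHom.comp θ) := by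
      intro h
      apply hθ
      funext s
      exact σ.injective (congrFun h s)
    -- The attached character determines θ only up to inversion. The ambiguity is absorbed by
    -- composing with an element that inverts the torus.
    rcases P.torusChar_eq_torusChar (θ' := θ.comp β.toMonoidHom) h2 h1 with h | h
    · exact ⟨c, β.toMonoidHom, hβ, fun s => DFunLike.congr_fun h s⟩
    · obtain ⟨w, -, hw, -⟩ := P.torus.exists_inv
      have hcomm := P.torus.mul_comm
      let b : T →* T :=
        { toFun := fun s => (β s)⁻¹
          map_one' := by simp
          map_mul' := fun r s => by rw [map_mul, mul_inv_rev, hcomm] }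
      refine ⟨w * c, b, fun s => ?_, fun s => ?_⟩
      · have := hw _ (β s).2
        rw [← hβ] at this
        calc w * c * φ s * (w * c)⁻¹ = w * (c * φ s * c⁻¹) * w⁻¹ := by group
          _ = (c * φ s * c⁻¹)⁻¹ := this
          _ = b s := by rw [hβ]; rfl
      · rw [show σ (θ s) = _ from (congrFun h s).symm]
        simp [b]
  obtain ⟨c, b, hb, hσb⟩ := hmain
  refine ⟨MulAut.conj c * φ, G.mul_mem (hG ⟨c, rfl⟩) hφ, ?_⟩
  -- An endomorphism of a cyclic group is a power map. Evaluating θ at the generator compares its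
  -- exponent with `l` modulo `n`, hence with `k` modulo `p`.
  obtain ⟨j, hj⟩ := htp (b t)
  have hbx : b x = x ^ j := by
    rw [hx, map_pow, ← hj, ← pow_mul, ← pow_mul, mul_comm]
  have hjl : j ≡ l [MOD n] := by
    have := hσb t
    rw [← hj, map_pow, ← hζ, hσ] at this
    exact ((hprim.isOfFinOrder hn0).pow_eq_pow_iff_modEq.1 this).symm
  have hjk : j ≡ k [MOD p] := (hjl.of_dvd hpn).trans hlk
  have : x ^ j = x ^ k := pow_eq_pow_iff_modEq.2 (by rwa [hxord])
  rw [MulAut.mul_apply, MulAut.conj_apply, hb, hbx, this, Subgroup.coe_pow]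

/-- An element of odd order of a torus, all of whose generators are fused, yields a character
attached to the torus all of whose Galois conjugates are fused. -/
theorem exists_fused_torusChar (P : TorusOfSign q ε T) {G : Subgroup (MulAut S)} {x : S}
    (hx : x ∈ T) (hx1 : x ≠ 1) (hodd : Odd (orderOf x))
    (hfus : ∀ k : ℕ, k.Coprime (orderOf x) → ∃ φ ∈ G, φ x = x ^ k) :
    ∃ θ : T →* ℂ, (fun t => θ t⁻¹) ≠ θ ∧
      ∀ σ : ℂ ≃+* ℂ, ∃ φ ∈ G, σ ∘ torusChar q ε θ = torusChar q ε θ ∘ φ := by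
  obtain ⟨t, ht⟩ := P.torus.isCyclic.exists_generator
  have htp : ∀ s : T, ∃ i : ℕ, t ^ i = s := fun s => (mem_powers_iff_mem_zpowers (x := t)).2 (ht s)
  have hord : orderOf t = Nat.card T := orderOf_eq_card_of_forall_mem_zpowers ht
  set n := orderOf x with hn
  have hn0 : n ≠ 0 := (orderOf_pos x).ne'
  have hn1 : n ≠ 1 := fun h => hx1 (orderOf_eq_one_iff.1 h)
  have hsq : ∀ k : ℕ, k.Coprime n → x ^ k * x ^ k ≠ 1 := by
    intro k hk h
    rw [← pow_add, ← two_mul, ← orderOf_dvd_iff_pow_eq_one, ← hn] at h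
    have h2 : n ∣ 2 := Nat.Coprime.dvd_of_dvd_mul_right hk.symm h
    rcases (Nat.dvd_prime Nat.prime_two).1 h2 with h3 | h3
    · exact hn1 h3
    · rw [h3] at hodd
      exact absurd hodd (by decide)
  have hnN : n ∣ Nat.card T := Subgroup.orderOf_dvd_natCard T hx
  have hprim := Complex.isPrimitiveRoot_exp n hn0
  set ζ := Complex.exp (2 * Real.pi * Complex.I / n) with hζ
  obtain ⟨u, hu⟩ := hprim.isUnit hn0
  have huord : orderOf u ∣ orderOf t := by
    rw [← orderOf_units, hu, ← hprim.eq_orderOf, hord]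
    exact hnN
  -- The linear character sends a generator to a primitive root of unity whose order is that of `x`.
  set θ : T →* ℂ := (Units.coeHom ℂ).comp (monoidHomOfForallMemZpowers ht huord) with hθ
  have hθt : θ t = ζ := by
    rw [hθ, MonoidHom.comp_apply, monoidHomOfForallMemZpowers_apply_gen, Units.coeHom_apply, hu]
  refine ⟨θ, fun h => ?_, fun σ => ?_⟩
  · have h1 : θ t * θ t = 1 := by
      nth_rewrite 1 [← congrFun h t]
      rw [← map_mul, inv_mul_cancel, map_one]
    rw [hθt, ← sq] at h1
    refine hsq 1 (Nat.coprime_one_left n) ?_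
    rw [pow_one, ← sq, ← orderOf_dvd_iff_pow_eq_one, ← hn]
    exact hprim.dvd_of_pow_eq_one 2 h1
  · have hσ := hprim.map_of_injective σ.injective
    have : NeZero n := ⟨hn0⟩
    obtain ⟨k, -, hk, hkσ⟩ := (hprim.isPrimitiveRoot_iff).1 hσ
    obtain ⟨φ, hφ, hφx⟩ := hfus k hk
    -- `T` contains the centralizer of `x ^ k = φ x`, so φ preserves `T` without a further
    -- conjugation.
    have hmem : ∀ s ∈ T, (1 : S) * φ s * 1⁻¹ ∈ T := by
      intro s hs
      rw [one_mul, inv_one, mul_one]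
      refine P.torus.mem_of_commute (T.pow_mem hx k) (hsq k hk) ?_
      have := congrArg (fun z : T => φ z) (P.torus.mul_comm ⟨s, hs⟩ ⟨x, hx⟩)
      simpa [hφx] using this
    obtain ⟨β, hβ⟩ := exists_mulAut_of_conj_mem hmem
    refine ⟨φ, hφ, ?_⟩
    rw [torusChar_mulEquiv q ε θ hβ, ringEquiv_torusChar]
    congr 1
    obtain ⟨j, hj⟩ := htp (β t)
    have hβs : ∀ s, β s = s ^ j := by
      intro s
      obtain ⟨i, rfl⟩ := htp s
      rw [map_pow, ← hj, ← pow_mul, ← pow_mul, mul_comm]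
    have hjk : j ≡ k [MOD n] := by
      have h1 := hβ ⟨x, hx⟩
      rw [hβs, one_mul, inv_one, mul_one, hφx, Subgroup.coe_pow] at h1
      exact (pow_eq_pow_iff_modEq.1 h1).symm
    funext s
    obtain ⟨i, rfl⟩ := htp s
    rw [Function.comp_apply, Function.comp_apply, hβs, map_pow, map_pow, map_pow, map_pow,
      hθt, ← hkσ, ← pow_mul, ← pow_mul]
    apply (hprim.isOfFinOrder hn0).pow_eq_pow_iff_modEq.2
    rw [← hprim.eq_orderOf, mul_comm k]
    exact (Nat.ModEq.mul_left i hjk).symm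

end TorusOfSign

end TorusGalois

/-! ### Nonreal irreducible characters. -/

section NonrealCharacters

variable {S : Type*} [Group S] [Finite S]

/-- Otherwise every class function, in particular the indicator of the class of `u`, would be
invariant under inversion. -/
theorem exists_nonreal {u : S} (hu : ¬IsConj u u⁻¹) :
    ∃ ψ : S → ℂ, IsIrreducibleCharacter ψ ∧ (fun n => ψ n⁻¹) ≠ ψ := by
  classical
  by_contra! hcon
  have hcl : IsClassFunction fun g : S => if IsConj u g then (1 : ℂ) else 0 := by
    intro x g
    have : IsConj g (x * g * x⁻¹) := isConj_iff.2 ⟨x, rfl⟩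
    have h : IsConj u (x * g * x⁻¹) ↔ IsConj u g :=
      ⟨fun h => h.trans this.symm, fun h => h.trans this⟩
    simp only [h]
  have h1 := congrFun hcl.eq_sum_irr u
  have h2 := congrFun hcl.eq_sum_irr u⁻¹
  simp only [if_pos (IsConj.refl u), if_neg hu, Finset.sum_apply, Pi.smul_apply, smul_eq_mul]
    at h1 h2
  rw [Finset.sum_congr rfl fun χ hχ => by
    rw [show χ u⁻¹ = χ u from congrFun (hcon χ (mem_irr.1 hχ)) u], ← h1] at h2
  exact zero_ne_one h2

/-- If χ were neither, pairing with χ would give 1 on the left and 0 on the right. -/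
theorem eq_or_eq_inv_of_sub_inv {χ ψ : S → ℂ} (hχ : IsIrreducibleCharacter χ)
    (hψ : IsIrreducibleCharacter ψ) (hne : (fun n => ψ n⁻¹) ≠ ψ) {c : ℂ} (hc : c ≠ 0)
    (h : χ - (fun n => χ n⁻¹) = c • (ψ - fun n => ψ n⁻¹)) :
    χ = ψ ∨ χ = fun n => ψ n⁻¹ := by
  by_contra! hcon
  have hχne : (fun n => χ n⁻¹) ≠ χ := by
    intro h'
    rw [h', sub_self, eq_comm, smul_eq_zero] at h
    exact hne (sub_eq_zero.1 (h.resolve_left hc)).symm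
  have h1 := congrArg (fun f => cf f χ) h
  simp only [map_sub, map_smul, LinearMap.sub_apply, LinearMap.smul_apply, hχ.cf_self,
    hχ.inv.cf_ne hχ hχne, hψ.cf_ne hχ hcon.1.symm, hψ.inv.cf_ne hχ hcon.2.symm] at h1
  simp at h1

theorem eq_of_sub_inv {χ ψ : S → ℂ} (hχ : IsIrreducibleCharacter χ)
    (hψ : IsIrreducibleCharacter ψ) (hne : (fun n => ψ n⁻¹) ≠ ψ)
    (h : χ - (fun n => χ n⁻¹) = ψ - fun n => ψ n⁻¹) : χ = ψ := by
  refine (eq_or_eq_inv_of_sub_inv hχ hψ hne one_ne_zero (by rw [h, one_smul])).resolve_right ?_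
  rintro rfl
  refine hne ?_
  funext n
  have := congrFun h n
  simp only [Pi.sub_apply, inv_inv] at this
  linear_combination this / 2

namespace TorusDecomposition

variable {q : ℕ} {T₁ T₂ : Subgroup S}

theorem isConj_inv (D : TorusDecomposition q T₁ T₂) {g : S} (hg : g ^ 3 ≠ 1) : IsConj g g⁻¹ := by
  have key : ∀ {T : Subgroup S}, IsTorus T → ∀ x, x * g * x⁻¹ ∈ T → IsConj g g⁻¹ := by
    intro T hT x hx
    obtain ⟨w, -, hw, -⟩ := hT.exists_inv
    have h1 : IsConj (x * g * x⁻¹) (x * g * x⁻¹)⁻¹ := isConj_iff.2 ⟨w, hw _ hx⟩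
    have h2 : IsConj g (x * g * x⁻¹) := isConj_iff.2 ⟨x, rfl⟩
    have h3 : IsConj g⁻¹ (x * g * x⁻¹)⁻¹ := isConj_iff.2 ⟨x, by group⟩
    exact (h2.trans h1).trans h3.symm
  rcases D.cover g with h | ⟨x, hx⟩ | ⟨x, hx⟩
  · exact absurd h hg
  · exact key D.torus₁ x hx
  · exact key D.torus₂ x hx

theorem apply_inv_eq (D : TorusDecomposition q T₁ T₂) {ψ : S → ℂ} (hψ : IsClassFunction ψ) {g : S}
    (hg : g ^ 3 ≠ 1 ∨ g = 1) : ψ g⁻¹ = ψ g := by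
  rcases hg with hg | rfl
  · obtain ⟨x, hx⟩ := isConj_iff.1 (D.isConj_inv hg)
    rw [← hx, hψ]
  · rw [inv_one]

variable {ψ : S → ℂ}

/-- The difference of ψ and its conjugate determines ψ and vanishes off the elements of order 3, so
only the effect of φ on their classes matters. -/
theorem comp_eq_self (D : TorusDecomposition q T₁ T₂) (hψ : IsIrreducibleCharacter ψ)
    (hne : (fun n => ψ n⁻¹) ≠ ψ) {φ : MulAut S}
    (hφ : ∀ g : S, g ^ 3 = 1 → g ≠ 1 → IsConj g (φ g)) : ψ ∘ φ = ψ := by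
  refine eq_of_sub_inv (hψ.mulEquiv φ) hψ hne ?_
  funext g
  have hcl := hψ.isClassFunction
  simp only [Pi.sub_apply, Function.comp_apply, map_inv]
  by_cases hg : g ^ 3 = 1 ∧ g ≠ 1
  · obtain ⟨x, hx⟩ := isConj_iff.1 (hφ g hg.1 hg.2)
    rw [← hx, hcl, show (x * g * x⁻¹)⁻¹ = x * g⁻¹ * x⁻¹ by group, hcl]
  · have hφg : φ g ^ 3 ≠ 1 ∨ φ g = 1 := by
      rw [← map_pow, Ne, map_eq_one_iff φ φ.injective, map_eq_one_iff φ φ.injective]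
      tauto
    rw [D.apply_inv_eq hcl (g := g) (by tauto), D.apply_inv_eq hcl hφg, sub_self, sub_self]

theorem comp_eq_inv (D : TorusDecomposition q T₁ T₂) (hψ : IsIrreducibleCharacter ψ)
    (hne : (fun n => ψ n⁻¹) ≠ ψ) {φ : MulAut S}
    (hφ : ∀ g : S, g ^ 3 = 1 → g ≠ 1 → IsConj g⁻¹ (φ g)) : ψ ∘ φ = fun n => ψ n⁻¹ := by
  refine eq_of_sub_inv (hψ.mulEquiv φ) hψ.inv (fun h => hne ?_) ?_
  · simpa using h.symm
  funext g
  have hcl := hψ.isClassFunction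
  simp only [Pi.sub_apply, Function.comp_apply, map_inv, inv_inv]
  by_cases hg : g ^ 3 = 1 ∧ g ≠ 1
  · obtain ⟨x, hx⟩ := isConj_iff.1 (hφ g hg.1 hg.2)
    rw [← hx, hcl, show (x * g⁻¹ * x⁻¹)⁻¹ = x * g * x⁻¹ by group, hcl]
  · have hφg : φ g ^ 3 ≠ 1 ∨ φ g = 1 := by
      rw [← map_pow, Ne, map_eq_one_iff φ φ.injective, map_eq_one_iff φ φ.injective]
      tauto
    rw [D.apply_inv_eq hcl (g := g) (by tauto), D.apply_inv_eq hcl hφg, sub_self, sub_self]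

/-- Class functions supported on elements of order 3 and odd under inversion form a line, since
there are only two classes there. So the difference for σψ is a multiple of that for ψ. -/
theorem ringEquiv_comp_eq (D : TorusDecomposition q T₁ T₂) (hψ : IsIrreducibleCharacter ψ)
    (hne : (fun n => ψ n⁻¹) ≠ ψ) (σ : ℂ ≃+* ℂ) :
    σ ∘ ψ = ψ ∨ σ ∘ ψ = fun n => ψ n⁻¹ := by
  have hcl := hψ.isClassFunction
  obtain ⟨u, hu⟩ := Function.ne_iff.1 hne
  have hu0 : ψ u - ψ u⁻¹ ≠ 0 := sub_ne_zero.2 (Ne.symm hu)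
  have hu3 : u ^ 3 = 1 ∧ u ≠ 1 := by
    by_contra h
    exact hu (D.apply_inv_eq hcl (by tauto))
  refine eq_or_eq_inv_of_sub_inv (c := σ (ψ u - ψ u⁻¹) / (ψ u - ψ u⁻¹)) (hψ.ringEquiv σ) hψ hne
    (div_ne_zero ((map_ne_zero σ).2 hu0) hu0) ?_
  funext g
  simp only [Pi.sub_apply, Function.comp_apply, Pi.smul_apply, smul_eq_mul]
  rw [div_mul_eq_mul_div, eq_div_iff hu0, ← map_sub]
  by_cases hg : g ^ 3 = 1 ∧ g ≠ 1
  · rcases D.isConj_or u g hu3.1 hu3.2 hg.1 hg.2 with h | h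
    · obtain ⟨x, hx⟩ := isConj_iff.1 h
      rw [← hx, hcl, show (x * u * x⁻¹)⁻¹ = x * u⁻¹ * x⁻¹ by group, hcl]
    · obtain ⟨x, hx⟩ := isConj_iff.1 h
      have hx' : g = x * u⁻¹ * x⁻¹ := by
        rw [← inv_inv g, ← hx]
        group
      rw [← hx, hcl, hx', hcl, ← neg_sub (ψ u) (ψ u⁻¹), map_neg]
      ring
  · rw [D.apply_inv_eq hcl (by tauto), sub_self, map_zero, zero_mul, mul_zero]

end TorusDecomposition

end NonrealCharacters

/-! ### Elementary matrices and standard automorphisms. -/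

section Automorphisms

namespace SL2

variable {F : Type*} [Field F]

theorem eq_upper_mul_lower_mul_upper {A : SL2 F} (h : A 1 0 ≠ 0) :
    A = upper ((A 0 0 - 1) / A 1 0) * lower (A 1 0) * upper ((A 1 1 - 1) / A 1 0) := by
  have hd := det_eq A
  simp only [eq_iff, mul_apply', upper, lower, of_00, of_01, of_10, of_11]
  refine ⟨?_, ?_, ?_, ?_⟩
  · field_simp
    ring
  · field_simp
    linear_combination -hd
  · field_simp
    ring
  · field_simp
    ring

theorem closure_upper_lower :
    Subgroup.closure (Set.range (upper : F → SL2 F) ∪ Set.range lower) = ⊤ := by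
  rw [eq_top_iff]
  have hu : ∀ x : F, upper x ∈ Subgroup.closure (Set.range (upper : F → SL2 F) ∪ Set.range lower) :=
    fun x => Subgroup.subset_closure (Or.inl ⟨x, rfl⟩)
  have hl : ∀ x : F, lower x ∈ Subgroup.closure (Set.range (upper : F → SL2 F) ∪ Set.range lower) :=
    fun x => Subgroup.subset_closure (Or.inr ⟨x, rfl⟩)
  have key : ∀ A : SL2 F, A 1 0 ≠ 0 →
      A ∈ Subgroup.closure (Set.range (upper : F → SL2 F) ∪ Set.range lower) := by
    intro A hA
    rw [eq_upper_mul_lower_mul_upper hA]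
    exact mul_mem (mul_mem (hu _) (hl _)) (hu _)
  rintro A -
  by_cases hA : A 1 0 = 0
  · have h1 : (A * lower 1 : SL2 F) 1 0 ≠ 0 := by
      have hd := det_eq A
      simp only [mul_apply', lower, of_00, of_10, hA]
      intro h
      have : A 1 1 = 0 := by linear_combination h
      rw [hA, this] at hd
      simp at hd
    have := mul_mem (key _ h1) (inv_mem (hl 1))
    rwa [mul_inv_cancel_right] at this
  · exact key A hA

/-- The monomial matrices. -/
def monomial (x y : F) (h : x * y = 1) : SL2 F := of 0 x (-y) 0 (by linear_combination h)

theorem upper_mul_lower_mul_upper {x y : F} (h : x * y = 1) :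
    upper x * lower (-y) * upper x = monomial x y h := by
  simp only [eq_iff, mul_apply', upper, lower, monomial, of_00, of_01, of_10, of_11]
  refine ⟨by linear_combination -h, by linear_combination -x * h, by ring, by linear_combination -h⟩

/-- A test for xy = -1 that is expressed inside PSL₂ and is therefore respected by automorphisms. -/
theorem sq_upper_mul_lower_mul_upper (h2 : (2 : F) ≠ 0) {x y : F} (hy : y ≠ 0) :
    ((upper x * lower y * upper x) ^ 2 = 1 ∨ (upper x * lower y * upper x) ^ 2 = -1) ↔
      1 + x * y = 0 := by
  rw [sq]
  constructor
  · rintro (h | h)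
    · have h3 := (eq_iff.1 h).2.2.1
      simp only [mul_apply', upper, lower, of_00, of_01, of_10, of_11, one_10] at h3
      have : 2 * y * (1 + x * y) = 0 := by linear_combination h3
      exact (mul_eq_zero.1 this).resolve_left (mul_ne_zero h2 hy)
    · have h3 := (eq_iff.1 h).2.2.1
      simp only [mul_apply', upper, lower, of_00, of_01, of_10, of_11, neg_apply', one_10] at h3
      have : 2 * y * (1 + x * y) = 0 := by linear_combination h3
      exact (mul_eq_zero.1 this).resolve_left (mul_ne_zero h2 hy)
  · intro h
    right
    simp only [eq_iff, mul_apply', upper, lower, of_00, of_01, of_10, of_11, neg_apply', one_00,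
      one_01, one_10, one_11]
    refine ⟨?_, ?_, ?_, ?_⟩
    · linear_combination (2 * x * y + 2) * h
    · linear_combination 2 * x * (2 + x * y) * h
    · linear_combination 2 * y * h
    · linear_combination (2 * x * y + 2) * h

theorem weyl_mul_lower (x : F) : weyl F * lower x = upper (-x) * weyl F := by
  simp [eq_iff, mul_apply', upper, lower, weyl]

end SL2

namespace IsPSL2

open SL2

variable {F S : Type*} [Field F] [Group S] {π : SL2 F →* S}

theorem map_lower_eq (π : SL2 F →* S) (x : F) :
    π (lower x) = (π (weyl F))⁻¹ * π (upper (-x)) * π (weyl F) := by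
  rw [mul_assoc, ← map_mul, ← weyl_mul_lower, map_mul, inv_mul_cancel_left]

theorem commute_lower (H : IsPSL2 π) (h2 : (2 : F) ≠ 0) {s : S} {x : F} (hx : x ≠ 0)
    (h : s * π (lower x) * s⁻¹ = π (lower x)) : ∃ y, s = π (lower y) := by
  obtain ⟨y, hy⟩ := H.commute_upper h2 (s := π (weyl F) * s * (π (weyl F))⁻¹) (x := -x)
    (neg_ne_zero.2 hx) (by
      rw [map_lower_eq] at h
      calc _ = π (weyl F) * (s * ((π (weyl F))⁻¹ * π (upper (-x)) * π (weyl F)) * s⁻¹)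
            * (π (weyl F))⁻¹ := by group
        _ = _ := by rw [h]; group)
  refine ⟨-y, ?_⟩
  rw [map_lower_eq, neg_neg, ← hy]
  group

theorem map_lower_injective (H : IsPSL2 π) (h2 : (2 : F) ≠ 0) :
    Function.Injective fun x => π (lower x) := by
  intro x y h
  simp only [map_lower_eq, mul_left_inj, mul_right_inj] at h
  exact neg_injective (H.map_upper_injective h2 h)

theorem mulEquiv_ext (H : IsPSL2 π) {φ φ' : MulAut S}
    (hu : ∀ x, φ (π (upper x)) = φ' (π (upper x)))
    (hl : ∀ x, φ (π (lower x)) = φ' (π (lower x))) : φ = φ' := by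
  have h : φ.toMonoidHom.comp π = φ'.toMonoidHom.comp π := by
    refine MonoidHom.eq_of_eqOn_dense closure_upper_lower ?_
    rintro _ (⟨x, rfl⟩ | ⟨x, rfl⟩)
    · exact hu x
    · exact hl x
  ext s
  obtain ⟨A, rfl⟩ := H.surjective s
  exact DFunLike.congr_fun h A

/-- The automorphism acts on the elementary matrices through `x ↦ ε ρ(x)`. -/
def IsStandard (π : SL2 F →* S) (φ : MulAut S) (ε : F) (ρ : F →+* F) : Prop :=
  ∀ x, φ (π (upper x)) = π (upper (ε * ρ x)) ∧ φ (π (lower x)) = π (lower (ε * ρ x))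

theorem IsStandard.mul {φ φ' : MulAut S} {ε ε' : F} {ρ ρ' : F →+* F} (h : IsStandard π φ ε ρ)
    (h' : IsStandard π φ' ε' ρ') : IsStandard π (φ * φ') (ε * ρ ε') (ρ.comp ρ') := by
  intro x
  rw [MulAut.mul_apply, MulAut.mul_apply, (h' x).1, (h' x).2, (h _).1, (h _).2]
  simp [mul_assoc]

theorem IsStandard.ext (H : IsPSL2 π) {φ φ' : MulAut S} {ε : F} {ρ : F →+* F}
    (h : IsStandard π φ ε ρ) (h' : IsStandard π φ' ε ρ) : φ = φ' :=
  H.mulEquiv_ext (fun x => by rw [(h x).1, (h' x).1]) fun x => by rw [(h x).2, (h' x).2]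

end IsPSL2

end Automorphisms

/-! ### Automorphisms of PSL₂ modulo inner ones. -/

section OuterAutomorphisms

theorem exists_frobenius_pow {F : Type*} [Field F] [Finite F] [CharP F 3] (ρ : F →+* F) :
    ∃ i : ℕ, ∀ x, ρ x = x ^ 3 ^ i := by
  have := ZMod.algebra F 3
  have hfact : Fact (Nat.Prime 3) := ⟨Nat.prime_three⟩
  let e : F →ₐ[ZMod 3] F :=
    { ρ with
      commutes' := fun r =>
        DFunLike.congr_fun (Subsingleton.elim (ρ.comp (algebraMap (ZMod 3) F)) _) r }
  obtain ⟨i, hi⟩ := (FiniteField.bijective_frobeniusAlgEquivOfAlgebraic_pow (ZMod 3) F).2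
    (AlgEquiv.ofBijective e (Finite.injective_iff_bijective.1 ρ.injective))
  refine ⟨i, fun x => ?_⟩
  have h := DFunLike.congr_fun hi x
  simp only [AlgEquiv.coe_pow, FiniteField.coe_frobeniusAlgEquivOfAlgebraic_iterate,
    ZMod.card] at h
  exact h.symm

theorem comp_comm_of_finite {F : Type*} [Field F] [Finite F] [CharP F 3] (ρ ρ' : F →+* F) :
    ρ.comp ρ' = ρ'.comp ρ := by
  obtain ⟨i, hi⟩ := exists_frobenius_pow ρ'
  ext x
  simp [hi]

theorem iterate_eq_self {F : Type*} [Field F] [Finite F] [CharP F 3] {f : ℕ}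
    (hF : Nat.card F = 3 ^ f) (ρ : F →+* F) (x : F) : ρ^[f] x = x := by
  obtain ⟨i, hi⟩ := exists_frobenius_pow ρ
  have := Fintype.ofFinite F
  have h1 : ∀ n, ρ^[n] x = x ^ 3 ^ (i * n) := by
    intro n
    induction n with
    | zero => simp
    | succ n ih => rw [Function.iterate_succ_apply', ih, hi, ← pow_mul, ← pow_add, mul_add, mul_one]
  rw [h1, mul_comm, pow_mul, ← hF, Nat.card_eq_fintype_card, FiniteField.pow_card_pow]

namespace IsPSL2

open SL2

variable {F S : Type*} [Field F] [Group S] {π : SL2 F →* S}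

/-- An automorphism fixing both the upper and the lower unitriangular subgroups acts on them through
a field automorphism up to scaling. -/
theorem exists_ringHom (H : IsPSL2 π) (h2 : (2 : F) ≠ 0) {φ : MulAut S} {α β : F → F}
    (hα : ∀ x, φ (π (upper x)) = π (upper (α x)))
    (hβ : ∀ x, φ (π (lower x)) = π (lower (β x))) :
    ∃ (c : F) (ρ : F →+* F), c ≠ 0 ∧ (∀ x, α x = c * ρ x) ∧ ∀ x, β x = c⁻¹ * ρ x := by
  have hinjα : ∀ {x y}, α x = α y → x = y := fun {x y} h =>
    H.map_upper_injective h2 (φ.injective (by simp only [hα, h]))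
  have hinjβ : ∀ {x y}, β x = β y → x = y := fun {x y} h =>
    H.map_lower_injective h2 (φ.injective (by simp only [hβ, h]))
  have hadd : ∀ x y, α (x + y) = α x + α y := by
    intro x y
    apply H.map_upper_injective h2
    simp only [← hα, upper_add, map_mul]
  have haddβ : ∀ x y, β (x + y) = β x + β y := by
    intro x y
    apply H.map_lower_injective h2
    simp only [← hβ, lower_add, map_mul]
  have h0 : α 0 = 0 := by
    have := hadd 0 0
    rw [add_zero] at this
    exact left_eq_add.1 this
  have h0β : β 0 = 0 := by
    have := haddβ 0 0
    rw [add_zero] at this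
    exact left_eq_add.1 this
  have hne : ∀ {x}, x ≠ 0 → α x ≠ 0 := fun {x} hx h => hx (hinjα (by rw [h, h0]))
  have hneβ : ∀ {x}, x ≠ 0 → β x ≠ 0 := fun {x} hx h => hx (hinjβ (by rw [h, h0β]))
  have hrel : ∀ x y, y ≠ 0 → 1 + x * y = 0 → 1 + α x * β y = 0 := by
    intro x y hy h
    rw [← sq_upper_mul_lower_mul_upper h2 hy, ← H.map_eq_one_iff] at h
    rw [← sq_upper_mul_lower_mul_upper h2 (hneβ hy), ← H.map_eq_one_iff]
    have h' := congrArg φ h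
    simpa only [map_pow, map_mul, hα, hβ, map_one] using h'
  -- The factorization of monomial matrices into elementary ones shows that φ maps them to monomial
  -- matrices.
  have hw : ∀ x y (hxy : x * y = 1), ∃ hxy' : α x * -β (-y) = 1,
      φ (π (monomial x y hxy)) = π (monomial (α x) (-β (-y)) hxy') := by
    intro x y hxy
    have hy : -y ≠ 0 := by
      rw [neg_ne_zero]
      rintro rfl
      simp at hxy
    have h := hrel x (-y) hy (by linear_combination -hxy)
    refine ⟨by linear_combination -h, ?_⟩
    rw [← upper_mul_lower_mul_upper, ← upper_mul_lower_mul_upper]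
    simp only [map_mul, hα, hβ, neg_neg]
  -- The product of the monomial matrices for `x` and for 1 is diagonal and conjugates `upper y` to
  -- `upper (x ^ 2 * y)`. Applying φ gives the same relation between values of α.
  have hmul : ∀ x y, α 1 ^ 2 * α (x ^ 2 * y) = α x ^ 2 * α y := by
    intro x y
    rcases eq_or_ne y 0 with rfl | hy
    · simp [h0]
    rcases eq_or_ne x 0 with rfl | hx
    · simp [h0]
    obtain ⟨h1, e1⟩ := hw x x⁻¹ (mul_inv_cancel₀ hx)
    obtain ⟨h1', e1'⟩ := hw 1 1 (one_mul 1)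
    have hk : π (monomial x x⁻¹ (mul_inv_cancel₀ hx) * monomial 1 1 (one_mul 1)) * π (upper y) *
        (π (monomial x x⁻¹ (mul_inv_cancel₀ hx) * monomial 1 1 (one_mul 1)))⁻¹
        = π (upper (x ^ 2 * y)) := by
      rw [H.map_upper_conj_iff h2 hy]
      simp [mul_apply', monomial]
    have hk' := congrArg φ hk
    simp only [map_mul, map_inv, e1, e1', hα] at hk'
    rw [← map_mul, H.map_upper_conj_iff h2 (hne hy)] at hk'
    have h3 := hk'.2
    simp only [mul_apply', monomial, of_00, of_01, of_10] at h3
    rw [h3]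
    linear_combination α x ^ 2 * α y * (α 1 * -β (-1) + 1) * h1'
  have hc : α 1 ≠ 0 := hne one_ne_zero
  have hsq : ∀ x, (α 1)⁻¹ * α (x * x) = (α 1)⁻¹ * α x * ((α 1)⁻¹ * α x) := by
    intro x
    have := hmul x 1
    rw [mul_one] at this
    field_simp
    exact mul_left_cancel₀ hc (by linear_combination this)
  let ρ : F →+* F :=
    { toFun := fun x => (α 1)⁻¹ * α x
      map_one' := inv_mul_cancel₀ hc
      map_zero' := by rw [h0, mul_zero]
      map_add' := fun x y => by rw [hadd, mul_add]
      map_mul' := fun x y => by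
        -- An additive map compatible with squares is multiplicative, by polarization.
        apply mul_left_cancel₀ h2
        have e := hsq (x + y)
        rw [show (x + y) * (x + y) = x * x + y * y + (x * y + x * y) by ring] at e
        simp only [hadd, mul_add] at e
        linear_combination e - hsq x - hsq y }
  have hρ : ∀ x, α x = α 1 * ρ x := fun x => by
    change α x = α 1 * ((α 1)⁻¹ * α x)
    rw [mul_inv_cancel_left₀ hc]
  refine ⟨α 1, ρ, hc, hρ, fun y => ?_⟩
  rcases eq_or_ne y 0 with rfl | hy
  · rw [h0β, map_zero, mul_zero]
  · have h := hrel (-y⁻¹) y hy (by field_simp; ring)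
    rw [hρ, show ρ (-y⁻¹) = -(ρ y)⁻¹ by simp] at h
    have hρy : ρ y ≠ 0 := (map_ne_zero ρ).2 hy
    field_simp at h ⊢
    linear_combination -h

variable [CharP F 3]

theorem map_upper_pow_three (π : SL2 F →* S) (x : F) : π (upper x) ^ 3 = 1 := by
  rw [pow_succ, sq, ← map_mul, ← map_mul, ← upper_add, ← upper_add]
  have : x + x + x = 0 := by
    have h3 : (3 : F) = 0 := by exact_mod_cast CharP.cast_eq_zero F 3
    linear_combination x * h3
  rw [this, upper_zero, map_one]

/-- Up to inner automorphisms, all automorphisms of `PSL₂(F)` are standard. -/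
theorem exists_isStandard (H : IsPSL2 π) (hs : ¬IsSquare (-1 : F))
    (hsq : ∀ z : F, IsSquare z ∨ IsSquare (-z))
    (h3 : ∀ s : S, s ^ 3 = 1 → s ≠ 1 → ∃ x y, y ≠ 0 ∧ x * s * x⁻¹ = π (upper y)) (φ : MulAut S) :
    ∃ (c : S) (ε : F) (ρ : F →+* F), (ε = 1 ∨ ε = -1) ∧
      IsStandard π (MulAut.conj c * φ) ε ρ := by
  have h2 := two_ne_zero_of_not_isSquare hs
  have hne1 : ∀ {x : F}, x ≠ 0 → π (upper x) ≠ 1 := fun {x} hx h =>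
    hx (H.map_upper_injective h2 (by simp only [h, upper_zero, map_one]))
  have h3' : ∀ (φ : MulAut S) (x : F), x ≠ 0 → ∃ s y, y ≠ 0 ∧
      s * φ (π (upper x)) * s⁻¹ = π (upper y) := by
    intro φ x hx
    refine h3 _ (by rw [← map_pow, map_upper_pow_three, map_one]) ?_
    rw [Ne, _root_.map_eq_one_iff _ φ.injective]
    exact hne1 hx
  obtain ⟨s, y, hy, hsy⟩ := h3' φ 1 one_ne_zero
  set φ₁ := MulAut.conj s * φ with hφ₁
  have hφ₁1 : φ₁ (π (upper 1)) = π (upper y) := hsy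
  have hcU : ∀ (φ : MulAut S) {y : F}, y ≠ 0 → φ (π (upper 1)) = π (upper y) →
      ∀ x, ∃ z, φ (π (upper x)) = π (upper z) := by
    intro φ y hy h x
    refine H.commute_upper h2 hy ?_
    rw [← h, ← map_mul, ← map_inv, ← map_mul, ← map_mul, ← map_inv, ← map_mul, ← upper_add,
      add_comm, upper_add, mul_inv_cancel_right]
  have hcL : ∀ (φ : MulAut S) {y : F}, y ≠ 0 → φ (π (lower 1)) = π (lower y) →
      ∀ x, ∃ z, φ (π (lower x)) = π (lower z) := by
    intro φ y hy h x
    refine H.commute_lower h2 hy ?_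
    rw [← h, ← map_mul, ← map_inv, ← map_mul, ← map_mul, ← map_inv, ← map_mul, ← lower_add,
      add_comm, lower_add, mul_inv_cancel_right]
  -- move the image of the lower unitriangular group
  obtain ⟨s', y', hy', hsy'⟩ := h3' (φ₁ * MulAut.conj (π (weyl F))⁻¹) (-1)
    (neg_ne_zero.2 one_ne_zero)
  rw [MulAut.mul_apply, MulAut.conj_apply, inv_inv, ← map_lower_eq] at hsy'
  obtain ⟨g, rfl⟩ := H.surjective s'
  -- Otherwise the image of `lower 1` would be upper unitriangular and commute with that of `upper
  -- 1`, whereas `lower 1` and `upper 1` do not commute.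
  have hg : g 1 0 ≠ 0 := by
    intro hg
    have h4 := mul_upper_eq (g := g⁻¹) y' (by simp [inv_eq_of, hg])
    have h5 : φ₁ (π (lower 1)) = π (upper ((g⁻¹ 0 0) ^ 2 * y')) := by
      have : φ₁ (π (lower 1)) = (π g)⁻¹ * π (upper y') * π g := by
        rw [← hsy']
        group
      rw [this, ← map_inv, ← map_mul, h4, map_mul, mul_assoc, ← map_mul, inv_mul_cancel, map_one,
        mul_one]
    obtain ⟨z, hz⟩ := H.commute_upper h2 (s := π (lower 1)) one_ne_zero (by
      apply φ₁.injective
      rw [map_mul, map_mul, map_inv, hφ₁1, h5, ← map_mul, ← map_inv, ← map_mul, ← upper_add,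
        add_comm, upper_add, mul_inv_cancel_right])
    rcases (H.eq_iff _ _).1 hz with h | h
    · exact one_ne_zero (SL2.eq_iff.1 h).2.2.1
    · have := (SL2.eq_iff.1 h).2.2.1
      simp [upper, lower] at this
  -- The image of `lower 1` fixes the line spanned by (g₁₁, -g₁₀). This upper matrix moves that line
  -- to the second axis without disturbing the upper unitriangular group.
  set u := π (upper (g 1 1 / g 1 0)) with hu
  set φ₂ := MulAut.conj u * φ₁ with hφ₂
  have hφ₂u : φ₂ (π (upper 1)) = π (upper y) := by
    rw [hφ₂, MulAut.mul_apply, MulAut.conj_apply, hφ₁1, hu, ← map_mul, ← map_inv, ← map_mul,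
      ← upper_add, add_comm, upper_add, mul_inv_cancel_right]
  have hφ₂l : φ₂ (π (lower 1)) = π (lower (-(g 1 0) ^ 2 * y')) := by
    have h6 : φ₁ (π (lower 1)) = (π g)⁻¹ * π (upper y') * π g := by
      rw [← hsy']
      group
    rw [hφ₂, MulAut.mul_apply, MulAut.conj_apply, h6, hu, mul_inv_eq_iff_eq_mul, ← mul_assoc,
      ← mul_assoc]
    simp only [← map_mul, ← map_inv]
    congr 1
    have hd := det_eq g
    simp only [SL2.eq_iff, mul_apply', upper, lower, inv_eq_of, of_00, of_01, of_10, of_11]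
    refine ⟨?_, ?_, ?_, ?_⟩ 
    · field_simp
      linear_combination g 1 0 * hd
    · field_simp
      linear_combination g 1 1 * hd
    · field_simp
      ring
    · field_simp
      linear_combination hd
  choose α hα using hcU φ₂ hy hφ₂u
  choose β hβ using hcL φ₂ (by
    rw [neg_mul, neg_ne_zero]
    exact mul_ne_zero (pow_ne_zero 2 hg) hy') hφ₂l
  obtain ⟨c, ρ, hc, hαρ, hβρ⟩ := H.exists_ringHom h2 hα hβ
  -- A diagonal conjugation changes `c` by a square, and modulo squares only ±1 remain.
  obtain ⟨ε, z, hε, hz⟩ : ∃ ε z : F, (ε = 1 ∨ ε = -1) ∧ ε = z ^ 2 * c := by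
    rcases hsq c with ⟨z, hz⟩ | ⟨z, hz⟩
    · have hz0 : z ≠ 0 := by
        rintro rfl
        exact hc (by rw [hz, mul_zero])
      exact ⟨1, z⁻¹, Or.inl rfl, by rw [hz]; field_simp⟩
    · have hz0 : z ≠ 0 := by
        rintro rfl
        exact hc (by rw [← neg_eq_zero, hz, mul_zero])
      refine ⟨-1, z⁻¹, Or.inr rfl, ?_⟩
      field_simp
      linear_combination hz
  have hz0 : z ≠ 0 := by
    rintro rfl
    rcases hε with rfl | rfl <;> simp at hz
  refine ⟨π (of z 0 0 z⁻¹ (by simp [hz0])) * u * s, ε, ρ, hε, fun x => ⟨?_, ?_⟩⟩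
  · have : (MulAut.conj (π (of z 0 0 z⁻¹ (by simp [hz0])) * u * s) * φ) (π (upper x)) =
        π (of z 0 0 z⁻¹ (by simp [hz0])) * φ₂ (π (upper x)) *
          (π (of z 0 0 z⁻¹ (by simp [hz0])))⁻¹ := by
      rw [hφ₂, hφ₁, map_mul, map_mul]
      rfl
    rw [this, hα, hαρ, H.conj_eq_iff, hz]
    left
    simp [SL2.eq_iff, mul_apply', upper]
    field_simp
  · have : (MulAut.conj (π (of z 0 0 z⁻¹ (by simp [hz0])) * u * s) * φ) (π (lower x)) =
        π (of z 0 0 z⁻¹ (by simp [hz0])) * φ₂ (π (lower x)) *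
          (π (of z 0 0 z⁻¹ (by simp [hz0])))⁻¹ := by
      rw [hφ₂, hφ₁, map_mul, map_mul]
      rfl
    rw [this, hβ, hβρ, H.conj_eq_iff]
    left
    have hεε : ε * ε = 1 := by rcases hε with rfl | rfl <;> ring
    simp [SL2.eq_iff, mul_apply', lower]
    field_simp
    linear_combination -ρ x * hεε + ρ x * ε * hz

end IsPSL2

end OuterAutomorphisms

/-! ### Assembling the structure of PSL₂(3^f) for odd f. -/

section Decomposition

theorem isSquare_or_isSquare_neg {F : Type*} [Field F] [Finite F] (hs : ¬IsSquare (-1 : F)) (z : F) :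
    IsSquare z ∨ IsSquare (-z) := by
  classical
  have := Fintype.ofFinite F
  by_contra! h
  have h1 := quadraticChar_neg_one_iff_not_isSquare.2 h.1
  have h2 := quadraticChar_neg_one_iff_not_isSquare.2 h.2
  have h3 := quadraticChar_neg_one_iff_not_isSquare.2 hs
  rw [← neg_one_mul, map_mul, h1, h3] at h2
  norm_num at h2

theorem exists_sq_add_sq_eq {F : Type*} [Field F] [Finite F] (hs : ¬IsSquare (-1 : F)) (z : F) :
    ∃ r s : F, r ^ 2 + s ^ 2 = z := by
  have := Fintype.ofFinite F
  have hchar : ringChar F ≠ 2 := by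
    intro h
    have h2 : (2 : F) = 0 := by
      have := ringChar.Nat.cast_ringChar (R := F)
      rw [h] at this
      exact_mod_cast this
    exact SL2.two_ne_zero_of_not_isSquare hs h2
  open Polynomial in
  obtain ⟨a, b, hab⟩ := FiniteField.exists_root_sum_quadratic (R := F)
    (f := X ^ 2 - C z) (g := X ^ 2) (degree_X_pow_sub_C (by norm_num) z) (degree_X_pow 2)
    (FiniteField.odd_card_of_char_ne_two hchar)
  refine ⟨a, b, ?_⟩
  simp at hab
  linear_combination hab

theorem three_pow_mod_eight {f : ℕ} (hf : Odd f) : 3 ^ f % 8 = 3 := by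
  obtain ⟨k, rfl⟩ := hf
  rw [pow_succ, pow_mul, Nat.mul_mod, Nat.pow_mod]
  norm_num

theorem not_isSquare_neg_one {F : Type*} [Field F] [Finite F] {f : ℕ} (hf : Odd f)
    (hF : Nat.card F = 3 ^ f) : ¬IsSquare (-1 : F) := by
  have := Fintype.ofFinite F
  rw [FiniteField.isSquare_neg_one_iff, not_not, ← Nat.card_eq_fintype_card, hF]
  have := three_pow_mod_eight hf
  omega

theorem eq_one_of_pow_three_of_not_dvd {S : Type*} [Group S] {T : Subgroup S}
    (hT : ¬3 ∣ Nat.card T) {t : S} (ht : t ∈ T) (h : t ^ 3 = 1) : t = 1 := by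
  rcases (Nat.dvd_prime Nat.prime_three).1 (orderOf_dvd_of_pow_eq_one h) with h3 | h3
  · exact orderOf_eq_one_iff.1 h3
  · exact absurd (h3 ▸ Subgroup.orderOf_dvd_natCard T ht) hT

namespace IsPSL2

open SL2

variable {F S : Type*} [Field F] [Group S] {π : SL2 F →* S}

theorem map_upper_inv (π : SL2 F →* S) (x : F) : (π (upper x))⁻¹ = π (upper (-x)) := by
  rw [inv_eq_iff_mul_eq_one, ← map_mul, ← upper_add, add_neg_cancel, upper_zero, map_one]

theorem not_isConj_upper_neg (H : IsPSL2 π) (hs : ¬IsSquare (-1 : F)) {x : F} (hx : x ≠ 0) :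
    ¬IsConj (π (upper x)) (π (upper (-x))) := by
  rw [H.isConj_map_upper_iff (two_ne_zero_of_not_isSquare hs) hx]
  rintro ⟨z, -, hz⟩
  exact hs ⟨z, mul_right_cancel₀ hx (by linear_combination hz)⟩

theorem map_upper_ne_one (H : IsPSL2 π) (hs : ¬IsSquare (-1 : F)) {x : F} (hx : x ≠ 0) :
    π (upper x) ≠ 1 := fun h =>
  hx (H.map_upper_injective (two_ne_zero_of_not_isSquare hs) (by simp only [h, upper_zero, map_one]))

theorem center_eq_bot (H : IsPSL2 π) (hs : ¬IsSquare (-1 : F)) {z : S} (hz : ∀ g, g * z = z * g) :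
    z = 1 := by
  have h2 := two_ne_zero_of_not_isSquare hs
  have h1 : ∀ g, z * g * z⁻¹ = g := fun g => by rw [← hz, mul_inv_cancel_right]
  obtain ⟨x, rfl⟩ := H.commute_upper h2 one_ne_zero (h1 _)
  obtain ⟨y, hy⟩ := H.commute_lower h2 one_ne_zero (h1 _)
  have hx : x = 0 := by
    rcases (H.eq_iff _ _).1 hy with h | h
    · exact (SL2.eq_iff.1 h).2.1
    · have := (SL2.eq_iff.1 h).2.1
      simpa [upper, lower] using this
  rw [hx, upper_zero, map_one]

variable [Finite F]

theorem two_mul_card_diagonal (H : IsPSL2 π) (hs : ¬IsSquare (-1 : F)) :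
    2 * Nat.card ((diagonal F).map π) + 1 = Nat.card F := by
  rw [H.two_mul_card_map (two_ne_zero_of_not_isSquare hs) fun _ => neg_mem_diagonal, card_diagonal]
  have : 0 < Nat.card F := Nat.card_pos
  omega

theorem two_mul_card_rotation (H : IsPSL2 π) (hs : ¬IsSquare (-1 : F)) :
    2 * Nat.card ((rotation F).map π) = Nat.card F + 1 := by
  rw [H.two_mul_card_map (two_ne_zero_of_not_isSquare hs) fun _ => neg_mem_rotation,
    card_rotation hs]

theorem cover (H : IsPSL2 π) (hs : ¬IsSquare (-1 : F)) (g : S) :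
    (∃ x y, x * g * x⁻¹ = π (upper y)) ∨ (∃ x, x * g * x⁻¹ ∈ (diagonal F).map π) ∨
      ∃ x, x * g * x⁻¹ ∈ (rotation F).map π := by
  obtain ⟨A, rfl⟩ := H.surjective g
  obtain ⟨P, B, hB, h⟩ := trichotomy (two_ne_zero_of_not_isSquare hs)
    (isSquare_or_isSquare_neg hs) (exists_sq_add_sq_eq hs) A
  have h' : (π P)⁻¹ * π A * (π P)⁻¹⁻¹ = π B := by
    rw [inv_inv, mul_assoc, ← map_mul, h, map_mul, inv_mul_cancel_left]
  rcases hB with hB | hB | ⟨y, hy⟩ | ⟨y, hy⟩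
  · exact Or.inr (Or.inl ⟨_, by rw [h']; exact ⟨B, hB, rfl⟩⟩)
  · exact Or.inr (Or.inr ⟨_, by rw [h']; exact ⟨B, hB, rfl⟩⟩)
  · exact Or.inl ⟨_, y, by rw [h', hy]⟩
  · exact Or.inl ⟨_, y, by rw [h', hy, H.map_neg]⟩

theorem three_dvd_card (F : Type*) [Field F] [Finite F] [CharP F 3] : 3 ∣ Nat.card F := by
  have := Fintype.ofFinite F
  rw [Nat.card_eq_fintype_card]
  have hfact : Fact (Nat.Prime 3) := ⟨Nat.prime_three⟩
  obtain ⟨n, -, hn⟩ := FiniteField.card F 3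
  rw [hn]
  exact dvd_pow_self 3 n.ne_zero

/-- The tori have order prime to 3, so an element of order 3 can only fall under the unipotent case
of the covering. -/
theorem exists_conj_upper [CharP F 3] (H : IsPSL2 π) (hs : ¬IsSquare (-1 : F)) (s : S) (h3 : s ^ 3 = 1)
    (h1 : s ≠ 1) : ∃ x y, y ≠ 0 ∧ x * s * x⁻¹ = π (upper y) := by
  have hcard := three_dvd_card F
  have hx1 : ∀ x, x * s * x⁻¹ ≠ 1 := fun x h => h1 (by rwa [mul_inv_eq_one, mul_eq_left] at h)
  have hx3 : ∀ x, (x * s * x⁻¹) ^ 3 = 1 := fun x => by rw [conj_pow, h3]; simp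
  rcases H.cover hs s with ⟨x, y, hxy⟩ | ⟨x, hx⟩ | ⟨x, hx⟩
  · refine ⟨x, y, ?_, hxy⟩
    rintro rfl
    rw [upper_zero, map_one] at hxy
    exact hx1 x hxy
  · refine absurd (eq_one_of_pow_three_of_not_dvd ?_ hx (hx3 x)) (hx1 x)
    have := H.two_mul_card_diagonal hs
    omega
  · refine absurd (eq_one_of_pow_three_of_not_dvd ?_ hx (hx3 x)) (hx1 x)
    have := H.two_mul_card_rotation hs
    omega

theorem isConj_upper_or (H : IsPSL2 π) (hs : ¬IsSquare (-1 : F)) {x y : F} (hx : x ≠ 0)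
    (hy : y ≠ 0) :
    IsConj (π (upper x)) (π (upper y)) ∨ IsConj (π (upper x)) (π (upper (-y))) := by
  have h2 := two_ne_zero_of_not_isSquare hs
  rw [H.isConj_map_upper_iff h2 hx, H.isConj_map_upper_iff h2 hx]
  refine (isSquare_or_isSquare_neg hs (y / x)).imp ?_ ?_
  · rintro ⟨z, hz⟩
    refine ⟨z, ?_, ?_⟩
    · rintro rfl
      exact div_ne_zero hy hx (by rw [hz, mul_zero])
    · rw [sq, ← hz, div_mul_cancel₀ _ hx]
  · rintro ⟨z, hz⟩
    refine ⟨z, ?_, ?_⟩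
    · rintro rfl
      exact div_ne_zero hy hx (by rw [← neg_eq_zero, hz, mul_zero])
    · rw [sq, ← hz, neg_mul, div_mul_cancel₀ _ hx]

theorem torusDecomposition [CharP F 3] [Finite S] (H : IsPSL2 π) {f : ℕ} (hf : Odd f)
    (hF : Nat.card F = 3 ^ f) :
    TorusDecomposition (3 ^ f) ((diagonal F).map π) ((rotation F).map π) := by
  have hs : ¬IsSquare (-1 : F) := not_isSquare_neg_one hf hF
  have h2 := two_ne_zero_of_not_isSquare hs
  have hcard : 2 * Nat.card S + 3 ^ f = (3 ^ f) ^ 3 := by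
    rw [H.two_mul_card h2, ← hF, card_eq]
  -- A representation of -1 as a sum of two squares provides the matrix that inverts all rotations.
  obtain ⟨r, s, hrs⟩ := exists_sq_add_sq_eq hs (-1)
  let ν : Multiplicative F →* S :=
    { toFun := fun x => π (upper x.toAdd)
      map_one' := by rw [toAdd_one, upper_zero, map_one]
      map_mul' := fun x y => by rw [toAdd_mul, upper_add, map_mul] }
  have hν : Function.Injective ν := fun x y h => H.map_upper_injective h2 h
  have hcube : ∀ n, ν n ^ 3 = 1 := fun n => map_upper_pow_three π _
  obtain ⟨l, hl⟩ := AddChar.exists_apply_ne_zero.2 (one_ne_zero (α := F))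
  have hθ : l.toMonoidHom ≠ 1 := fun h => hl (DFunLike.congr_fun h (Multiplicative.ofAdd 1))
  have hN : Nat.card (Multiplicative F) = 3 ^ f := hF
  have hΦ := indCF_eq_unipotentChar hν hN hcard hcube
    (fun g hg => by
      by_cases hg1 : g = 1
      · exact ⟨1, 1, by simp [hg1]⟩
      · obtain ⟨x, y, -, hxy⟩ := H.exists_conj_upper hs g hg hg1
        exact ⟨x, Multiplicative.ofAdd y, hxy⟩)
    (fun n hn t ht => H.commute_upper h2 hn ht)
    (fun m n hm hn => H.isConj_upper_or hs hm hn)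
    (fun m hm => H.not_isConj_upper_neg hs hm) hθ
  obtain ⟨hint, hself⟩ := cf_unipotentChar hν hN hcube hθ hΦ
  exact {
    three_dvd := dvd_pow_self 3 hf.pos.ne'
    mod_eight := three_pow_mod_eight hf
    torus₁ := H.isTorus_diagonal
    torus₂ := H.isTorus_rotation hs (r := r) (s := s) (by linear_combination -hrs)
    card₁ := by rw [H.two_mul_card_diagonal hs, hF]
    card₂ := by rw [H.two_mul_card_rotation hs, hF]
    card := hcard
    cover := fun g => (H.cover hs g).imp_left (by
      rintro ⟨x, y, hxy⟩
      have := map_upper_pow_three π y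
      rwa [← hxy, conj_pow, mul_inv_eq_one, mul_eq_left] at this)
    exists_unipotent := ⟨π (upper 1), map_upper_pow_three π 1, H.map_upper_ne_one hs one_ne_zero⟩
    isConj_or := fun g h hg hg1 hh hh1 => by
      obtain ⟨x, a, ha, hxa⟩ := H.exists_conj_upper hs g hg hg1
      obtain ⟨y, b, hb, hyb⟩ := H.exists_conj_upper hs h hh hh1
      have e1 : IsConj g (π (upper a)) := isConj_iff.2 ⟨x, hxa⟩
      have e2 : IsConj h (π (upper b)) := isConj_iff.2 ⟨y, hyb⟩
      have e3 : IsConj h⁻¹ (π (upper (-b))) :=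
        isConj_iff.2 ⟨y, by rw [← map_upper_inv, ← hyb]; group⟩
      exact (H.isConj_upper_or hs ha hb).imp (fun h => (e1.trans h).trans e2.symm)
        fun h => (e1.trans h).trans e3.symm
    not_isConj_inv := fun g hg hg1 hcon => by
      obtain ⟨x, a, ha, hxa⟩ := H.exists_conj_upper hs g hg hg1
      have e1 : IsConj g (π (upper a)) := isConj_iff.2 ⟨x, hxa⟩
      have e3 : IsConj g⁻¹ (π (upper (-a))) :=
        isConj_iff.2 ⟨x, by rw [← map_upper_inv, ← hxa]; group⟩
      exact H.not_isConj_upper_neg hs ha ((e1.symm.trans hcon).trans e3)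
    cf_unipotentChar_int := hint
    cf_unipotentChar_self := hself }

theorem exists_standard [CharP F 3] (H : IsPSL2 π) (hs : ¬IsSquare (-1 : F)) (φ : MulAut S) :
    ∃ (c : S) (ε : F) (ρ : F →+* F), (ε = 1 ∨ ε = -1) ∧
      IsStandard π (MulAut.conj c * φ) ε ρ :=
  H.exists_isStandard hs (isSquare_or_isSquare_neg hs) (H.exists_conj_upper hs) φ

theorem conj_mul_mul_inv {φ : MulAut S} (c : S) :
    φ * MulAut.conj c * φ⁻¹ = MulAut.conj (φ c) := by
  ext x
  simp [MulAut.mul_apply]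

theorem innerAut_normal : (innerAut S).Normal :=
  ⟨by rintro _ ⟨c, rfl⟩ φ; exact ⟨φ c, (conj_mul_mul_inv c).symm⟩⟩

/-- The outer automorphism group of `PSL₂(F)` is abelian. -/
theorem commutator_mem_innerAut [CharP F 3] (H : IsPSL2 π) (hs : ¬IsSquare (-1 : F)) (φ φ' : MulAut S) :
    φ * φ' * φ⁻¹ * φ'⁻¹ ∈ innerAut S := by
  have := innerAut_normal (S := S)
  obtain ⟨c, ε, ρ, hε, h⟩ := H.exists_standard hs φ
  obtain ⟨c', ε', ρ', hε', h'⟩ := H.exists_standard hs φ'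
  -- Standard forms commute: field automorphisms of a finite field commute with each other and fix
  -- the signs.
  have e : ∀ {ε : F} (ρ : F →+* F), (ε = 1 ∨ ε = -1) → ρ ε = ε := by
    rintro _ ρ (rfl | rfl) <;> simp
  have h1 := h.mul h'
  have h2 := h'.mul h
  rw [e ρ hε'] at h1
  rw [e ρ' hε, comp_comm_of_finite ρ' ρ, mul_comm ε' ε] at h2
  have h3 := h1.ext H h2
  rw [← QuotientGroup.eq_one_iff, QuotientGroup.mk_mul, QuotientGroup.mk_mul, QuotientGroup.mk_mul,
    QuotientGroup.mk_inv, QuotientGroup.mk_inv, mul_inv_eq_one, mul_inv_eq_iff_eq_mul,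
    ← QuotientGroup.mk_mul, ← QuotientGroup.mk_mul]
  have h4 := congrArg (QuotientGroup.mk : MulAut S → MulAut S ⧸ innerAut S) h3
  have hc : ∀ c : S, (QuotientGroup.mk (MulAut.conj c) : MulAut S ⧸ innerAut S) = 1 :=
    fun c => (QuotientGroup.eq_one_iff _).2 ⟨c, rfl⟩
  simpa only [QuotientGroup.mk_mul, hc, one_mul] using h4

/-- Preserving the class of `upper 1` forces the sign to be 1, because `upper (-1)` lies in the
other class. The standard form is then a pure field automorphism, of order dividing `f`. -/
theorem pow_mem_innerAut [CharP F 3] (H : IsPSL2 π) (hs : ¬IsSquare (-1 : F)) {f : ℕ}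
    (hF : Nat.card F = 3 ^ f) {φ : MulAut S}
    (hφ : IsConj (π (upper 1)) (φ (π (upper 1)))) : φ ^ f ∈ innerAut S := by
  have := innerAut_normal (S := S)
  obtain ⟨c, ε, ρ, hε, h⟩ := H.exists_standard hs φ
  have hε1 : ε = 1 := by
    refine hε.resolve_right ?_
    rintro rfl
    refine H.not_isConj_upper_neg hs one_ne_zero (hφ.trans (isConj_iff.2 ⟨c, ?_⟩))
    have := (h 1).1
    rwa [map_one, mul_one] at this
  subst hε1
  have hpow : ∀ n : ℕ, ∀ x, ((MulAut.conj c * φ) ^ n) (π (upper x)) = π (upper (ρ^[n] x)) ∧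
      ((MulAut.conj c * φ) ^ n) (π (lower x)) = π (lower (ρ^[n] x)) := by
    intro n
    induction n with
    | zero => intro x; simp
    | succ n ih =>
      intro x
      rw [pow_succ, MulAut.mul_apply, (h x).1, MulAut.mul_apply, (h x).2, one_mul, (ih _).1,
        (ih _).2, Function.iterate_succ_apply]
      exact ⟨rfl, rfl⟩
  have h1 : (MulAut.conj c * φ) ^ f = 1 := H.mulEquiv_ext
    (fun x => by rw [(hpow f x).1, iterate_eq_self hF]; rfl)
    (fun x => by rw [(hpow f x).2, iterate_eq_self hF]; rfl)
  rw [← QuotientGroup.eq_one_iff, QuotientGroup.mk_pow]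
  have h4 := congrArg (QuotientGroup.mk : MulAut S → MulAut S ⧸ innerAut S) h1
  have hc : (QuotientGroup.mk (MulAut.conj c) : MulAut S ⧸ innerAut S) = 1 :=
    (QuotientGroup.eq_one_iff _).2 ⟨c, rfl⟩
  simpa only [QuotientGroup.mk_mul, QuotientGroup.mk_pow, hc, one_mul, QuotientGroup.mk_one] using h4

end IsPSL2

end Decomposition

/-! ### Groups between Inn(S) and Aut(S): the fused and the unfused case. -/

section Main

/-- By Cauchy an even index would give an element of order 2 in the quotient, where every element
has order dividing the odd number `f`. -/
theorem odd_index_of_forall_pow_mem {K : Type*} [Group K] [Finite K] (R : Subgroup K) [R.Normal]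
    {f : ℕ} (hf : Odd f) (h : ∀ k, k ^ f ∈ R) : Odd R.index := by
  rw [← Nat.not_even_iff_odd, even_iff_two_dvd]
  intro h2
  rw [Subgroup.index_eq_card] at h2
  have hp : Fact (Nat.Prime 2) := ⟨Nat.prime_two⟩
  obtain ⟨x, hx⟩ := exists_prime_orderOf_dvd_card' 2 h2
  obtain ⟨k, rfl⟩ := QuotientGroup.mk_surjective x
  have h1 : (QuotientGroup.mk k : K ⧸ R) ^ f = 1 := by
    rw [← QuotientGroup.mk_pow, QuotientGroup.eq_one_iff]
    exact h k
  have h3 := orderOf_dvd_of_pow_eq_one h1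
  rw [hx, ← even_iff_two_dvd, ← Nat.not_odd_iff_even] at h3
  exact h3 hf

variable {S : Type*} [Group S] {G : Subgroup (MulAut S)}

/-- The map sending an element to the inner automorphism it defines. -/
def innerHom (hG : innerAut S ≤ G) : S →* G :=
  (MulAut.conj : S →* MulAut S).codRestrict G fun s => hG ⟨s, rfl⟩

theorem mem_range_innerHom (hG : innerAut S ≤ G) {g : G} :
    g ∈ (innerHom hG).range ↔ (g : MulAut S) ∈ innerAut S :=
  ⟨fun ⟨s, hs⟩ => ⟨s, congrArg Subtype.val hs⟩, fun ⟨s, hs⟩ => ⟨s, Subtype.ext hs⟩⟩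

theorem normalEmbedding_innerHom (hG : innerAut S ≤ G)
    (hinj : Function.Injective (MulAut.conj : S →* MulAut S)) :
    NormalEmbedding (innerHom hG) G.subtype where
  injective := fun _ _ h => hinj (congrArg Subtype.val h)
  map_act := fun g s => Subtype.ext (IsPSL2.conj_mul_mul_inv (φ := (g : MulAut S)) s).symm

theorem innerHom_conj (hG : innerAut S ≤ G)
    (hinj : Function.Injective (MulAut.conj : S →* MulAut S)) (g : G) (s : S) :
    g * innerHom hG s * g⁻¹ = innerHom hG ((g : MulAut S) s) :=
  ((normalEmbedding_innerHom hG hinj).map_act g s).symm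

/-- Conjugating an inner automorphism by φ amounts to applying φ to the element of `S`, and the
generators of a cyclic group are the powers with exponent prime to its order. -/
theorem isRationalElement_innerHom_iff [Finite S] (hG : innerAut S ≤ G)
    (hinj : Function.Injective (MulAut.conj : S →* MulAut S)) (x : S) :
    IsRationalElement (innerHom hG x) ↔
      ∀ k : ℕ, k.Coprime (orderOf x) → ∃ φ ∈ G, φ x = x ^ k := by
  have E := normalEmbedding_innerHom hG hinj
  have hord : orderOf (innerHom hG x) = orderOf x := orderOf_injective _ E.injective x
  constructor
  · intro h k hk
    have h1 : Subgroup.zpowers (innerHom hG x ^ k) = Subgroup.zpowers (innerHom hG x) := by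
      apply le_antisymm
      · exact Subgroup.zpowers_le.2 (Subgroup.npow_mem_zpowers _ k)
      · obtain ⟨m, hm⟩ := exists_pow_eq_self_of_coprime
          (show k.Coprime (orderOf (innerHom hG x)) by rwa [hord])
        rw [Subgroup.zpowers_le]
        have h2 := Subgroup.npow_mem_zpowers (innerHom hG x ^ k) m
        rwa [hm] at h2
    obtain ⟨g, hg⟩ := isConj_iff.1 (h _ h1)
    rw [innerHom_conj hG hinj, ← map_pow] at hg
    exact ⟨g, g.2, E.injective hg⟩
  · intro h y hy
    have hy' : y ∈ Subgroup.zpowers (innerHom hG x) := hy ▸ Subgroup.mem_zpowers y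
    obtain ⟨k, rfl⟩ := (mem_powers_iff_mem_zpowers (x := innerHom hG x)).2 hy'
    simp only at hy ⊢
    have h2 : orderOf (innerHom hG x ^ k) = orderOf (innerHom hG x) := by
      rw [← Nat.card_zpowers, hy, Nat.card_zpowers]
    rw [orderOf_pow, hord] at h2
    have hk : k.Coprime (orderOf x) := by
      have hpos := orderOf_pos x
      rcases Nat.div_eq_self.1 h2 with h3 | h3
      · exact absurd h3 hpos.ne'
      · exact (Nat.coprime_comm).1 h3
    obtain ⟨φ, hφ, hφx⟩ := h k hk
    refine isConj_iff.2 ⟨⟨φ, hφ⟩, ?_⟩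
    rw [innerHom_conj hG hinj, ← map_pow, ← hφx]

theorem hasRationalEvenCharacter_of_exists (hG : innerAut S ≤ G)
    (h : ∃ χ : G → ℂ, IsIrreducibleCharacter χ ∧ IsRationalCharacter χ ∧ HasEvenDegree χ ∧
      ∃ n, χ (innerHom hG n) ≠ χ 1) : HasRationalEvenCharacter G := by
  obtain ⟨χ, h1, h2, h3, n, hn⟩ := h
  exact ⟨χ, h1, h2, h3, fun hsub => hn (hsub ((mem_range_innerHom hG).1 ⟨n, rfl⟩))⟩

theorem isConj_inv_inv {a b : S} (h : IsConj a b) : IsConj a⁻¹ b⁻¹ := by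
  obtain ⟨c, rfl⟩ := isConj_iff.1 h
  exact isConj_iff.2 ⟨c, by group⟩

/-- The elements of a group of automorphisms fixing the class of an element of order three. -/
def classStabilizer (G : Subgroup (MulAut S)) (u : S) : Subgroup G where
  carrier := {g | IsConj u ((g : MulAut S) u)}
  mul_mem' := fun {g h} hg hh => hg.trans ((g : MulAut S).toMonoidHom.map_isConj hh)
  one_mem' := IsConj.refl u
  inv_mem' := fun {g} hg => by
    have := (g : MulAut S)⁻¹.toMonoidHom.map_isConj hg
    simpa using this.symm

theorem mem_classStabilizer {u : S} {g : G} :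
    g ∈ classStabilizer G u ↔ IsConj u ((g : MulAut S) u) := Iff.rfl

theorem range_innerHom_le_classStabilizer (hG : innerAut S ≤ G) (u : S) :
    (innerHom hG).range ≤ classStabilizer G u := by
  rintro _ ⟨s, rfl⟩
  exact isConj_iff.2 ⟨s, rfl⟩

namespace TorusDecomposition

variable [Finite S] {q : ℕ} {T₁ T₂ : Subgroup S}

/-- Every element of order 3 is conjugate to `u` or to its inverse, so it suffices to test the class
of `u`. -/
theorem isConj_apply (D : TorusDecomposition q T₁ T₂) {φ : MulAut S} {u : S} (hu : u ^ 3 = 1)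
    (hu1 : u ≠ 1) (h : IsConj u (φ u)) {g : S} (hg : g ^ 3 = 1) (hg1 : g ≠ 1) :
    IsConj g (φ g) := by
  have hmap : ∀ {a b : S}, IsConj a b → IsConj (φ a) (φ b) := fun h =>
    φ.toMonoidHom.map_isConj h
  have hinv : IsConj u⁻¹ (φ u⁻¹) := by
    rw [map_inv]
    exact isConj_inv_inv h
  rcases D.isConj_or g u hg hg1 hu hu1 with h' | h'
  · exact (h'.trans h).trans (hmap h').symm
  · exact (h'.trans hinv).trans (hmap h').symm

theorem isConj_inv_apply (D : TorusDecomposition q T₁ T₂) {φ : MulAut S} {u : S} (hu : u ^ 3 = 1)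
    (hu1 : u ≠ 1) (h : IsConj u⁻¹ (φ u)) {g : S} (hg : g ^ 3 = 1) (hg1 : g ≠ 1) :
    IsConj g⁻¹ (φ g) := by
  have hmap : ∀ {a b : S}, IsConj a b → IsConj (φ a) (φ b) := fun h =>
    φ.toMonoidHom.map_isConj h
  rcases D.isConj_or g u hg hg1 hu hu1 with h' | h'
  · exact ((isConj_inv_inv h').trans h).trans (hmap h').symm
  · have h1 := isConj_inv_inv h
    rw [inv_inv, ← map_inv] at h1
    have h2 := isConj_inv_inv h'
    rw [inv_inv] at h2
    exact (h2.trans h1).trans (hmap h').symm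

theorem isConj_apply_or (D : TorusDecomposition q T₁ T₂) (φ : MulAut S) {u : S} (hu : u ^ 3 = 1)
    (hu1 : u ≠ 1) : IsConj u (φ u) ∨ IsConj u⁻¹ (φ u) := by
  refine D.isConj_or _ _ hu hu1 ?_ ?_ |>.imp id fun h => ?_
  · rw [← map_pow, hu, map_one]
  · rwa [Ne, map_eq_one_iff _ φ.injective]
  · simpa using isConj_inv_inv h

theorem index_classStabilizer (D : TorusDecomposition q T₁ T₂) {u : S} (hu : u ^ 3 = 1)
    (hu1 : u ≠ 1) {t : G} (ht : IsConj u⁻¹ ((t : MulAut S) u)) :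
    (classStabilizer G u).index = 2 := by
  rw [Subgroup.index_eq_two_iff]
  refine ⟨t, fun b => ?_⟩
  have hbt : IsConj ((b : MulAut S) u)⁻¹ ((b : MulAut S) ((t : MulAut S) u)) := by
    rw [← map_inv]
    exact (b : MulAut S).toMonoidHom.map_isConj ht
  rw [mem_classStabilizer, mem_classStabilizer, Subgroup.coe_mul, MulAut.mul_apply]
  by_cases hb : IsConj u ((b : MulAut S) u)
  · exact Or.inr ⟨hb, fun h => D.not_isConj_inv u hu hu1
      ((h.trans hbt.symm).trans (isConj_inv_inv hb).symm)⟩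
  · refine Or.inl ⟨?_, hb⟩
    have := isConj_inv_inv ((D.isConj_apply_or b hu hu1).resolve_left hb)
    rw [inv_inv] at this
    exact this.trans hbt

end TorusDecomposition

namespace IsPSL2

open SL2

variable {F : Type*} [Field F] {π : SL2 F →* S}

theorem conj_injective (H : IsPSL2 π) (hs : ¬IsSquare (-1 : F)) :
    Function.Injective (MulAut.conj : S →* MulAut S) := by
  rw [injective_iff_map_eq_one]
  intro z hz
  refine H.center_eq_bot hs fun g => ?_
  have := DFunLike.congr_fun hz g
  rw [MulAut.conj_apply, MulAut.one_apply, mul_inv_eq_iff_eq_mul] at this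
  exact this.symm

variable [Finite F] [CharP F 3] [Finite S] {f : ℕ}

/-- A group of automorphisms fixing a class of elements of order three is an extension of the inner
automorphism group by a group of odd order. -/
theorem exists_card_eq (H : IsPSL2 π) (hf : Odd f) (hF : Nat.card F = 3 ^ f)
    (hG : innerAut S ≤ G) (K : Subgroup G) (hK : (innerHom hG).range ≤ K)
    (hfix : ∀ g ∈ K, IsConj (π (upper 1)) ((g : MulAut S) (π (upper 1)))) :
    ∃ d, Odd d ∧ Nat.card K = Nat.card S * d := by
  have hs := not_isSquare_neg_one hf hF
  have E := normalEmbedding_innerHom hG (H.conj_injective hs)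
  set R := (innerHom hG).range.subgroupOf K with hR
  have hnR : (innerHom hG).range.Normal := by
    refine ⟨?_⟩
    rintro _ ⟨s, rfl⟩ g
    exact ⟨_, E.map_act g s⟩
  have hRn : R.Normal := hnR.subgroupOf K
  refine ⟨R.index, odd_index_of_forall_pow_mem R hf fun k => ?_, ?_⟩
  · rw [hR, Subgroup.mem_subgroupOf, mem_range_innerHom]
    exact H.pow_mem_innerAut hs hF (hfix k k.2)
  · rw [← R.card_mul_index, hR, Nat.card_congr (Subgroup.subgroupOfEquivOfLe hK).toEquiv,
      ← Nat.card_congr (MonoidHom.ofInjective E.injective).toEquiv]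

/-- A group of automorphisms fusing an element of order three to its inverse has a rational
irreducible character of even degree. -/
theorem hasRationalEvenCharacter_of_fused (H : IsPSL2 π) (hf : Odd f) (hF : Nat.card F = 3 ^ f)
    (hG : innerAut S ≤ G) {t : G} (ht : IsConj (π (upper 1))⁻¹ ((t : MulAut S) (π (upper 1)))) :
    HasRationalEvenCharacter G := by
  have hs := not_isSquare_neg_one hf hF
  have D := H.torusDecomposition hf hF
  have hinj := H.conj_injective hs
  have E := normalEmbedding_innerHom hG hinj
  have hu : π (upper 1) ^ 3 = 1 := map_upper_pow_three π 1
  have hu1 : π (upper 1) ≠ 1 := H.map_upper_ne_one hs one_ne_zero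
  obtain ⟨ψ, hψ, hne⟩ := exists_nonreal (D.not_isConj_inv _ hu hu1)
  obtain ⟨d, hd, hcard⟩ := H.exists_card_eq hf hF hG (classStabilizer G (π (upper 1)))
    (range_innerHom_le_classStabilizer hG _) fun g hg => hg
  refine hasRationalEvenCharacter_of_exists hG (E.exists_rational_even_of_index_two
    (classStabilizer G (π (upper 1))) (D.index_classStabilizer hu hu1 ht)
    (range_innerHom_le_classStabilizer hG _) hd hcard (t := t) (fun h => ?_) (fun k _ => ?_) hψ
    (fun k hk => ?_) ?_ hne (D.ringEquiv_comp_eq hψ hne))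
  · exact D.not_isConj_inv _ hu hu1 (h.trans ht.symm)
  -- `t` acts trivially modulo inner automorphisms because Out(S) is abelian.
  · rw [mem_range_innerHom]
    exact H.commutator_mem_innerAut hs t k
  · exact D.comp_eq_self hψ hne fun g hg hg1 => D.isConj_apply hu hu1 hk hg hg1
  · exact D.comp_eq_inv hψ hne fun g hg hg1 => D.isConj_inv_apply hu hu1 ht hg hg1

/-- The element `upper 1` has order 3, so the only other generator of its subgroup is its inverse,
to which `t` fuses it. -/
theorem hasRationalOddElement_of_fused (H : IsPSL2 π) (hf : Odd f) (hF : Nat.card F = 3 ^ f)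
    (hG : innerAut S ≤ G) {t : G} (ht : IsConj (π (upper 1))⁻¹ ((t : MulAut S) (π (upper 1)))) :
    HasRationalOddElement G := by
  have hs := not_isSquare_neg_one hf hF
  have hinj := H.conj_injective hs
  have E := normalEmbedding_innerHom hG hinj
  have hu : π (upper 1) ^ 3 = 1 := map_upper_pow_three π 1
  have hu1 : π (upper 1) ≠ 1 := H.map_upper_ne_one hs one_ne_zero
  have hord : orderOf (π (upper 1)) = 3 := orderOf_eq_prime hu hu1
  refine ⟨innerHom hG (π (upper 1)), ⟨_, rfl⟩, ?_, ?_, ?_⟩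
  · rwa [Ne, _root_.map_eq_one_iff _ E.injective]
  · rw [orderOf_injective _ E.injective, hord]
    decide
  · rw [isRationalElement_innerHom_iff hG hinj, hord]
    intro k hk
    have h3 : k % 3 = 1 ∨ k % 3 = 2 := by
      have : k % 3 ≠ 0 := fun h => by
        have := Nat.dvd_gcd (Nat.dvd_of_mod_eq_zero h) (dvd_refl 3)
        rw [hk] at this
        omega
      omega
    have hmod : π (upper 1) ^ k = π (upper 1) ^ (k % 3) := by rw [← hord, pow_mod_orderOf]
    rw [hmod]
    rcases h3 with h3 | h3 <;> rw [h3]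
    · exact ⟨1, G.one_mem, by simp⟩
    · obtain ⟨c, hc⟩ := isConj_iff.1 ht.symm
      refine ⟨MulAut.conj c * t, G.mul_mem (hG ⟨c, rfl⟩) t.2, ?_⟩
      rw [MulAut.mul_apply, MulAut.conj_apply, hc, inv_eq_iff_mul_eq_one, ← pow_succ', hu]

/-- In a group of automorphisms fixing the classes of elements of order three, a rational irreducible
character of even degree yields a rational element of odd order. -/
theorem hasRationalOddElement_of_character (H : IsPSL2 π) (hf : Odd f) (hF : Nat.card F = 3 ^ f)
    (hG : innerAut S ≤ G)
    (hfix : ∀ g ∈ G, IsConj (π (upper 1)) (g (π (upper 1))))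
    (h : HasRationalEvenCharacter G) : HasRationalOddElement G := by
  have hs := not_isSquare_neg_one hf hF
  have D := H.torusDecomposition hf hF
  have hinj := H.conj_injective hs
  have E := normalEmbedding_innerHom hG hinj
  obtain ⟨d, hd, hcard⟩ := H.exists_card_eq hf hF hG ⊤ le_top fun g _ => hfix g g.2
  rw [Subgroup.card_top] at hcard
  obtain ⟨χ, hχ, hrat, heven, -⟩ := h
  obtain ⟨ψ, hψ, -, hreal, hev, hgal⟩ := E.exists_under_rational_even hd hcard hχ hrat heven
  have hgal' : ∀ σ : ℂ ≃+* ℂ, ∃ φ ∈ G, σ ∘ ψ = ψ ∘ φ := fun σ =>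
    let ⟨x, hx⟩ := hgal σ
    ⟨x, x.2, hx⟩
  have P := D.torusOfSign₁
  have P' := D.torusOfSign₂
  obtain ⟨x, hx1, hxodd, hx⟩ : ∃ x : S, x ≠ 1 ∧ Odd (orderOf x) ∧
      ∀ k : ℕ, k.Coprime (orderOf x) → ∃ φ ∈ G, φ x = x ^ k := by
    rcases D.exists_eq_torusChar hψ hreal hev with ⟨θ, hθ, rfl⟩ | ⟨θ, hθ, rfl⟩
    · exact P.exists_fused_powers hG hθ
        (fun t ht h2 φ => exists_conj_mem_of_cover P P' (by decide) D.cover ht h2 φ) hgal'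
    · exact P'.exists_fused_powers hG hθ
        (fun t ht h2 φ => exists_conj_mem_of_cover P' P (by decide)
          (fun g => (D.cover g).imp_right Or.symm) ht h2 φ) hgal'
  refine ⟨innerHom hG x, ⟨_, rfl⟩, ?_, ?_, (isRationalElement_innerHom_iff hG hinj x).2 hx⟩
  · rwa [Ne, _root_.map_eq_one_iff _ E.injective]
  · rwa [orderOf_injective _ E.injective]

/-- In a group of automorphisms fixing the classes of elements of order three, a rational element of
odd order yields a rational irreducible character of even degree. -/
theorem hasRationalEvenCharacter_of_element (H : IsPSL2 π) (hf : Odd f) (hF : Nat.card F = 3 ^ f)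
    (hG : innerAut S ≤ G)
    (hfix : ∀ g ∈ G, IsConj (π (upper 1)) (g (π (upper 1))))
    (h : HasRationalOddElement G) : HasRationalEvenCharacter G := by
  have hs := not_isSquare_neg_one hf hF
  have D := H.torusDecomposition hf hF
  have hinj := H.conj_injective hs
  have E := normalEmbedding_innerHom hG hinj
  have hu : π (upper 1) ^ 3 = 1 := map_upper_pow_three π 1
  have hu1 : π (upper 1) ≠ 1 := H.map_upper_ne_one hs one_ne_zero
  obtain ⟨d, hd, hcard⟩ := H.exists_card_eq hf hF hG ⊤ le_top fun g _ => hfix g g.2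
  rw [Subgroup.card_top] at hcard
  obtain ⟨x, hx, hx1, hodd, hrat⟩ := h
  obtain ⟨s, rfl⟩ := (mem_range_innerHom hG).2 hx
  rw [isRationalElement_innerHom_iff hG hinj] at hrat
  rw [orderOf_injective _ E.injective] at hodd
  have hs1 : s ≠ 1 := fun h => hx1 (by rw [h, map_one])
  have htorus : ∀ {ε : ℤ} {T : Subgroup S}, TorusOfSign (3 ^ f) ε T → (∃ c, c * s * c⁻¹ ∈ T) →
      HasRationalEvenCharacter G := by
    rintro ε T P ⟨c, hc⟩
    have hord : orderOf (c * s * c⁻¹) = orderOf s := (MulAut.conj c).orderOf_eq s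
    obtain ⟨θ, hθ, hgal⟩ := P.exists_fused_torusChar (G := G) hc
      (fun h => hs1 (by rwa [mul_inv_eq_one, mul_eq_left] at h)) (by rwa [hord]) (by
        rw [hord]
        intro k hk
        obtain ⟨φ, hφ, hφs⟩ := hrat k hk
        refine ⟨MulAut.conj c * φ * (MulAut.conj c)⁻¹,
          G.mul_mem (G.mul_mem (hG ⟨c, rfl⟩) hφ) (G.inv_mem (hG ⟨c, rfl⟩)), ?_⟩
        have : (MulAut.conj c)⁻¹ (c * s * c⁻¹) = s := MulAut.inv_apply_self S (MulAut.conj c) s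
        rw [MulAut.mul_apply, MulAut.mul_apply, this, hφs, MulAut.conj_apply, conj_pow])
    exact hasRationalEvenCharacter_of_exists hG (E.exists_rational_even_of_odd hd hcard
      (P.isIrreducibleCharacter hθ) (P.torusChar_inv _) (P.hasEvenDegree θ) fun σ =>
        let ⟨φ, hφ, h⟩ := hgal σ
        ⟨⟨φ, hφ⟩, h⟩)
  rcases D.cover s with h3 | h | h
  -- A rational element of order 3 would be fused to its inverse by `G`, which preserves the two
  -- classes of such elements.
  · exfalso
    have hord : orderOf s = 3 := orderOf_eq_prime h3 hs1
    obtain ⟨φ, hφ, hφs⟩ := hrat 2 (by rw [hord]; decide)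
    have h4 := D.isConj_apply hu hu1 (hfix φ hφ) h3 hs1
    have h5 : s ^ 2 = s⁻¹ := by rw [eq_inv_iff_mul_eq_one, ← pow_succ, h3]
    rw [hφs, h5] at h4
    exact D.not_isConj_inv s h3 hs1 h4
  · exact htorus D.torusOfSign₁ h
  · exact htorus D.torusOfSign₂ h

/-- A copy of `PGL₂(F)` fuses an element of order three to its inverse. -/
theorem exists_fused_of_mulEquiv (H : IsPSL2 π) (hf : Odd f) (hF : Nat.card F = 3 ^ f)
    (hG : innerAut S ≤ G) (e : G ≃* Matrix.ProjGenLinGroup (Fin 2) F) :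
    ∃ t ∈ G, IsConj (π (upper 1))⁻¹ (t (π (upper 1))) := by
  have hs := not_isSquare_neg_one hf hF
  have D := H.torusDecomposition hf hF
  by_contra! hcon
  -- Without such fusion the order of `G` would be an odd multiple of that of `S`, whereas PGL₂ has
  -- the order of SL₂, twice that of `S`.
  obtain ⟨d, hd, hcard⟩ := H.exists_card_eq hf hF hG ⊤ le_top fun g _ =>
    (D.isConj_apply_or (g : MulAut S) (map_upper_pow_three π 1)
      (H.map_upper_ne_one hs one_ne_zero)).resolve_right (hcon g g.2)
  rw [Subgroup.card_top, Nat.card_congr e.toEquiv, card_projGenLinGroup,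
    ← H.two_mul_card (two_ne_zero_of_not_isSquare hs), mul_comm] at hcard
  have := Nat.eq_of_mul_eq_mul_left Nat.card_pos hcard
  rw [← this] at hd
  exact absurd hd (by decide)

end IsPSL2

end Main

theorem proposition2p6 (f : ℕ) (hf : Odd f) {S : Type*} [Group S]
    (hS : Nonempty (S ≃* Matrix.ProjectiveSpecialLinearGroup (Fin 2) (GaloisField 3 f)))
    (G : Subgroup (MulAut S)) (hG : innerAut S < G) :
    (HasRationalOddElement G ↔ HasRationalEvenCharacter G) ∧
    ((∃ H : Subgroup (MulAut S), innerAut S < H ∧ H ≤ G ∧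
        Nonempty (H ≃* Matrix.ProjGenLinGroup (Fin 2) (GaloisField 3 f))) →
      HasRationalEvenCharacter G ∧ HasRationalOddElement G) := by
  obtain ⟨e⟩ := hS
  have hfact : Fact (Nat.Prime 3) := ⟨Nat.prime_three⟩
  have hF : Nat.card (GaloisField 3 f) = 3 ^ f := GaloisField.card 3 f hf.pos.ne'
  obtain ⟨π, H⟩ : ∃ π : SL2 (GaloisField 3 f) →* S, IsPSL2 π :=
    ⟨_, IsPSL2.isPSL2_mk'.comp_mulEquiv e.symm⟩
  have hfin : Finite S := Finite.of_surjective _ H.surjective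
  have D := H.torusDecomposition hf hF
  have hs := not_isSquare_neg_one hf hF
  constructor
  -- With fusion both properties hold outright. Without it `G` preserves both classes of elements of
  -- order 3 and the two odd-index arguments apply.
  · by_cases hcon : ∃ t ∈ G, IsConj (π (SL2.upper 1))⁻¹ (t (π (SL2.upper 1)))
    · obtain ⟨t, htG, ht⟩ := hcon
      exact iff_of_true (H.hasRationalOddElement_of_fused hf hF hG.le (t := ⟨t, htG⟩) ht)
        (H.hasRationalEvenCharacter_of_fused hf hF hG.le (t := ⟨t, htG⟩) ht)
    · push Not at hcon
      have hfix := fun g hg => (D.isConj_apply_or g (IsPSL2.map_upper_pow_three π 1)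
        (H.map_upper_ne_one hs one_ne_zero)).resolve_right (hcon g hg)
      exact ⟨H.hasRationalEvenCharacter_of_element hf hF hG.le hfix,
        H.hasRationalOddElement_of_character hf hF hG.le hfix⟩
  · rintro ⟨L, hL, hLG, ⟨e'⟩⟩
    obtain ⟨t, htL, ht⟩ := H.exists_fused_of_mulEquiv hf hF hL.le e'
    exact ⟨H.hasRationalEvenCharacter_of_fused hf hF hG.le (t := ⟨t, hLG htL⟩) ht,
      H.hasRationalOddElement_of_fused hf hF hG.le (t := ⟨t, hLG htL⟩) ht⟩
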